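/- Let $M$ be a complex manifold of dimension $n$ with a Kähler–Poisson structure, i.e. a (complex-valued) Poisson tensor of type $(1,1)$, with Poisson bracket $\{\cdot,\cdot\}$; in holomorphic coordinates $z^k$ put $g^{lk}=\{\bar z^l,z^k\}$. A star product $f\ast g=\sum_{r\ge0}\nu^rC_r(f,g)$ on $M$ (an associative product on $C^\infty(M)[[\nu]]$ with unit $1$ given by bidifferential operators $C_r$, with $C_0(f,g)=fg$ and $C_1(f,g)-C_1(g,f)=\{f,g\}$) is said to be with separation of variables if every $C_r$ differentiates its first argument only in antiholomorphic and its second argument only in holomorphic directions. Its formal Berezin transform is the formal differential operator $B$ with $B(ab)=b\ast a$ for all local holomorphic functions $a$ and local antiholomorphic functions $b$. Denote by $L_f,R_f$ the operators of left and right star multiplication by $f$. A formal differential operator $A=\sum_r\nu^rA_r$ is natural if $A_r$ has order at most $r$ for all $r$; its $\sigma$-symbol is $\sigma(A)=\sum_r\sigma_r(A_r)$, where $\sigma_r(A_r)$ is the principal symbol of order $r$, regarded as an element of the algebra $C^\infty(T^\ast M,Z)$ of functions on the formal neighbourhood of the zero section $Z$ of $T^\ast M$ (formal power series in the fibre coordinates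 $\zeta_k,\bar\zeta_l$ dual to $z^k,\bar z^l$, with smooth coefficients, compatible with changes of holomorphic coordinates). Let $\{\cdot,\cdot\}_{T^\ast M}$ be the Poisson bracket of the standard symplectic structure, $\{\zeta_k,f\}_{T^\ast M}=\partial f/\partial z^k$ and $\{\bar\zeta_l,f\}_{T^\ast M}=\partial f/\partial\bar z^l$ for functions $f$ on $M$, and $H_KQ=\{K,Q\}_{T^\ast M}$. Let $\epsilon$ be a formal parameter with $\epsilon^2=0$ and extend the bracket $\epsilon$-linearly. Let $\mathcal K[\epsilon]$ be the set of all $F=K+\epsilon J\in C^\infty(T^\ast M,Z)[\epsilon]$ whose expansion into homogeneous components in the fibre variables starts at least with the quadratic term and such that $$\{e^{H_F}a,\tilde a\}_{T^\ast M}=0\quad\text{and}\quad\{e^{H_F}b,\tilde b\}_{T^\ast M}=0$$ for all local holomorphic functions $a,\tilde a$ and local antiholomorphic functions $b,\tilde b$; let $\mathcal K$ be the analogous set of elements $K\in C^\infty(T^\ast M,Z)$. Proposition. Let $\ast$ and $\tilde\ast$ be two star products with separation of variables on the same Kähler–Poisson manifold $M$, with formal Berezin transforms $B=\exp(\frac1\nu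 X)$ and $\tilde B=\exp(\frac1\nu\tilde X)$, where $X=\nu^2X_2+\nu^3X_3+\cdots$ and $\tilde X=\nu^2\tilde X_2+\nu^3\tilde X_3+\cdots$ are formal differential operators. Then: (1) For every local function $f$ (a smooth function on the domain of a holomorphic coordinate chart) the operators $L_f,\tilde L_f,R_f,\tilde R_f$ are natural, $\sigma(L_f)=\sigma(\tilde L_f)$, $\sigma(R_f)=\sigma(\tilde R_f)$, and $\frac1\nu(L_f-\tilde L_f)$ and $\frac1\nu(R_f-\tilde R_f)$ are natural. Hence the source and target mappings of the deformation groupoid of the pair $(\ast,\tilde\ast)$, $$Sf=\sigma(L_f)+\epsilon\,\sigma\left(\tfrac1\nu(L_f-\tilde L_f)\right),\qquad Tf=\sigma(R_f)+\epsilon\,\sigma\left(\tfrac1\nu(R_f-\tilde R_f)\right),$$ are well defined. (2) $X$, $\tilde X$ and $\frac1\nu(X-\tilde X)$ are natural, and $\sigma(X)=\sigma(\tilde X)=K$, where $K$ is the unique element of $\mathcal K$ whose quadratic component is $K_2=g^{lk}\zeta_k\bar\zeta_l$ in all holomorphic coordinates. (3) Put $J=\sigma\left(\frac1\nu(X-\tilde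 X)\right)$ and $F=K+\epsilon J$. Then $F\in\mathcal K[\epsilon]$, and for all local holomorphic functions $a$ and local antiholomorphic functions $b$, $$e^{H_F}b=Sb\quad\text{and}\quad e^{H_F}a=Ta .$$ -/

import Mathlib

open scoped Manifold ContDiff
open TopologicalSpace

noncomputable section

namespace BerezinLog

/-! ## Differential operators on a commutative algebra, natural formal operators -/

section Algebra

variable {R : Type*} [CommRing R] [Algebra ℂ R]

/-- The operator of pointwise multiplication by `f`. -/
abbrev mulOp (f : R) : Module.End ℂ R := LinearMap.mulLeft ℂ f

/-- `HasOrder r A`: `A` is a differential operator of order not greater than `r`, i.e. all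
`(r + 1)`-fold commutators of `A` with operators of multiplication by functions vanish. -/
def HasOrder : ℕ → Module.End ℂ R → Prop
  | 0, A => ∀ f : R, A * mulOp f - mulOp f * A = 0
  | r + 1, A => ∀ f : R, HasOrder r (A * mulOp f - mulOp f * A)

/-- A formal operator `A = A₀ + ν A₁ + …` is natural if the order of `A_r` is at most `r`. -/
def IsNatural (A : PowerSeries (Module.End ℂ R)) : Prop :=
  ∀ r, HasOrder r (PowerSeries.coeff r A)

/-- `A ↦ ν⁻¹ A`, used only for series `A` whose coefficient at `ν⁰` vanishes. -/
def divNu {S : Type*} [Semiring S] (A : PowerSeries S) : PowerSeries S :=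
  PowerSeries.mk fun r => PowerSeries.coeff (r + 1) A

/-- `exp Y = ∑ₖ Yᵏ / k!` for a formal operator `Y` whose coefficient at `ν⁰` vanishes; the power
`Yᵏ` is then divisible by `νᵏ`, so only `k ≤ r` contributes to the coefficient at `νʳ`. -/
def formalExp (Y : PowerSeries (Module.End ℂ R)) : PowerSeries (Module.End ℂ R) :=
  PowerSeries.mk fun r =>
    ∑ k ∈ Finset.range (r + 1), ((k.factorial : ℂ)⁻¹) • PowerSeries.coeff r (Y ^ k)

instance commutator_leftCommutative {ι : Type*} (x : ι → R) :
    LeftCommutative fun (i : ι) (A : Module.End ℂ R) => A * mulOp (x i) - mulOp (x i) * A where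
  left_comm i j A := by
    ext f
    simp only [mulOp, LinearMap.sub_apply, Module.End.mul_apply, LinearMap.mulLeft_apply]
    simp only [mul_left_comm (x i) (x j)]
    ring

/-- The iterated commutator `[…[[A, x_{i₁}], x_{i₂}], …, x_{i_r}]` of `A` with the functions `x_i`,
in which each `x_i` occurs `α i` times. The order is irrelevant, since the `x_i` commute. -/
def iterComm {ι : Type*} (x : ι → R) (α : ι →₀ ℕ) (A : Module.End ℂ R) : Module.End ℂ R :=
  Multiset.foldr (fun i A => A * mulOp (x i) - mulOp (x i) * A) A (Finsupp.toMultiset α)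

end Algebra

/-! ## Smooth functions on open subsets of a complex manifold -/

section Smooth

variable (n : ℕ) {M : Type*} [TopologicalSpace M] [ChartedSpace (Fin n → ℂ) M]

/-- `C^∞(U)`: the complex valued functions on the open set `U` which are smooth in the real
sense. -/
def Sm (U : Opens M) : Subalgebra ℂ (U → ℂ) where
  carrier := {f | ContMDiff 𝓘(ℝ, Fin n → ℂ) 𝓘(ℝ, ℂ) ∞ f}
  mul_mem' hf hg :=
    ((contDiff_fst.mul contDiff_snd : ContDiff ℝ ∞ fun p : ℂ × ℂ => p.1 * p.2).contMDiff).comp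
      (ContMDiff.prodMk_space hf hg)
  add_mem' hf hg :=
    ((contDiff_fst.add contDiff_snd : ContDiff ℝ ∞ fun p : ℂ × ℂ => p.1 + p.2).contMDiff).comp
      (ContMDiff.prodMk_space hf hg)
  algebraMap_mem' _ := contMDiff_const

/-- Restriction of smooth functions to a smaller open set. -/
def res {V U : Opens M} (h : V ≤ U) : Sm n U →ₐ[ℂ] Sm n V where
  toFun f := ⟨fun x => f.1 (Opens.inclusion h x),
    ContMDiff.comp (show ContMDiff 𝓘(ℝ, Fin n → ℂ) 𝓘(ℝ, ℂ) ∞ f.1 from f.2)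
      (contMDiff_inclusion h)⟩
  map_one' := rfl
  map_mul' _ _ := rfl
  map_zero' := rfl
  map_add' _ _ := rfl
  commutes' _ := rfl

variable {n}

/-- Holomorphic functions on `U`. -/
def IsHol {U : Opens M} (f : Sm n U) : Prop :=
  MDifferentiable 𝓘(ℂ, Fin n → ℂ) 𝓘(ℂ, ℂ) f.1

/-- Antiholomorphic functions on `U`. -/
def IsAntihol {U : Opens M} (f : Sm n U) : Prop :=
  MDifferentiable 𝓘(ℂ, Fin n → ℂ) 𝓘(ℂ, ℂ) fun x => (starRingEnd ℂ) (f.1 x)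

end Smooth

/-! ## Poisson structures and star products -/

section Star

variable (n : ℕ) (M : Type*) [TopologicalSpace M] [ChartedSpace (Fin n → ℂ) M]

/-- A (complex valued) Poisson structure on `M`, given by its Poisson bracket on the sheaf of
smooth functions. -/
structure PoissonStructure where
  bracket : ∀ U : Opens M, Sm n U →ₗ[ℂ] Sm n U →ₗ[ℂ] Sm n U
  res_bracket : ∀ {V U : Opens M} (h : V ≤ U) (f g : Sm n U),
    res n h (bracket U f g) = bracket V (res n h f) (res n h g)
  skew : ∀ (U : Opens M) (f g : Sm n U), bracket U f g = -bracket U g f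
  leibniz : ∀ (U : Opens M) (f g h : Sm n U),
    bracket U f (g * h) = bracket U f g * h + g * bracket U f h
  jacobi : ∀ (U : Opens M) (f g h : Sm n U),
    bracket U f (bracket U g h) + bracket U g (bracket U h f) + bracket U h (bracket U f g) = 0

variable {n M}

/-- A Kähler–Poisson structure: the Poisson tensor is of type `(1,1)`, i.e. its components of
types `(2,0)` and `(0,2)` vanish. -/
def PoissonStructure.IsKahlerPoisson (π : PoissonStructure n M) : Prop :=
  ∀ (U : Opens M) (f g : Sm n U),
    (IsHol f ∧ IsHol g) ∨ (IsAntihol f ∧ IsAntihol g) → π.bracket U f g = 0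

/-- The product of formal functions determined by bilinear operators `C_r`,
`f ⋆ g = ∑ ν^(r+i+j) C_r (f_i, g_j)`. -/
def starMul {R : Type*} [CommRing R] [Algebra ℂ R] (C : ℕ → R →ₗ[ℂ] R →ₗ[ℂ] R)
    (f g : PowerSeries R) : PowerSeries R :=
  PowerSeries.mk fun s => ∑ p ∈ Finset.HasAntidiagonal.antidiagonal s,
    ∑ q ∈ Finset.HasAntidiagonal.antidiagonal p.2,
      C p.1 (PowerSeries.coeff q.1 f) (PowerSeries.coeff q.2 g)

/-- A formal differential star product on `(M, π)`: bidifferential operators `C_r` on `M`, given by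
their restrictions to all open subsets, defining an associative unital product on formal functions
with `C₀ (f, g) = f g` and `C₁ (f, g) - C₁ (g, f) = {f, g}`. -/
structure StarProduct (π : PoissonStructure n M) where
  C : ℕ → ∀ U : Opens M, Sm n U →ₗ[ℂ] Sm n U →ₗ[ℂ] Sm n U
  res_C : ∀ (r : ℕ) {V U : Opens M} (h : V ≤ U) (f g : Sm n U),
    res n h (C r U f g) = C r V (res n h f) (res n h g)
  bidifferential : ∀ r : ℕ, ∃ N : ℕ, ∀ (U : Opens M) (f : Sm n U),
    HasOrder N (C r U f) ∧ HasOrder N ((C r U).flip f)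
  C_zero : ∀ (U : Opens M) (f g : Sm n U), C 0 U f g = f * g
  C_one : ∀ (U : Opens M) (f g : Sm n U), C 1 U f g - C 1 U g f = π.bracket U f g
  one_mul : ∀ (U : Opens M) (f : PowerSeries (Sm n U)), starMul (fun r => C r U) 1 f = f
  mul_one : ∀ (U : Opens M) (f : PowerSeries (Sm n U)), starMul (fun r => C r U) f 1 = f
  assoc : ∀ (U : Opens M) (f g h : PowerSeries (Sm n U)),
    starMul (fun r => C r U) (starMul (fun r => C r U) f g) h =
      starMul (fun r => C r U) f (starMul (fun r => C r U) g h)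

namespace StarProduct

variable {π : PoissonStructure n M} (st : StarProduct π)

/-- Separation of variables: every `C_r` differentiates its first argument only in antiholomorphic
directions (it is linear over holomorphic functions in that argument), and its second argument only
in holomorphic directions (it is linear over antiholomorphic functions in that argument). -/
def SeparationOfVariables : Prop :=
  ∀ (r : ℕ) (U : Opens M) (f g : Sm n U),
    (∀ a : Sm n U, IsHol a → st.C r U (a * f) g = a * st.C r U f g) ∧
    (∀ b : Sm n U, IsAntihol b → st.C r U f (b * g) = b * st.C r U f g)

/-- The operator `L_f` of left star multiplication by `f ∈ C^∞(U)`. -/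
def L {U : Opens M} (f : Sm n U) : PowerSeries (Module.End ℂ (Sm n U)) :=
  PowerSeries.mk fun r => st.C r U f

/-- The operator `R_f` of right star multiplication by `f ∈ C^∞(U)`. -/
def R {U : Opens M} (f : Sm n U) : PowerSeries (Module.End ℂ (Sm n U)) :=
  PowerSeries.mk fun r => (st.C r U).flip f

end StarProduct

variable (n M) in
/-- Series in `ν` of linear operators on `C^∞(U)`, for all open sets `U`. -/
abbrev FormalOp := ∀ U : Opens M, PowerSeries (Module.End ℂ (Sm n U))

/-- Formal differential operators on `M`: each coefficient is a differential operator on `M`, given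
by its restrictions to all open subsets. -/
def IsFormalDiffOp (A : FormalOp n M) : Prop :=
  ∀ r : ℕ,
    (∀ {V U : Opens M} (h : V ≤ U) (f : Sm n U),
      res n h (PowerSeries.coeff r (A U) f) = PowerSeries.coeff r (A V) (res n h f)) ∧
    ∃ N : ℕ, ∀ U : Opens M, HasOrder N (PowerSeries.coeff r (A U))

/-- `B` is the formal Berezin transform of the star product: the formal differential operator with
`B (a b) = b ⋆ a` for local holomorphic `a` and antiholomorphic `b`. -/
def StarProduct.IsBerezinTransform {π : PoissonStructure n M} (st : StarProduct π)
    (B : FormalOp n M) : Prop :=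
  IsFormalDiffOp B ∧
    ∀ (U : Opens M) (a b : Sm n U), IsHol a → IsAntihol b →
      ∀ r : ℕ, PowerSeries.coeff r (B U) (a * b) = st.C r U b a

/-- `X = ν² X₂ + ν³ X₃ + …` is a formal differential operator with `B = exp (ν⁻¹ X)`. -/
def IsExponent (B X : FormalOp n M) : Prop :=
  IsFormalDiffOp X ∧ ∀ U : Opens M,
    PowerSeries.coeff 0 (X U) = 0 ∧ PowerSeries.coeff 1 (X U) = 0 ∧ B U = formalExp (divNu (X U))

end Star

/-! ## Holomorphic coordinates -/

section Charts

variable (n : ℕ) (M : Type*) [TopologicalSpace M] [ChartedSpace (Fin n → ℂ) M]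

/-- A holomorphic coordinate chart: an open set `dom` with holomorphic coordinates `z^k` on it,
given as the restriction to `dom` of a chart of the complex structure. -/
structure HolChart where
  chart : OpenPartialHomeomorph M (Fin n → ℂ)
  mem_atlas : chart ∈ IsManifold.maximalAtlas 𝓘(ℂ, Fin n → ℂ) ω M
  dom : Opens M
  dom_le : (dom : Set M) ⊆ chart.source

variable {n M}

/-- The same coordinates on a smaller open set. -/
def HolChart.restrict (c : HolChart n M) (W : Opens M) (h : W ≤ c.dom) : HolChart n M where
  chart := c.chart
  mem_atlas := c.mem_atlas
  dom := W
  dom_le := fun _ hx => c.dom_le (h hx)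

lemma contDiffGroupoid_complex_le_real :
    contDiffGroupoid ω 𝓘(ℂ, Fin n → ℂ) ≤ contDiffGroupoid ∞ 𝓘(ℝ, Fin n → ℂ) := by
  rw [contDiffGroupoid, contDiffGroupoid]
  refine groupoid_of_pregroupoid_le _ _ fun f s hfs => ?_
  exact (ContDiffOn.restrict_scalars ℝ hfs).of_le le_top

/-- The function `f ∈ C^∞(U)` written in the coordinates `c`, as a function on the open set
`c.chart (c.dom)` of `ℂⁿ` (extended by zero). -/
def HolChart.read (c : HolChart n M) (f : Sm n c.dom) : (Fin n → ℂ) → ℂ :=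
  Function.extend Subtype.val f.1 0 ∘ c.chart.symm

/-- The coordinate domain in `ℂⁿ`. -/
def HolChart.image (c : HolChart n M) : Set (Fin n → ℂ) :=
  c.chart.target ∩ c.chart.symm ⁻¹' c.dom

lemma HolChart.isOpen_image (c : HolChart n M) : IsOpen c.image :=
  c.chart.symm.isOpen_inter_preimage c.dom.isOpen

lemma HolChart.map_mem_image (c : HolChart n M) (x : c.dom) : c.chart x ∈ c.image :=
  ⟨c.chart.map_source (c.dom_le x.2), by
    simp [Set.mem_preimage, c.chart.left_inv (c.dom_le x.2)]⟩

lemma mem_maximalAtlas_real {e : OpenPartialHomeomorph M (Fin n → ℂ)}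
    (he : e ∈ IsManifold.maximalAtlas 𝓘(ℂ, Fin n → ℂ) ω M) :
    e ∈ IsManifold.maximalAtlas 𝓘(ℝ, Fin n → ℂ) ∞ M :=
  fun e' he' => ⟨contDiffGroupoid_complex_le_real (he e' he').1,
    contDiffGroupoid_complex_le_real (he e' he').2⟩

variable [IsManifold 𝓘(ℂ, Fin n → ℂ) ω M]

variable (n M) in
lemma isManifold_real : IsManifold 𝓘(ℝ, Fin n → ℂ) ∞ M where
  compatible he he' := contDiffGroupoid_complex_le_real
    ((contDiffGroupoid ω 𝓘(ℂ, Fin n → ℂ)).compatible he he')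

lemma HolChart.contDiffOn_read (c : HolChart n M) (f : Sm n c.dom) :
    ContDiffOn ℝ ∞ (c.read f) c.image := by
  have := isManifold_real n M
  rw [← contMDiffOn_iff_contDiffOn]
  have h1 : ContMDiffOn 𝓘(ℝ, Fin n → ℂ) 𝓘(ℝ, ℂ) ∞
      (Function.extend (Subtype.val : c.dom → M) f.1 0) (c.dom : Set M) := by
    intro x hx
    refine ContMDiffAt.contMDiffWithinAt ?_
    have := contMDiffAt_subtype_iff (I := 𝓘(ℝ, Fin n → ℂ)) (I' := 𝓘(ℝ, ℂ)) (n := ∞)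
      (f := Function.extend (Subtype.val : c.dom → M) f.1 0) (x := ⟨x, hx⟩)
    refine this.1 ?_
    have h : (fun x : c.dom => Function.extend (Subtype.val : c.dom → M) f.1 0 x) = f.1 := by
      funext y
      exact Subtype.val_injective.extend_apply _ _ _
    rw [h]
    exact ContMDiff.contMDiffAt f.2
  have h2 := contMDiffOn_symm_of_mem_maximalAtlas (mem_maximalAtlas_real c.mem_atlas)
  exact h1.comp (h2.mono Set.inter_subset_left) fun y hy => hy.2

/-- The derivative of `f ∈ C^∞(U)` in the constant direction `v` of the coordinate space. -/
def HolChart.dirDeriv (c : HolChart n M) (v : Fin n → ℂ) (f : Sm n c.dom) : Sm n c.dom :=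
  ⟨fun x => fderiv ℝ (c.read f) (c.chart x) v, by
    have := isManifold_real n M
    have h1 : ContDiffOn ℝ ∞ (fun y => fderiv ℝ (c.read f) y v) c.image :=
      ((c.contDiffOn_read f).fderiv_of_isOpen c.isOpen_image (by simp)).clm_apply
        contDiffOn_const
    have h2 := contMDiffOn_of_mem_maximalAtlas (mem_maximalAtlas_real c.mem_atlas)
    intro x
    refine (contMDiffAt_subtype_iff (I := 𝓘(ℝ, Fin n → ℂ)) (I' := 𝓘(ℝ, ℂ)) (n := ∞)
      (f := fun x : M => fderiv ℝ (c.read f) (c.chart x) v) (x := x)).2 ?_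
    exact ContMDiffAt.comp (x : M)
      ((contMDiffOn_iff_contDiffOn.2 h1).contMDiffAt
        (c.isOpen_image.mem_nhds (c.map_mem_image x)))
      (h2.contMDiffAt (c.chart.open_source.mem_nhds (c.dom_le x.2)))⟩

lemma HolChart.contMDiff_clm (c : HolChart n M) (u : (Fin n → ℂ) →L[ℝ] ℂ) :
    ContMDiff 𝓘(ℝ, Fin n → ℂ) 𝓘(ℝ, ℂ) ∞ fun x : c.dom => u (c.chart x) := by
  have := isManifold_real n M
  intro x
  have h2 := contMDiffOn_of_mem_maximalAtlas (mem_maximalAtlas_real c.mem_atlas)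
  refine (contMDiffAt_subtype_iff (I := 𝓘(ℝ, Fin n → ℂ)) (I' := 𝓘(ℝ, ℂ)) (n := ∞)
    (f := fun x : M => u (c.chart x)) (x := x)).2 ?_
  exact ContMDiffAt.comp (x : M) u.contMDiff.contMDiffAt
    (h2.contMDiffAt (c.chart.open_source.mem_nhds (c.dom_le x.2)))

variable (n) in
/-- Indices of the coordinates `z^k` (`Sum.inl k`) and `z̄^l` (`Sum.inr l`), and of the dual fibre
coordinates `ζ_k` and `ζ̄_l` on the cotangent bundle. -/
abbrev Idx := Fin n ⊕ Fin n

/-- The coordinate derivatives `∂/∂z^k` and `∂/∂z̄^l`. -/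
def HolChart.partial (c : HolChart n M) : Idx n → Sm n c.dom → Sm n c.dom
  | Sum.inl k, f => (1 / 2 : ℂ) •
      (c.dirDeriv (Pi.single k 1) f - Complex.I • c.dirDeriv (Pi.single k Complex.I) f)
  | Sum.inr k, f => (1 / 2 : ℂ) •
      (c.dirDeriv (Pi.single k 1) f + Complex.I • c.dirDeriv (Pi.single k Complex.I) f)

/-- The coordinate functions `z^k` and `z̄^l`. -/
def HolChart.coord (c : HolChart n M) : Idx n → Sm n c.dom
  | Sum.inl k => ⟨fun x => c.chart x k, c.contMDiff_clm (ContinuousLinearMap.proj k)⟩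
  | Sum.inr k => ⟨fun x => (starRingEnd ℂ) (c.chart x k),
      c.contMDiff_clm ((Complex.conjCLE : ℂ →L[ℝ] ℂ).comp (ContinuousLinearMap.proj k))⟩

/-! ## Formal functions on the cotangent bundle -/

/-- `C^∞(T^*U, Z)` for the coordinate domain `U`: functions on the formal neighbourhood of the zero
section `Z`, i.e. formal power series in the fibre coordinates `ζ_k, ζ̄_l` with coefficients in
`C^∞(U)`. -/
abbrev HolChart.Fun (c : HolChart n M) := MvPowerSeries (Idx n) (Sm n c.dom)

/-- A function on the base as a function on the cotangent bundle. -/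
abbrev HolChart.pull (c : HolChart n M) (f : Sm n c.dom) : c.Fun := MvPowerSeries.C f

/-- The derivative with respect to a base coordinate. -/
def HolChart.baseDeriv (c : HolChart n M) (i : Idx n) (P : c.Fun) : c.Fun :=
  fun α => c.partial i (MvPowerSeries.coeff α P)

/-- The Poisson bracket of the standard symplectic structure of the cotangent bundle. -/
def HolChart.poisson (c : HolChart n M) (P Q : c.Fun) : c.Fun :=
  ∑ i : Idx n, (MvPowerSeries.pderiv (Sm n c.dom) i P * c.baseDeriv i Q -
    c.baseDeriv i P * MvPowerSeries.pderiv (Sm n c.dom) i Q)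

/-- `e^{H_K} Q`, where `H_K Q = {K, Q}`. It is used only for `K` which starts with quadratic terms in
the fibre variables. Then `H_K` raises the fibre degree, so that only `k ≤ |α|` contributes to the
coefficient at the monomial of index `α`. -/
def HolChart.expHam (c : HolChart n M) (K Q : c.Fun) : c.Fun :=
  fun α => ∑ k ∈ Finset.range (α.degree + 1),
    ((k.factorial : ℂ)⁻¹) • MvPowerSeries.coeff α ((c.poisson K)^[k] Q)

/-- The Poisson bracket on `C^∞(T^*U, Z)[ε]`, `ε² = 0`, extended by `ε`-linearity. -/
def HolChart.poissonEps (c : HolChart n M) (P Q : DualNumber c.Fun) : DualNumber c.Fun :=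
  (c.poisson P.fst Q.fst, c.poisson P.fst Q.snd + c.poisson P.snd Q.fst)

/-- `e^{H_F} Q` on `C^∞(T^*U, Z)[ε]`, where `H_F Q = {F, Q}`, for `F` which starts with quadratic
terms in the fibre variables. -/
def HolChart.expHamEps (c : HolChart n M) (F Q : DualNumber c.Fun) : DualNumber c.Fun :=
  (fun α => ∑ k ∈ Finset.range (α.degree + 1),
      ((k.factorial : ℂ)⁻¹) • MvPowerSeries.coeff α ((c.poissonEps F)^[k] Q).fst,
    fun α => ∑ k ∈ Finset.range (α.degree + 1),
      ((k.factorial : ℂ)⁻¹) • MvPowerSeries.coeff α ((c.poissonEps F)^[k] Q).snd)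

/-- The `σ`-symbol `∑ σ_r(A_r)` of a natural formal operator `A` on `C^∞(U)`. If `A_r` has order at
most `r`, then the coefficient of its principal symbol at `ζ^α`, `|α| = r`, i.e. the coefficient of
`A_r` at the partial derivative of multi-index `α`, is `1/α!` times the `r`-fold commutator of `A_r`
with coordinate functions of multi-index `α` (an operator of multiplication by a function). -/
def HolChart.sigma (c : HolChart n M) (A : PowerSeries (Module.End ℂ (Sm n c.dom))) : c.Fun :=
  fun α => ((∏ i, (α i).factorial : ℕ) : ℂ)⁻¹ •
    iterComm c.coord α (PowerSeries.coeff α.degree A) 1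

variable (n M) in
/-- A function on the formal neighbourhood of the zero section of `T^*M` through its expressions in
all holomorphic charts. The charts have to be related as in `IsGlobal`. -/
abbrev CotFun := ∀ c : HolChart n M, c.Fun

/-- The expression in the chart `c` of a formal function on the cotangent bundle, restricted to a
smaller open set. -/
def HolChart.resFun (c : HolChart n M) {W : Opens M} (h : W ≤ c.dom) :
    c.Fun → MvPowerSeries (Idx n) (Sm n W) :=
  MvPowerSeries.map (res n h).toRingHom

/-- The local expressions of `P` are related by the coordinate changes of the cotangent bundle:
on the overlap `W` of two charts with coordinates `x` and `y` on the base, the fibre coordinates `ξ`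
and `η` (with `∑ ξ_i dx^i = ∑ η_j dy^j`) satisfy `ξ_i = ∑ (∂y^j/∂x^i) η_j`. -/
def IsGlobal (P : CotFun n M) : Prop :=
  ∀ (c d : HolChart n M) (W : Opens M) (hc : W ≤ c.dom) (hd : W ≤ d.dom),
    MvPowerSeries.subst
        (fun i : Idx n => ∑ j : Idx n,
          MvPowerSeries.C ((c.restrict W hc).partial i (res n hd (d.coord j))) *
            (MvPowerSeries.X j : MvPowerSeries (Idx n) (Sm n W)))
        (c.resFun hc (P c)) =
      d.resFun hd (P d)

/-- The formal operator `A` on `M` is natural and its `σ`-symbol is the formal function `P` on the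
cotangent bundle. -/
def HasSymbol (A : FormalOp n M) (P : CotFun n M) : Prop :=
  (∀ U : Opens M, IsNatural (A U)) ∧ IsGlobal P ∧ ∀ c : HolChart n M, c.sigma (A c.dom) = P c

variable (n M) in
/-- The set `𝒦` of formal functions `K = K₂ + K₃ + …` on the cotangent bundle such that
`{e^{H_K} a, ã} = 0` and `{e^{H_K} b, b̃} = 0` for local holomorphic `a, ã` and antiholomorphic
`b, b̃`. -/
def calK : Set (CotFun n M) :=
  {K | IsGlobal K ∧ ∀ c : HolChart n M,
    (∀ α : Idx n →₀ ℕ, α.degree < 2 → MvPowerSeries.coeff α (K c) = 0) ∧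
    (∀ a a' : Sm n c.dom, IsHol a → IsHol a' →
      c.poisson (c.expHam (K c) (c.pull a)) (c.pull a') = 0) ∧
    (∀ b b' : Sm n c.dom, IsAntihol b → IsAntihol b' →
      c.poisson (c.expHam (K c) (c.pull b)) (c.pull b') = 0)}

/-- The expression of `F = K + ε J` in a chart. -/
def HolChart.eval (c : HolChart n M) (F : DualNumber (CotFun n M)) : DualNumber c.Fun :=
  (F.fst c, F.snd c)

/-- A function on the base as an element of `C^∞(T^*U, Z)[ε]`. -/
def HolChart.pullEps (c : HolChart n M) (f : Sm n c.dom) : DualNumber c.Fun :=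
  (c.pull f, 0)

variable (n M) in
/-- The set `𝒦[ε]` of elements `F = K + ε J` which start with quadratic terms in the fibre variables
and satisfy `{e^{H_F} a, ã} = 0` and `{e^{H_F} b, b̃} = 0` for local holomorphic `a, ã` and
antiholomorphic `b, b̃`. -/
def calKEps : Set (DualNumber (CotFun n M)) :=
  {F | IsGlobal F.fst ∧ IsGlobal F.snd ∧ ∀ c : HolChart n M,
    (∀ α : Idx n →₀ ℕ, α.degree < 2 → MvPowerSeries.coeff α (F.fst c) = 0 ∧
      MvPowerSeries.coeff α (F.snd c) = 0) ∧
    (∀ a a' : Sm n c.dom, IsHol a → IsHol a' →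
      c.poissonEps (c.expHamEps (c.eval F) (c.pullEps a)) (c.pullEps a') = 0) ∧
    (∀ b b' : Sm n c.dom, IsAntihol b → IsAntihol b' →
      c.poissonEps (c.expHamEps (c.eval F) (c.pullEps b)) (c.pullEps b') = 0)}

/-- `K` is the element of `𝒦` corresponding to the Kähler–Poisson tensor `g` of `π`:
`K₂ = ∑ g^{lk} ζ_k ζ̄_l`, where `g^{lk} = {z̄^l, z^k}`. -/
def IsKahlerPoissonElement (π : PoissonStructure n M) (K : CotFun n M) : Prop :=
  K ∈ calK n M ∧ ∀ (c : HolChart n M) (α : Idx n →₀ ℕ), α.degree = 2 →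
    MvPowerSeries.coeff α (K c) =
      MvPowerSeries.coeff α (∑ k : Fin n, ∑ l : Fin n,
        MvPowerSeries.C (π.bracket c.dom (c.coord (Sum.inr l)) (c.coord (Sum.inl k))) *
          MvPowerSeries.X (Sum.inl k) * MvPowerSeries.X (Sum.inr l))

/-! ## The deformation groupoid of a pair of star products -/

/-- The source mapping `S = S₀ + ε S₁` of the deformation groupoid of the pair `(⋆, ⋆')` on
functions: `S₀ f = σ(L_f)`, `S₁ f = σ(ν⁻¹ (L_f - L'_f))`. -/
def HolChart.source {π : PoissonStructure n M} (c : HolChart n M) (st st' : StarProduct π)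
    (f : Sm n c.dom) : DualNumber c.Fun :=
  (c.sigma (st.L f), c.sigma (divNu (st.L f - st'.L f)))

/-- The target mapping `T = T₀ + ε T₁` of the deformation groupoid of the pair `(⋆, ⋆')` on
functions: `T₀ f = σ(R_f)`, `T₁ f = σ(ν⁻¹ (R_f - R'_f))`. -/
def HolChart.target {π : PoissonStructure n M} (c : HolChart n M) (st st' : StarProduct π)
    (f : Sm n c.dom) : DualNumber c.Fun :=
  (c.sigma (st.R f), c.sigma (divNu (st.R f - st'.R f)))

/-- The two star products are natural and have the same formal symplectic groupoid, which makes the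
deformation groupoid of the pair well defined: over each chart, `L_f, L'_f, R_f, R'_f` are natural,
`σ(L_f) = σ(L'_f)`, `σ(R_f) = σ(R'_f)`, and `L_f - L'_f`, `R_f - R'_f` belong to `ν` times natural
operators. -/
def SameGroupoid {π : PoissonStructure n M} (st st' : StarProduct π) : Prop :=
  ∀ (c : HolChart n M) (f : Sm n c.dom),
    (IsNatural (st.L f) ∧ IsNatural (st'.L f) ∧ c.sigma (st.L f) = c.sigma (st'.L f) ∧
      PowerSeries.coeff 0 (st.L f - st'.L f) = 0 ∧ IsNatural (divNu (st.L f - st'.L f))) ∧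
    (IsNatural (st.R f) ∧ IsNatural (st'.R f) ∧ c.sigma (st.R f) = c.sigma (st'.R f) ∧
      PowerSeries.coeff 0 (st.R f - st'.R f) = 0 ∧ IsNatural (divNu (st.R f - st'.R f)))

end Charts

end BerezinLog

end

open BerezinLog

noncomputable section

namespace BerezinLog

/-! ### Commutator identities -/

section Commutator

variable {E : Type*} [Ring E]

/-! Over a coordinate chart everything rests on conjugation by the Berezin transform. For
antiholomorphic `b` and holomorphic `a`, associativity and separation of variables give `L_b B = B
b` and `R_a B = B a`: both sides are differential operators, and they agree on products `a b`, hence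
on all monomials in the coordinates, which suffices. With `B = exp(X/ν)` this reads `L_b =
e^{ad(X/ν)} b` and `R_a = e^{ad(X/ν)} a` (`IsLog.L_eq`, `IsLog.Rt_eq`). Left and right
multiplications commute, and `L_a = a`, `R_b = b`; so `e^{ad(X/ν)} a` commutes with holomorphic
functions and `e^{ad(X/ν)} b` with antiholomorphic ones.

These commutation relations force `X` to be natural. Modulo terms controlled by lower coefficients,
the coefficient of `e^{ad(X/ν)} x_i` at `ν^(r-1)` is `[X_r, x_i]`, so `[[X_r, x_i], x_j]` has small
order whenever `x_i, x_j` are of the same type. Among any three coordinates two have the same type,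
so all triple commutators of `X_r` have small order (`CoordSys.isNatural_of_lie_expAd`).

For natural `A, B` the operator `ν⁻¹[A, B]` is natural and its symbol is the Poisson bracket of the
symbols (`CoordSys.sigma_divNu_lie`). Hence `e^{ad(X/ν)} f` has symbol `e^{H_K} f` with `K = σ(X)`,
and the commutation relations become the equations defining `𝒦`. The same pigeonhole argument on
coordinate types shows that these equations determine `K` from its quadratic part
(`CoordSys.eq_of_poisson_expHam_eq_zero`). The quadratic part comes from `X₂`, which is fixed by the
Poisson bracket, so `σ(X) = σ(X')`.

Equality of symbols means that each coefficient of `X - X'` drops one order, so `ν⁻¹(X - X')` is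
natural. Subtracting the two conjugations term by term is calculus over the dual numbers: the
`ε`-part of `e^{H_F} f` is the symbol of `ν⁻¹` times the difference of the two exponentials
(`CoordSys.expHamEps_eq`). This gives the source and target formulas and membership in `𝒦[ε]`.
Statements about `L_f`, `R_f` for arbitrary `f` follow from `f = a b`, because `f ↦ C_r(f, g)` and
`f ↦ C_r(g, f)` are differential operators (`SepStar.Adapted.mem_orderLT`).

The algebra is carried out for an abstract commutative algebra with coordinates and dual derivations
that determine all derivations. Hadamard's lemma and a bump function show that holomorphic charts
provide such a system; locality then globalizes the results. -/

lemma commutator_zero_left (a : E) : ⁅(0 : E), a⁆ = 0 := by simp [Ring.lie_def]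

lemma commutator_zero_right (a : E) : ⁅a, (0 : E)⁆ = 0 := by simp [Ring.lie_def]

lemma commutator_mul_left (a b c : E) : ⁅a * b, c⁆ = a * ⁅b, c⁆ + ⁅a, c⁆ * b := by
  simp only [Ring.lie_def]; noncomm_ring

lemma commutator_leibniz (a b c : E) : ⁅⁅a, b⁆, c⁆ = ⁅a, ⁅b, c⁆⁆ + ⁅⁅a, c⁆, b⁆ := by
  simp only [Ring.lie_def]; noncomm_ring

lemma commutator_sub_commutator (a a' b b' : E) :
    ⁅a, b⁆ - ⁅a', b'⁆ = ⁅a, b - b'⁆ + ⁅a - a', b'⁆ := by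
  simp only [Ring.lie_def, mul_sub, sub_mul]; abel

end Commutator

/-! ### Orders of differential operators -/

section Order

variable {R : Type*} [CommRing R] [Algebra ℂ R]

/-- The differential operators of order less than `r`. -/
def orderLT : ℕ → Submodule ℂ (Module.End ℂ R)
  | 0 => ⊥
  | r + 1 => ⨅ f : R, (orderLT r).comap
      (LinearMap.mulRight ℂ (mulOp f) - LinearMap.mulLeft ℂ (mulOp f))

lemma mem_orderLT_zero {A : Module.End ℂ R} : A ∈ orderLT 0 ↔ A = 0 := Iff.rfl

lemma mem_orderLT_succ {r : ℕ} {A : Module.End ℂ R} :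
    A ∈ orderLT (r + 1) ↔ ∀ f : R, ⁅A, mulOp f⁆ ∈ orderLT r := by
  simp only [orderLT, Submodule.mem_iInf, Submodule.mem_comap, LinearMap.sub_apply,
    LinearMap.mulRight_apply, LinearMap.mulLeft_apply, Ring.lie_def]

/-- The index is shifted by one so that the bottom level consists of the zero operator alone;
inductions on the order then start from `A = 0`, and no negative orders occur. -/
lemma hasOrder_iff {r : ℕ} {A : Module.End ℂ R} : HasOrder r A ↔ A ∈ orderLT (r + 1) := by
  induction r generalizing A with
  | zero => exact (mem_orderLT_succ (r := 0) (A := A)).symm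
  | succ r ih =>
    rw [mem_orderLT_succ]
    exact forall_congr' fun f => ih

lemma orderLT_mono : Monotone (orderLT : ℕ → Submodule ℂ (Module.End ℂ R)) := by
  refine monotone_nat_of_le_succ fun r => ?_
  induction r with
  | zero => exact bot_le
  | succ r ih => exact fun A hA => mem_orderLT_succ.2 fun f => ih (mem_orderLT_succ.1 hA f)

lemma mulOp_lie_mulOp (f g : R) : ⁅mulOp f, mulOp g⁆ = 0 := by
  ext h
  simp [Ring.lie_def, mul_left_comm]

lemma mulOp_mem_orderLT (f : R) : mulOp f ∈ orderLT 1 :=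
  mem_orderLT_succ.2 fun g => mulOp_lie_mulOp f g

lemma eq_mulOp_of_mem_orderLT_one {A : Module.End ℂ R} (hA : A ∈ orderLT 1) :
    A = mulOp (A 1) := by
  ext f
  have := LinearMap.congr_fun (mem_orderLT_succ.1 hA f) 1
  simp only [Ring.lie_def, LinearMap.sub_apply, Module.End.mul_apply, LinearMap.mulLeft_apply,
    mul_one, LinearMap.zero_apply, sub_eq_zero] at this
  rw [this, LinearMap.mulLeft_apply, mul_comm]

lemma mul_mem_orderLT {p q m : ℕ} {A B : Module.End ℂ R} (h : p + q ≤ m + 1)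
    (hA : A ∈ orderLT p) (hB : B ∈ orderLT q) : A * B ∈ orderLT m := by
  induction m generalizing p q A B with
  | zero =>
    obtain rfl | rfl : p = 0 ∨ q = 0 := by omega
    · rw [mem_orderLT_zero.1 hA, zero_mul]; exact zero_mem _
    · rw [mem_orderLT_zero.1 hB, mul_zero]; exact zero_mem _
  | succ m ih =>
    obtain _ | p := p
    · rw [mem_orderLT_zero.1 hA, zero_mul]; exact zero_mem _
    obtain _ | q := q
    · rw [mem_orderLT_zero.1 hB, mul_zero]; exact zero_mem _
    refine mem_orderLT_succ.2 fun f => ?_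
    rw [commutator_mul_left]
    exact add_mem (ih (by omega) hA (mem_orderLT_succ.1 hB f))
      (ih (by omega) (mem_orderLT_succ.1 hA f) hB)

/-- A commutator loses one order compared with a product, because multiplication operators commute.
The induction is on the resulting order, using the Jacobi identity against `mulOp f`. -/
lemma lie_mem_orderLT {p q m : ℕ} {A B : Module.End ℂ R} (h : p + q ≤ m + 2)
    (hA : A ∈ orderLT p) (hB : B ∈ orderLT q) : ⁅A, B⁆ ∈ orderLT m := by
  induction m generalizing p q A B with
  | zero =>
    obtain _ | p := p
    · rw [mem_orderLT_zero.1 hA, commutator_zero_left]; exact zero_mem _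
    obtain _ | q := q
    · rw [mem_orderLT_zero.1 hB, commutator_zero_right]; exact zero_mem _
    obtain ⟨rfl, rfl⟩ : p = 0 ∧ q = 0 := by omega
    rw [eq_mulOp_of_mem_orderLT_one hA, eq_mulOp_of_mem_orderLT_one hB, mulOp_lie_mulOp]
    exact zero_mem _
  | succ m ih =>
    obtain _ | p := p
    · rw [mem_orderLT_zero.1 hA, commutator_zero_left]; exact zero_mem _
    obtain _ | q := q
    · rw [mem_orderLT_zero.1 hB, commutator_zero_right]; exact zero_mem _
    refine mem_orderLT_succ.2 fun f => ?_
    rw [commutator_leibniz]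
    exact add_mem (ih (by omega) hA (mem_orderLT_succ.1 hB f))
      (ih (by omega) (mem_orderLT_succ.1 hA f) hB)

lemma lie_mulOp_comm (A : Module.End ℂ R) (f g : R) :
    ⁅⁅A, mulOp f⁆, mulOp g⁆ = ⁅⁅A, mulOp g⁆, mulOp f⁆ := by
  rw [commutator_leibniz, mulOp_lie_mulOp, commutator_zero_right, zero_add]

/-- The derivation `f ↦ [A, f]` given by an operator of order at most one. -/
def orderOneDerivation (A : Module.End ℂ R) (hA : A ∈ orderLT 2) : Derivation ℂ R R :=
  Derivation.mk' (A - mulOp (A 1)) fun f g => by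
    have h := LinearMap.congr_fun
      (eq_mulOp_of_mem_orderLT_one (mem_orderLT_succ.1 hA f)) g
    simp only [Ring.lie_def, LinearMap.sub_apply, Module.End.mul_apply, LinearMap.mulLeft_apply,
      mul_one] at h
    simp only [LinearMap.sub_apply, LinearMap.mulLeft_apply, smul_eq_mul]
    linear_combination h

lemma orderOneDerivation_apply (A : Module.End ℂ R) (hA : A ∈ orderLT 2) (f : R) :
    orderOneDerivation A hA f = ⁅A, mulOp f⁆ 1 := by
  simp [orderOneDerivation, Ring.lie_def, mul_comm]

end Order

/-! ### Abstract coordinate systems -/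

/-- A system of coordinate functions `x i` with dual derivations `D i`, such that a derivation is
determined by its values on the coordinates. -/
structure CoordSys (R : Type*) [CommRing R] [Algebra ℂ R] (ι : Type*) where
  x : ι → R
  D : ι → Derivation ℂ R R
  D_x_self : ∀ i, D i (x i) = 1
  D_x_of_ne : ∀ i j, i ≠ j → D i (x j) = 0
  eq_zero : ∀ E : Derivation ℂ R R, (∀ i, E (x i) = 0) → E = 0

namespace CoordSys

variable {R : Type*} [CommRing R] [Algebra ℂ R] {ι : Type*} [Fintype ι] (S : CoordSys R ι)

lemma derivation_apply (E : Derivation ℂ R R) (f : R) : E f = ∑ i, E (S.x i) * S.D i f := by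
  classical
  have h := S.eq_zero (E - ∑ i, E (S.x i) • S.D i) fun j => by
    rw [Derivation.sub_apply, ← Derivation.coeFnAddMonoidHom_apply (∑ i, _), map_sum,
      Finset.sum_apply, Finset.sum_eq_single j]
    · simp [S.D_x_self]
    · intro i _ hij
      simp [S.D_x_of_ne i j hij]
    · simp
  have h1 := DFunLike.congr_fun h f
  rw [Derivation.sub_apply, ← Derivation.coeFnAddMonoidHom_apply (∑ i, _), map_sum,
      Finset.sum_apply] at h1
  simpa [sub_eq_zero] using h1

lemma lie_mulOp_apply_one {A : Module.End ℂ R} (hA : A ∈ orderLT 2) (f : R) :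
    ⁅A, mulOp f⁆ 1 = ∑ i, ⁅A, mulOp (S.x i)⁆ 1 * S.D i f := by
  simp only [← orderOneDerivation_apply A hA]
  exact S.derivation_apply _ f

/-- By induction on the order, every `[A, f]` again commutes with the coordinates and so is a
multiplication operator. Thus `f ↦ [A, f] 1` is a derivation; it vanishes on the coordinates, hence
everywhere. -/
lemma mem_orderLT_one {N : ℕ} {A : Module.End ℂ R} (hA : A ∈ orderLT N)
    (h : ∀ i, ⁅A, mulOp (S.x i)⁆ = 0) : A ∈ orderLT 1 := by
  induction N generalizing A with
  | zero => exact orderLT_mono (Nat.zero_le 1) hA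
  | succ N ih =>
    have h2 : A ∈ orderLT 2 := mem_orderLT_succ.2 fun f =>
      ih (mem_orderLT_succ.1 hA f) fun i => by rw [lie_mulOp_comm, h i, commutator_zero_left]
    refine mem_orderLT_succ.2 fun f => ?_
    rw [mem_orderLT_zero, eq_mulOp_of_mem_orderLT_one (mem_orderLT_succ.1 h2 f),
      S.lie_mulOp_apply_one h2]
    simp [h]

/-- Given that the order is finite, it can be tested on commutators with coordinates alone, since
commutators with different functions may be interchanged. -/
lemma mem_orderLT_succ {N r : ℕ} {A : Module.End ℂ R} (hA : A ∈ orderLT N)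
    (h : ∀ i, ⁅A, mulOp (S.x i)⁆ ∈ orderLT r) : A ∈ orderLT (r + 1) := by
  induction r generalizing N A with
  | zero => exact S.mem_orderLT_one hA h
  | succ r ih =>
    refine BerezinLog.mem_orderLT_succ.2 fun f => ?_
    refine ih (BerezinLog.mem_orderLT_succ.1 (orderLT_mono (Nat.le_succ N) hA) f) fun i => ?_
    rw [lie_mulOp_comm]
    exact BerezinLog.mem_orderLT_succ.1 (h i) f

/-- The commutators `[A, x_i]` also kill all monomials, so they vanish by induction; then `A` is
multiplication by `A 1`, and `1` is a monomial. -/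
lemma eq_zero_of_monomials {N : ℕ} {A : Module.End ℂ R} (hA : A ∈ orderLT N)
    (h : ∀ y ∈ Submonoid.closure (Set.range S.x), A y = 0) : A = 0 := by
  induction N generalizing A with
  | zero => exact hA
  | succ N ih =>
    have h1 : A ∈ orderLT 1 := S.mem_orderLT_one hA fun i =>
      ih (BerezinLog.mem_orderLT_succ.1 hA _) fun y hy => by
        simp [Ring.lie_def, h y hy,
          h _ (mul_mem (Submonoid.subset_closure (Set.mem_range_self i)) hy)]
    rw [eq_mulOp_of_mem_orderLT_one h1, h 1 (one_mem _)]
    simp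

end CoordSys

/-! ### Division by the formal parameter -/

section DivNu

variable {E : Type*} [Ring E]

lemma coeff_divNu (A : PowerSeries E) (r : ℕ) :
    PowerSeries.coeff r (divNu A) = PowerSeries.coeff (r + 1) A := by
  simp [divNu]

lemma divNu_add (A B : PowerSeries E) : divNu (A + B) = divNu A + divNu B := by
  ext r; simp [coeff_divNu]

lemma divNu_sub (A B : PowerSeries E) : divNu (A - B) = divNu A - divNu B := by
  ext r; simp [coeff_divNu]

lemma divNu_zero : divNu (0 : PowerSeries E) = 0 := by
  ext r; simp [coeff_divNu]

lemma divNu_X_mul (A : PowerSeries E) : divNu (PowerSeries.X * A) = A := by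
  ext r; simp [coeff_divNu, PowerSeries.coeff_succ_X_mul]

lemma X_mul_divNu {A : PowerSeries E} (h : PowerSeries.coeff 0 A = 0) :
    PowerSeries.X * divNu A = A := by
  ext r
  cases r with
  | zero => rw [PowerSeries.coeff_zero_X_mul, h]
  | succ r => rw [PowerSeries.coeff_succ_X_mul, coeff_divNu]

lemma X_mul_lie (A B : PowerSeries E) : ⁅PowerSeries.X * A, B⁆ = PowerSeries.X * ⁅A, B⁆ := by
  rw [Ring.lie_def, Ring.lie_def, mul_sub, ← mul_assoc B, (PowerSeries.commute_X B).eq, mul_assoc,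
    mul_assoc]

lemma lie_X_mul (A B : PowerSeries E) : ⁅A, PowerSeries.X * B⁆ = PowerSeries.X * ⁅A, B⁆ := by
  rw [Ring.lie_def, Ring.lie_def, mul_sub, ← mul_assoc A, (PowerSeries.commute_X A).eq, mul_assoc,
    mul_assoc]

lemma divNu_lie_left {A : PowerSeries E} (h : PowerSeries.coeff 0 A = 0) (B : PowerSeries E) :
    divNu ⁅A, B⁆ = ⁅divNu A, B⁆ := by
  conv_lhs => rw [← X_mul_divNu h, X_mul_lie, divNu_X_mul]

lemma divNu_lie_right (A : PowerSeries E) {B : PowerSeries E} (h : PowerSeries.coeff 0 B = 0) :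
    divNu ⁅A, B⁆ = ⁅A, divNu B⁆ := by
  conv_lhs => rw [← X_mul_divNu h, lie_X_mul, divNu_X_mul]

lemma coeff_lie (A B : PowerSeries E) (r : ℕ) :
    PowerSeries.coeff r ⁅A, B⁆ = ∑ p ∈ Finset.HasAntidiagonal.antidiagonal r,
      ⁅PowerSeries.coeff p.1 A, PowerSeries.coeff p.2 B⁆ := by
  rw [Ring.lie_def, map_sub, PowerSeries.coeff_mul, PowerSeries.coeff_mul,
    ← Finset.Nat.sum_antidiagonal_swap (n := r) (f := fun p =>
      PowerSeries.coeff p.1 B * PowerSeries.coeff p.2 A), ← Finset.sum_sub_distrib]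
  rfl

lemma coeff_lie_C (A : PowerSeries E) (b : E) (r : ℕ) :
    PowerSeries.coeff r ⁅A, PowerSeries.C b⁆ = ⁅PowerSeries.coeff r A, b⁆ := by
  simp [Ring.lie_def]

end DivNu

/-! ### Natural operators and the rescaled commutator -/

section Natural

variable {R : Type*} [CommRing R] [Algebra ℂ R]

lemma isNatural_iff {A : PowerSeries (Module.End ℂ R)} :
    IsNatural A ↔ ∀ r, PowerSeries.coeff r A ∈ orderLT (r + 1) :=
  forall_congr' fun _ => hasOrder_iff

lemma IsNatural.sub {A B : PowerSeries (Module.End ℂ R)} (hA : IsNatural A) (hB : IsNatural B) :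
    IsNatural (A - B) :=
  isNatural_iff.2 fun r => by
    rw [map_sub]; exact sub_mem (isNatural_iff.1 hA r) (isNatural_iff.1 hB r)

lemma isNatural_C (f : R) : IsNatural (PowerSeries.C (mulOp f)) :=
  isNatural_iff.2 fun r => by
    rw [PowerSeries.coeff_C]
    split_ifs with h
    · exact orderLT_mono (by omega) (mulOp_mem_orderLT f)
    · exact zero_mem _

lemma IsNatural.coeff_zero {A : PowerSeries (Module.End ℂ R)} (hA : IsNatural A) :
    PowerSeries.coeff 0 A = mulOp (PowerSeries.coeff 0 A 1) :=
  eq_mulOp_of_mem_orderLT_one (isNatural_iff.1 hA 0)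

lemma IsNatural.coeff_zero_lie {A B : PowerSeries (Module.End ℂ R)} (hA : IsNatural A)
    (hB : IsNatural B) : PowerSeries.coeff 0 ⁅A, B⁆ = 0 := by
  rw [coeff_lie, Finset.Nat.sum_antidiagonal_eq_sum_range_succ_mk]
  simp only [Finset.sum_range_one, tsub_zero]
  rw [hA.coeff_zero, hB.coeff_zero, mulOp_lie_mulOp]

lemma IsNatural.divNu_lie {A B : PowerSeries (Module.End ℂ R)} (hA : IsNatural A)
    (hB : IsNatural B) : IsNatural (divNu ⁅A, B⁆) :=
  isNatural_iff.2 fun r => by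
    rw [coeff_divNu, coeff_lie]
    refine sum_mem fun p hp => ?_
    have := Finset.HasAntidiagonal.mem_antidiagonal.1 hp
    exact lie_mem_orderLT (by omega) (isNatural_iff.1 hA _) (isNatural_iff.1 hB _)

/-- The Jacobi identity survives the rescaling to `ν⁻¹[·,·]`. Naturality ensures that each division
by `ν` is exact: the leading coefficients are multiplication operators and commute. -/
lemma divNu_lie_leibniz {A B C : PowerSeries (Module.End ℂ R)} (hA : IsNatural A)
    (hB : IsNatural B) (hC : IsNatural C) :
    divNu ⁅divNu ⁅A, B⁆, C⁆ = divNu ⁅A, divNu ⁅B, C⁆⁆ + divNu ⁅divNu ⁅A, C⁆, B⁆ := by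
  rw [← divNu_lie_left (hA.coeff_zero_lie hB), ← divNu_lie_left (hA.coeff_zero_lie hC),
    ← divNu_lie_right A (hB.coeff_zero_lie hC), ← divNu_add, ← divNu_add, commutator_leibniz]

end Natural

/-! ### Iterated commutators and induction on the fibre degree -/

section IterComm

variable {R : Type*} [CommRing R] [Algebra ℂ R] {ι : Type*}

/-- Iterated commutators with coordinate functions, as a linear map. -/
def iterCommHom (x : ι → R) (α : ι →₀ ℕ) : Module.End ℂ R →ₗ[ℂ] Module.End ℂ R where
  toFun := iterComm x α
  map_add' A B := by
    simp only [iterComm]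
    induction Finsupp.toMultiset α using Multiset.induction_on with
    | empty => simp
    | cons i s ih => simp only [Multiset.foldr_cons, ih]; noncomm_ring
  map_smul' c A := by
    simp only [iterComm]
    induction Finsupp.toMultiset α using Multiset.induction_on with
    | empty => simp
    | cons i s ih => simp [ih, smul_sub]

lemma iterCommHom_apply (x : ι → R) (α : ι →₀ ℕ) (A : Module.End ℂ R) :
    iterCommHom x α A = iterComm x α A := rfl

lemma iterComm_zero (x : ι → R) (A : Module.End ℂ R) : iterComm x 0 A = A := by
  simp [iterComm]

lemma iterComm_add_single (x : ι → R) (α : ι →₀ ℕ) (i : ι) (A : Module.End ℂ R) :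
    iterComm x (α + Finsupp.single i 1) A = iterComm x α ⁅A, mulOp (x i)⁆ := by
  simp only [iterComm, map_add, Multiset.foldr_add, Finsupp.toMultiset_single, one_smul]
  rfl

end IterComm

section Torsion

lemma ext_degree {R ι : Type*} [CommRing R] {P Q : MvPowerSeries ι R}
    (h : ∀ (d : ℕ) (α : ι →₀ ℕ), α.degree = d → MvPowerSeries.coeff α P = MvPowerSeries.coeff α Q) :
    P = Q :=
  MvPowerSeries.ext fun α => h _ α rfl

variable {R : Type*} [CommRing R] [Algebra ℂ R]

lemma natCast_mul_eq_zero {k : ℕ} (hk : k ≠ 0) {f : R} (h : f * k = 0) : f = 0 := by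
  have : ((k : ℂ)⁻¹) • ((k : ℂ) • f) = f := by
    rw [smul_smul, inv_mul_cancel₀ (by exact_mod_cast hk), one_smul]
  rw [← this, Algebra.smul_def (k : ℂ) f, map_natCast, mul_comm, h, smul_zero]

/-- Multiplication by a nonzero integer is injective on a complex algebra, so a homogeneous
component of positive degree is recovered from its fibre derivatives. This drives the inductions on
fibre degree below. -/
lemma coeff_eq_of_pderiv {ι : Type*} {P Q : MvPowerSeries ι R} {d : ℕ}
    (h : ∀ (i : ι) (β : ι →₀ ℕ), β.degree = d → MvPowerSeries.coeff β (MvPowerSeries.pderiv R i P) =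
      MvPowerSeries.coeff β (MvPowerSeries.pderiv R i Q)) (α : ι →₀ ℕ) (hα : α.degree = d + 1) :
    MvPowerSeries.coeff α P = MvPowerSeries.coeff α Q := by
  obtain ⟨i, hi⟩ : ∃ i, α i ≠ 0 := by
    by_contra! h0
    have : α = 0 := Finsupp.ext h0
    simp [this] at hα
  have hle : Finsupp.single i 1 ≤ α := by
    simpa [Finsupp.single_le_iff] using Nat.one_le_iff_ne_zero.2 hi
  obtain ⟨β, rfl⟩ := exists_add_of_le hle
  rw [add_comm] at *
  have hβ : β.degree = d := by simpa using hα
  have := h i β hβ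
  rw [MvPowerSeries.coeff_pderiv, MvPowerSeries.coeff_pderiv, ← sub_eq_zero, ← sub_mul] at this
  refine sub_eq_zero.1 (natCast_mul_eq_zero (k := β i + 1) (by omega) ?_)
  exact_mod_cast this

lemma pderiv_comm {R ι : Type*} [CommRing R] (i j : ι) (F : MvPowerSeries ι R) :
    MvPowerSeries.pderiv R i (MvPowerSeries.pderiv R j F) =
      MvPowerSeries.pderiv R j (MvPowerSeries.pderiv R i F) := by
  ext α
  classical
  simp only [MvPowerSeries.coeff_pderiv, Finsupp.add_apply, Finsupp.single_apply]
  rw [add_right_comm]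
  split_ifs with h1 h2 h2
  · subst h1; ring
  · exact absurd h1.symm h2
  · exact absurd h2.symm h1
  · push_cast; ring

end Torsion

/-! ### Calculus of symbols -/

namespace CoordSys

variable {R : Type*} [CommRing R] [Algebra ℂ R] {ι : Type*} (S : CoordSys R ι)

/-- The derivative with respect to a base coordinate. -/
def baseDeriv (i : ι) (P : MvPowerSeries ι R) : MvPowerSeries ι R :=
  fun α => S.D i (MvPowerSeries.coeff α P)

lemma coeff_baseDeriv (i : ι) (P : MvPowerSeries ι R) (α : ι →₀ ℕ) :
    MvPowerSeries.coeff α (S.baseDeriv i P) = S.D i (MvPowerSeries.coeff α P) := rfl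

lemma baseDeriv_pderiv (i j : ι) (P : MvPowerSeries ι R) :
    S.baseDeriv i (MvPowerSeries.pderiv R j P) = MvPowerSeries.pderiv R j (S.baseDeriv i P) := by
  ext α
  have : S.D i (α j + 1 : R) = 0 := by
    have := (S.D i).map_natCast (α j + 1)
    push_cast at this
    exact this
  rw [coeff_baseDeriv, MvPowerSeries.coeff_pderiv, MvPowerSeries.coeff_pderiv, coeff_baseDeriv,
    Derivation.leibniz, this]
  simp [mul_comm]

variable [Fintype ι]

/-- The standard Poisson bracket. -/
def poisson (P Q : MvPowerSeries ι R) : MvPowerSeries ι R :=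
  ∑ i, (MvPowerSeries.pderiv R i P * S.baseDeriv i Q - S.baseDeriv i P * MvPowerSeries.pderiv R i Q)

/-- The `σ`-symbol of a natural formal operator. -/
def sigma (A : PowerSeries (Module.End ℂ R)) : MvPowerSeries ι R :=
  fun α => ((∏ i, (α i).factorial : ℕ) : ℂ)⁻¹ •
    iterComm S.x α (PowerSeries.coeff α.degree A) 1

/-- The exponential of the Hamiltonian derivation. -/
def expHam (K Q : MvPowerSeries ι R) : MvPowerSeries ι R :=
  fun α => ∑ k ∈ Finset.range (α.degree + 1),
    ((k.factorial : ℂ)⁻¹) • MvPowerSeries.coeff α ((S.poisson K)^[k] Q)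

lemma coeff_sigma (A : PowerSeries (Module.End ℂ R)) (α : ι →₀ ℕ) :
    MvPowerSeries.coeff α (S.sigma A) = ((∏ i, (α i).factorial : ℕ) : ℂ)⁻¹ •
      iterComm S.x α (PowerSeries.coeff α.degree A) 1 := rfl

lemma coeff_expHam (K Q : MvPowerSeries ι R) (α : ι →₀ ℕ) :
    MvPowerSeries.coeff α (S.expHam K Q) = ∑ k ∈ Finset.range (α.degree + 1),
      ((k.factorial : ℂ)⁻¹) • MvPowerSeries.coeff α ((S.poisson K)^[k] Q) := rfl

lemma pderiv_poisson (j : ι) (P Q : MvPowerSeries ι R) :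
    MvPowerSeries.pderiv R j (S.poisson P Q) =
      S.poisson P (MvPowerSeries.pderiv R j Q) + S.poisson (MvPowerSeries.pderiv R j P) Q := by
  simp only [poisson, map_sum, map_sub, Derivation.leibniz, smul_eq_mul, baseDeriv_pderiv,
    ← Finset.sum_add_distrib]
  refine Finset.sum_congr rfl fun i _ => ?_
  rw [pderiv_comm j i P, pderiv_comm j i Q]
  ring

lemma sigma_add (A B : PowerSeries (Module.End ℂ R)) : S.sigma (A + B) = S.sigma A + S.sigma B := by
  ext α
  rw [map_add, coeff_sigma, coeff_sigma, coeff_sigma, map_add, ← iterCommHom_apply, map_add,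
    LinearMap.add_apply, smul_add]
  rfl

lemma sigma_sub (A B : PowerSeries (Module.End ℂ R)) : S.sigma (A - B) = S.sigma A - S.sigma B := by
  rw [eq_sub_iff_add_eq, ← sigma_add, sub_add_cancel]

lemma sigma_zero : S.sigma 0 = 0 := by
  simpa using S.sigma_sub 0 0

lemma constantCoeff_sigma (A : PowerSeries (Module.End ℂ R)) :
    MvPowerSeries.coeff 0 (S.sigma A) = PowerSeries.coeff 0 A 1 := by
  simp [coeff_sigma, iterComm_zero]

/-- The factor `α i + 1` produced by differentiation cancels against the factorials in the symbol.
Fibre derivatives of symbols thus become rescaled commutators with coordinates, so properties of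
symbols can be proved by induction on the degree. -/
lemma pderiv_sigma (A : PowerSeries (Module.End ℂ R)) (i : ι) :
    MvPowerSeries.pderiv R i (S.sigma A) =
      S.sigma (divNu ⁅A, PowerSeries.C (mulOp (S.x i))⁆) := by
  classical
  ext α
  have hf : (∏ j, ((α + Finsupp.single i 1 : ι →₀ ℕ) j).factorial) =
      (∏ j, (α j).factorial) * (α i + 1) := by
    rw [← Finset.mul_prod_erase _ _ (Finset.mem_univ i),
      ← Finset.mul_prod_erase Finset.univ (fun j => (α j).factorial) (Finset.mem_univ i)]
    have : ∏ j ∈ Finset.univ.erase i, ((α + Finsupp.single i 1 : ι →₀ ℕ) j).factorial =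
        ∏ j ∈ Finset.univ.erase i, (α j).factorial :=
      Finset.prod_congr rfl fun j hj => by
        simp [Finsupp.single_eq_of_ne (Finset.ne_of_mem_erase hj)]
    rw [this]
    simp [Nat.factorial_succ]
    ring
  have hd : (α + Finsupp.single i 1).degree = α.degree + 1 := by simp
  rw [MvPowerSeries.coeff_pderiv, coeff_sigma, coeff_sigma, iterComm_add_single, hf, coeff_divNu,
    coeff_lie_C, hd]
  have : ((α i : R) + 1) = algebraMap ℂ R (α i + 1) := by simp
  rw [this, mul_comm, ← Algebra.smul_def, smul_smul]
  congr 1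
  have h1 : ((α i : ℂ) + 1) ≠ 0 := Nat.cast_add_one_ne_zero _
  push_cast
  rw [mul_inv, mul_comm, mul_assoc, inv_mul_cancel₀ h1, mul_one]

lemma sigma_eq_zero {A : PowerSeries (Module.End ℂ R)}
    (h : ∀ r, PowerSeries.coeff r A ∈ orderLT r) : S.sigma A = 0 := by
  refine ext_degree fun d => ?_
  induction d generalizing A with
  | zero =>
    intro α hα
    obtain rfl := (Finsupp.degree_eq_zero_iff α).1 hα
    rw [constantCoeff_sigma, mem_orderLT_zero.1 (h 0)]
    simp
  | succ d ih =>
    refine coeff_eq_of_pderiv fun i β hβ => ?_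
    rw [pderiv_sigma, map_zero]
    refine ih (fun r => ?_) β hβ
    rw [coeff_divNu, coeff_lie_C]
    exact BerezinLog.mem_orderLT_succ.1 (h (r + 1)) _

/-- Commuting with each coordinate lowers both the index and the order, and the resulting operators
have zero symbol as well. With `sigma_eq_zero` this identifies the kernel of `σ` on natural
operators as those divisible by `ν` with natural quotient. -/
lemma coeff_mem_orderLT_of_sigma_eq_zero {A : PowerSeries (Module.End ℂ R)} (hA : IsNatural A)
    (h : S.sigma A = 0) (r : ℕ) : PowerSeries.coeff r A ∈ orderLT r := by
  induction r generalizing A with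
  | zero =>
    rw [mem_orderLT_zero, hA.coeff_zero, ← S.constantCoeff_sigma, h]
    simp
  | succ r ih =>
    refine S.mem_orderLT_succ (isNatural_iff.1 hA (r + 1)) fun i => ?_
    have := ih (hA.divNu_lie (isNatural_C (S.x i))) (by rw [← pderiv_sigma, h, map_zero])
    rwa [coeff_divNu, coeff_lie_C] at this

lemma sigma_C (f : R) : S.sigma (PowerSeries.C (mulOp f)) = MvPowerSeries.C f := by
  refine ext_degree fun d => ?_
  cases d with
  | zero =>
    intro α hα
    obtain rfl := (Finsupp.degree_eq_zero_iff α).1 hα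
    rw [constantCoeff_sigma]
    simp
  | succ d =>
    refine coeff_eq_of_pderiv fun i β hβ => ?_
    rw [pderiv_sigma, MvPowerSeries.pderiv_C]
    have : divNu ⁅PowerSeries.C (mulOp f), PowerSeries.C (mulOp (S.x i))⁆ = 0 := by
      ext1 r
      rw [coeff_divNu, coeff_lie_C, PowerSeries.coeff_C, if_neg (Nat.succ_ne_zero r),
        commutator_zero_left, map_zero]
    rw [this, sigma_zero]

/-- Both sides satisfy the same Leibniz rule under fibre derivatives: the left by the Jacobi
identity for `ν⁻¹[·,·]`, the right by `pderiv_poisson`. Only the component of degree zero has to be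
computed. -/
lemma sigma_divNu_lie {A B : PowerSeries (Module.End ℂ R)} (hA : IsNatural A) (hB : IsNatural B) :
    S.sigma (divNu ⁅A, B⁆) = S.poisson (S.sigma A) (S.sigma B) := by
  refine ext_degree fun d => ?_
  induction d generalizing A B with
  | zero =>
    intro α hα
    obtain rfl := (Finsupp.degree_eq_zero_iff α).1 hα
    have h1 (C : PowerSeries (Module.End ℂ R)) (i : ι) :
        MvPowerSeries.constantCoeff (MvPowerSeries.pderiv R i (S.sigma C)) =
          ⁅PowerSeries.coeff 1 C, mulOp (S.x i)⁆ 1 := by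
      rw [← MvPowerSeries.coeff_zero_eq_constantCoeff_apply, pderiv_sigma, constantCoeff_sigma,
        coeff_divNu, coeff_lie_C]
    have h2 (C : PowerSeries (Module.End ℂ R)) (i : ι) :
        MvPowerSeries.constantCoeff (S.baseDeriv i (S.sigma C)) =
          S.D i (PowerSeries.coeff 0 C 1) := by
      rw [← MvPowerSeries.coeff_zero_eq_constantCoeff_apply, coeff_baseDeriv, constantCoeff_sigma]
    rw [constantCoeff_sigma, MvPowerSeries.coeff_zero_eq_constantCoeff_apply]
    simp only [poisson, map_sum, map_sub, map_mul, h1, h2, Finset.sum_sub_distrib]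
    -- In degree zero the Poisson bracket is `[A₁, B₀] 1 - [B₁, A₀] 1`: here `A₀`, `B₀` are
    -- multiplication operators, and a commutator with `A₁` or `B₁` is a derivation expanded in
    -- coordinates.
    rw [← S.lie_mulOp_apply_one (isNatural_iff.1 hA 1), coeff_divNu, coeff_lie]
    simp only [mul_comm (S.D _ _)]
    rw [← S.lie_mulOp_apply_one (isNatural_iff.1 hB 1), ← hA.coeff_zero, ← hB.coeff_zero,
      Finset.Nat.sum_antidiagonal_eq_sum_range_succ_mk]
    simp only [Finset.sum_range_succ, Finset.sum_range_zero]
    simp [Ring.lie_def]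
    ring
  | succ d ih =>
    refine coeff_eq_of_pderiv fun i β hβ => ?_
    have hx := isNatural_C (S.x i)
    rw [pderiv_sigma, divNu_lie_leibniz hA hB hx, sigma_add, pderiv_poisson, pderiv_sigma,
      pderiv_sigma, map_add, map_add, ih hA (hB.divNu_lie hx) β hβ,
      ih (hA.divNu_lie hx) hB β hβ]

end CoordSys

/-! ### Operators of finite order -/

section DiffOp

variable {R : Type*} [CommRing R] [Algebra ℂ R]

variable (R) in
/-- The algebra of differential operators of finite order. -/
def diffOp : Subring (Module.End ℂ R) where
  carrier := {A | ∃ N, A ∈ orderLT N}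
  mul_mem' := fun ⟨p, hp⟩ ⟨q, hq⟩ => ⟨p + q, mul_mem_orderLT (Nat.le_succ _) hp hq⟩
  one_mem' := ⟨1, by
    have : (1 : Module.End ℂ R) = mulOp 1 := by ext; simp
    rw [this]; exact mulOp_mem_orderLT 1⟩
  add_mem' := fun ⟨p, hp⟩ ⟨q, hq⟩ =>
    ⟨p + q,
     add_mem (orderLT_mono (Nat.le_add_right p q) hp) (orderLT_mono (Nat.le_add_left q p) hq)⟩
  zero_mem' := ⟨0, zero_mem _⟩
  neg_mem' := fun ⟨p, hp⟩ => ⟨p, neg_mem hp⟩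

lemma mem_diffOp_of_hasOrder {A : Module.End ℂ R} {N : ℕ} (h : HasOrder N A) : A ∈ diffOp R :=
  ⟨N + 1, hasOrder_iff.1 h⟩

end DiffOp

/-! ### Formal exponentials and conjugation -/

section Exp

variable {E : Type*} [Ring E]

lemma iterate_lie_X_mul (Z V : PowerSeries E) (k : ℕ) :
    (fun W => ⁅PowerSeries.X * Z, W⁆)^[k] V = PowerSeries.X ^ k * (fun W => ⁅Z, W⁆)^[k] V := by
  induction k with
  | zero => simp
  | succ k ih =>
    have h (m : ℕ) (U : PowerSeries E) :
        ⁅Z, PowerSeries.X ^ m * U⁆ = PowerSeries.X ^ m * ⁅Z, U⁆ := by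
      induction m generalizing U with
      | zero => simp
      | succ m ih => rw [pow_succ, mul_assoc, ih, lie_X_mul, mul_assoc]
    rw [Function.iterate_succ_apply', Function.iterate_succ_apply', ih, X_mul_lie, h, ← mul_assoc,
      ← pow_succ']

lemma coeff_iterate_lie {Y V : PowerSeries E} (hY : PowerSeries.coeff 0 Y = 0) (k r : ℕ) :
    PowerSeries.coeff r ((fun W => ⁅Y, W⁆)^[k] V) = if k ≤ r then
      PowerSeries.coeff (r - k) ((fun W => ⁅divNu Y, W⁆)^[k] V) else 0 := by
  conv_lhs => rw [← X_mul_divNu hY]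
  rw [iterate_lie_X_mul, PowerSeries.coeff_X_pow_mul']

lemma coeff_pow_eq_zero {Y : PowerSeries E} (hY : PowerSeries.coeff 0 Y = 0) {k r : ℕ}
    (h : r < k) : PowerSeries.coeff r (Y ^ k) = 0 := by
  rw [← X_mul_divNu hY, (PowerSeries.commute_X _).symm.mul_pow, PowerSeries.coeff_X_pow_mul',
    if_neg (by omega)]

/-- A series with leading coefficient `1` can be cancelled on the right, coefficient by coefficient.
-/
lemma eq_of_mul_eq_mul_right {A A' B : PowerSeries E} (hB : PowerSeries.coeff 0 B = 1)
    (h : A * B = A' * B) : A = A' := by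
  ext r
  induction r using Nat.strong_induction_on with
  | _ r ih =>
    have h1 := congrArg (PowerSeries.coeff r) h
    rw [PowerSeries.coeff_mul, PowerSeries.coeff_mul,
      Finset.Nat.sum_antidiagonal_eq_sum_range_succ_mk,
      Finset.Nat.sum_antidiagonal_eq_sum_range_succ_mk, Finset.sum_range_succ,
      Finset.sum_range_succ, Finset.sum_congr rfl fun i hi => by
        rw [ih i (Finset.mem_range.1 hi)], add_right_inj] at h1
    simpa [hB] using h1

variable [Algebra ℂ E]

/-- `∑ₖ ad(Y)ᵏ V / k!` for a formal series `Y` without constant term. -/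
def expAd (Y V : PowerSeries E) : PowerSeries E :=
  PowerSeries.mk fun r => ∑ k ∈ Finset.range (r + 1),
    ((k.factorial : ℂ)⁻¹) • PowerSeries.coeff r ((fun W => ⁅Y, W⁆)^[k] V)

lemma coeff_expAd (Y V : PowerSeries E) (r : ℕ) :
    PowerSeries.coeff r (expAd Y V) = ∑ k ∈ Finset.range (r + 1),
      ((k.factorial : ℂ)⁻¹) • PowerSeries.coeff r ((fun W => ⁅Y, W⁆)^[k] V) := by
  simp [expAd]

/-- Left multiplication by `Y` is the sum of `ad Y` and right multiplication by `Y`, and these two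
commute; this is the binomial theorem applied to `V`. -/
lemma pow_mul_eq_sum (Y V : PowerSeries E) (m : ℕ) :
    Y ^ m * V = ∑ p ∈ Finset.HasAntidiagonal.antidiagonal m,
      m.choose p.1 • ((fun W => ⁅Y, W⁆)^[p.1] V * Y ^ p.2) := by
  set D : Module.End ℂ (PowerSeries E) :=
    LinearMap.mulLeft ℂ Y - LinearMap.mulRight ℂ Y with hD
  have hc : Commute D (LinearMap.mulRight ℂ Y) :=
    (LinearMap.commute_mulLeft_right (R := ℂ) Y Y).sub_left (Commute.refl _)
  have h := LinearMap.congr_fun (hc.add_pow' m) V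
  rw [hD, sub_add_cancel, LinearMap.pow_mulLeft, LinearMap.mulLeft_apply, LinearMap.sum_apply] at h
  rw [h]
  refine Finset.sum_congr rfl fun p _ => ?_
  rw [LinearMap.smul_apply, ← hD, (hc.pow_pow p.1 p.2).eq, Module.End.mul_apply,
    LinearMap.pow_mulRight, LinearMap.mulRight_apply, Module.End.pow_apply]
  rfl

end Exp

section FormalExp

variable {R : Type*} [CommRing R] [Algebra ℂ R]

lemma coeff_zero_formalExp (Y : PowerSeries (Module.End ℂ R)) :
    PowerSeries.coeff 0 (formalExp Y) = 1 := by
  simp [formalExp]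

lemma coeff_one_formalExp (Y : PowerSeries (Module.End ℂ R)) :
    PowerSeries.coeff 1 (formalExp Y) = PowerSeries.coeff 1 Y := by
  simp [formalExp, Finset.sum_range_succ, PowerSeries.coeff_one]

lemma coeff_formalExp_of_le {Y : PowerSeries (Module.End ℂ R)} (hY : PowerSeries.coeff 0 Y = 0)
    {i r : ℕ} (hi : i ≤ r) : PowerSeries.coeff i (formalExp Y) =
      ∑ k ∈ Finset.range (r + 1), ((k.factorial : ℂ)⁻¹) • PowerSeries.coeff i (Y ^ k) := by
  rw [formalExp, PowerSeries.coeff_mk]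
  refine Finset.sum_subset (Finset.range_mono (by omega)) fun k _ hk => ?_
  rw [coeff_pow_eq_zero hY (by simpa using hk), smul_zero]

/-- This is `e^{ad Y} V = e^Y V e^{-Y}` without the inverse. Both sides are sums of `ad(Y)^p V · Y^q
/ (p! q!)`, taken over a square on the left and, by the binomial expansion, over a triangle on the
right. -/
lemma expAd_mul_formalExp {Y : PowerSeries (Module.End ℂ R)} (hY : PowerSeries.coeff 0 Y = 0)
    (V : PowerSeries (Module.End ℂ R)) : expAd Y V * formalExp Y = formalExp Y * V := by
  ext1 r
  set F : ℕ × ℕ → Module.End ℂ R := fun p => ((p.1.factorial : ℂ)⁻¹ * (p.2.factorial : ℂ)⁻¹) •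
    PowerSeries.coeff r ((fun W => ⁅Y, W⁆)^[p.1] V * Y ^ p.2) with hF
  have hl : PowerSeries.coeff r (expAd Y V * formalExp Y) =
      ∑ p ∈ Finset.range (r + 1) ×ˢ Finset.range (r + 1), F p := by
    have h1 (i : ℕ) (hi : i ≤ r) : PowerSeries.coeff i (expAd Y V) =
        ∑ k ∈ Finset.range (r + 1),
          ((k.factorial : ℂ)⁻¹) • PowerSeries.coeff i ((fun W => ⁅Y, W⁆)^[k] V) := by
      rw [coeff_expAd]
      refine Finset.sum_subset (Finset.range_mono (by omega)) fun k _ hk => ?_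
      rw [coeff_iterate_lie hY, if_neg (by simpa using hk), smul_zero]
    rw [PowerSeries.coeff_mul, Finset.sum_congr rfl fun p hp => by
      have := Finset.HasAntidiagonal.mem_antidiagonal.1 hp
      rw [h1 p.1 (by omega), coeff_formalExp_of_le hY (show p.2 ≤ r by omega), Finset.sum_mul_sum,
        ← Finset.sum_product'],
      Finset.sum_comm]
    refine Finset.sum_congr rfl fun q _ => ?_
    rw [hF]
    simp only [PowerSeries.coeff_mul, Finset.smul_sum, smul_mul_smul_comm]
  have hr : PowerSeries.coeff r (formalExp Y * V) =
      ∑ m ∈ Finset.range (r + 1), ∑ p ∈ Finset.HasAntidiagonal.antidiagonal m, F p := by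
    have h1 : PowerSeries.coeff r (formalExp Y * V) =
        ∑ m ∈ Finset.range (r + 1), ((m.factorial : ℂ)⁻¹) • PowerSeries.coeff r (Y ^ m * V) := by
      rw [PowerSeries.coeff_mul, Finset.sum_congr rfl fun p hp => by
        have := Finset.HasAntidiagonal.mem_antidiagonal.1 hp
        rw [coeff_formalExp_of_le hY (show p.1 ≤ r by omega), Finset.sum_mul], Finset.sum_comm]
      refine Finset.sum_congr rfl fun q _ => ?_
      simp only [PowerSeries.coeff_mul, Finset.smul_sum, smul_mul_assoc]
    rw [h1]
    refine Finset.sum_congr rfl fun m _ => ?_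
    rw [pow_mul_eq_sum, map_sum, Finset.smul_sum]
    refine Finset.sum_congr rfl fun p hp => ?_
    have := Finset.HasAntidiagonal.mem_antidiagonal.1 hp
    rw [hF, map_nsmul, ← Nat.cast_smul_eq_nsmul ℂ, smul_smul]
    congr 1
    have h3 : ((p.1 + p.2).factorial : ℂ) ≠ 0 := by exact_mod_cast Nat.factorial_ne_zero _
    rw [← this, Nat.cast_add_choose]
    field_simp
  rw [hl, hr]
  -- Since `Y` is divisible by `ν`, the term of index `(p, q)` is divisible by `ν^(p+q)`. The part
  -- of the square outside the triangle therefore contributes nothing at `ν^r`.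
  have hz : ∑ p ∈ Finset.range (r + 1) ×ˢ Finset.range (r + 1), F p =
      ∑ p ∈ Finset.range (r + 1) ×ˢ Finset.range (r + 1) with p.1 + p.2 ≤ r, F p := by
    refine (Finset.sum_filter_of_ne fun p _ hp => ?_).symm
    by_contra! hlt
    refine hp ?_
    rw [hF]
    simp only
    rw [PowerSeries.coeff_mul, Finset.sum_eq_zero, smul_zero]
    intro q hq
    have := Finset.HasAntidiagonal.mem_antidiagonal.1 hq
    rw [coeff_iterate_lie hY]
    split_ifs with h
    · rw [coeff_pow_eq_zero hY (by omega), mul_zero]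
    · rw [zero_mul]
  rw [hz, ← Finset.sum_fiberwise_of_maps_to (t := Finset.range (r + 1)) (g := fun p => p.1 + p.2)
    (fun p hp => by
      rw [Finset.mem_filter] at hp
      exact Finset.mem_range.2 (by omega))]
  refine Finset.sum_congr rfl fun m hm => Finset.sum_congr ?_ fun _ _ => rfl
  have := Finset.mem_range.1 hm
  ext p
  simp only [Finset.mem_filter, Finset.mem_product, Finset.mem_range,
    Finset.HasAntidiagonal.mem_antidiagonal]
  omega

end FormalExp

/-! ### Fibre order of Poisson brackets -/

section Order

variable {ι R : Type*} [CommRing R] [Algebra ℂ R]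

lemma le_order_poisson [Fintype ι] (S : CoordSys R ι) {p q m : ℕ} (h : m + 1 ≤ p + q)
    {P Q : MvPowerSeries ι R} (hP : (p : ℕ∞) ≤ P.order) (hQ : (q : ℕ∞) ≤ Q.order) :
    (m : ℕ∞) ≤ (S.poisson P Q).order := by
  have hb (i : ι) (r : ℕ) (F : MvPowerSeries ι R) (hF : (r : ℕ∞) ≤ F.order) :
      (r : ℕ∞) ≤ (S.baseDeriv i F).order := by
    refine MvPowerSeries.nat_le_order fun d hd => ?_
    rw [S.coeff_baseDeriv,
      MvPowerSeries.coeff_of_lt_order (lt_of_lt_of_le (by exact_mod_cast hd) hF),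
      map_zero]
  have hp (i : ι) (r : ℕ) (F : MvPowerSeries ι R) (hF : (r : ℕ∞) ≤ F.order) :
      ((r - 1 : ℕ) : ℕ∞) ≤ (MvPowerSeries.pderiv R i F).order := by
    refine MvPowerSeries.nat_le_order fun d hd => ?_
    rw [MvPowerSeries.coeff_pderiv, MvPowerSeries.coeff_of_lt_order (lt_of_lt_of_le ?_ hF),
      zero_mul]
    have : (d + Finsupp.single i 1).degree < r := by simp; omega
    exact_mod_cast this
  have hm (a b : ℕ) (F G : MvPowerSeries ι R) (hab : m ≤ a + b) (hF : (a : ℕ∞) ≤ F.order)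
      (hG : (b : ℕ∞) ≤ G.order) (d : ι →₀ ℕ) (hd : d.degree < m) :
      MvPowerSeries.coeff d (F * G) = 0 := by
    refine MvPowerSeries.coeff_of_lt_order (lt_of_lt_of_le ?_
      ((add_le_add hF hG).trans MvPowerSeries.le_order_mul))
    exact_mod_cast (by omega : d.degree < a + b)
  refine MvPowerSeries.nat_le_order fun d hd => ?_
  rw [CoordSys.poisson, map_sum]
  refine Finset.sum_eq_zero fun i _ => ?_
  rw [map_sub, hm (p - 1) q _ _ (by omega) (hp i p P hP) (hb i q Q hQ) d hd,
    hm p (q - 1) _ _ (by omega) (hb i p P hP) (hp i q Q hQ) d hd, sub_zero]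

end Order

/-! ### Symbols of conjugated functions -/

section ExpAd

variable {R : Type*} [CommRing R] [Algebra ℂ R]

/-- `[X/ν, W]` is the rescaled commutator `ν⁻¹[X, W]`, which preserves naturality although `X/ν`
itself need not be natural. -/
lemma IsNatural.iterate_lie {X : PowerSeries (Module.End ℂ R)} (hX : IsNatural X)
    (h0 : PowerSeries.coeff 0 X = 0) (f : R) (k : ℕ) :
    IsNatural ((fun W => ⁅divNu X, W⁆)^[k] (PowerSeries.C (mulOp f))) := by
  induction k with
  | zero => exact isNatural_C f
  | succ k ih =>
    rw [Function.iterate_succ_apply', ← divNu_lie_left h0]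
    exact hX.divNu_lie ih

lemma IsNatural.expAd {X : PowerSeries (Module.End ℂ R)} (hX : IsNatural X)
    (h0 : PowerSeries.coeff 0 X = 0) (f : R) :
    IsNatural (expAd (divNu X) (PowerSeries.C (mulOp f))) :=
  isNatural_iff.2 fun r => by
    rw [coeff_expAd]
    exact sum_mem fun k _ => Submodule.smul_mem _ _ (isNatural_iff.1 (hX.iterate_lie h0 f k) r)

end ExpAd

namespace CoordSys

section Symbols

variable {R : Type*} [CommRing R] [Algebra ℂ R] {ι : Type*} [Fintype ι] (S : CoordSys R ι)

lemma poisson_sub_left (P P' Q : MvPowerSeries ι R) :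
    S.poisson (P - P') Q = S.poisson P Q - S.poisson P' Q := by
  have (i : ι) : S.baseDeriv i (P - P') = S.baseDeriv i P - S.baseDeriv i P' := by
    ext α; simp [coeff_baseDeriv]
  simp only [poisson, this, map_sub, sub_mul, ← Finset.sum_sub_distrib]
  exact Finset.sum_congr rfl fun i _ => by ring

lemma poisson_sub_right (P Q Q' : MvPowerSeries ι R) :
    S.poisson P (Q - Q') = S.poisson P Q - S.poisson P Q' := by
  have (i : ι) : S.baseDeriv i (Q - Q') = S.baseDeriv i Q - S.baseDeriv i Q' := by
    ext α; simp [coeff_baseDeriv]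
  simp only [poisson, this, map_sub, mul_sub, ← Finset.sum_sub_distrib]
  exact Finset.sum_congr rfl fun i _ => by ring

lemma poisson_C_x (P : MvPowerSeries ι R) (i : ι) :
    S.poisson P (MvPowerSeries.C (S.x i)) = MvPowerSeries.pderiv R i P := by
  classical
  have h (j : ι) : S.baseDeriv j (MvPowerSeries.C (S.x i)) = if j = i then 1 else 0 := by
    ext α
    rw [coeff_baseDeriv, MvPowerSeries.coeff_C]
    split_ifs with h1 h2 h2
    · rw [h2, S.D_x_self, h1]; simp
    · rw [S.D_x_of_ne _ _ h2]; simp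
    · rw [map_zero, MvPowerSeries.coeff_one, if_neg h1]
    · simp
  simp [poisson, h]

lemma sigma_iterate_lie {X : PowerSeries (Module.End ℂ R)} (hX : IsNatural X)
    (h0 : PowerSeries.coeff 0 X = 0) (f : R) (k : ℕ) :
    S.sigma ((fun W => ⁅divNu X, W⁆)^[k] (PowerSeries.C (mulOp f))) =
      (S.poisson (S.sigma X))^[k] (MvPowerSeries.C f) := by
  induction k with
  | zero => exact S.sigma_C f
  | succ k ih =>
    rw [Function.iterate_succ_apply', Function.iterate_succ_apply', ← divNu_lie_left h0,
      S.sigma_divNu_lie hX (hX.iterate_lie h0 f k), ih]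

/-- The coefficient at `α` of a symbol only sees the power `ν^|α|`, so both exponentials are
truncated at the same index and can be compared term by term. -/
lemma sigma_expAd {X : PowerSeries (Module.End ℂ R)} (hX : IsNatural X)
    (h0 : PowerSeries.coeff 0 X = 0) (f : R) :
    S.sigma (expAd (divNu X) (PowerSeries.C (mulOp f))) =
      S.expHam (S.sigma X) (MvPowerSeries.C f) := by
  ext1 α
  rw [coeff_sigma, coeff_expAd, ← iterCommHom_apply, map_sum, LinearMap.sum_apply, Finset.smul_sum,
    coeff_expHam]
  refine Finset.sum_congr rfl fun k _ => ?_
  rw [← S.sigma_iterate_lie hX h0 f k, coeff_sigma, map_smul, LinearMap.smul_apply, smul_comm]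
  rfl

/-- The Poisson bracket extended by `ε`-linearity. -/
def poissonEps (P Q : DualNumber (MvPowerSeries ι R)) : DualNumber (MvPowerSeries ι R) :=
  (S.poisson P.fst Q.fst, S.poisson P.fst Q.snd + S.poisson P.snd Q.fst)

/-- The exponential of a Hamiltonian derivation over dual numbers. -/
def expHamEps (F Q : DualNumber (MvPowerSeries ι R)) : DualNumber (MvPowerSeries ι R) :=
  (fun α => ∑ k ∈ Finset.range (α.degree + 1),
      ((k.factorial : ℂ)⁻¹) • MvPowerSeries.coeff α ((S.poissonEps F)^[k] Q).fst,
    fun α => ∑ k ∈ Finset.range (α.degree + 1),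
      ((k.factorial : ℂ)⁻¹) • MvPowerSeries.coeff α ((S.poissonEps F)^[k] Q).snd)

lemma coeff_expHamEps_fst (F Q : DualNumber (MvPowerSeries ι R)) (α : ι →₀ ℕ) :
    MvPowerSeries.coeff α (S.expHamEps F Q).fst = ∑ k ∈ Finset.range (α.degree + 1),
      ((k.factorial : ℂ)⁻¹) • MvPowerSeries.coeff α ((S.poissonEps F)^[k] Q).fst := rfl

lemma coeff_expHamEps_snd (F Q : DualNumber (MvPowerSeries ι R)) (α : ι →₀ ℕ) :
    MvPowerSeries.coeff α (S.expHamEps F Q).snd = ∑ k ∈ Finset.range (α.degree + 1),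
      ((k.factorial : ℂ)⁻¹) • MvPowerSeries.coeff α ((S.poissonEps F)^[k] Q).snd := rfl

/-- For each iterate, the `ε`-component is the symbol of `ν⁻¹` times the difference of the iterated
commutators for `X` and `X'`. Exact divisibility and naturality of this difference must be carried
along in the same induction. -/
lemma iterate_poissonEps {X X' : PowerSeries (Module.End ℂ R)} (hX : IsNatural X)
    (hX' : IsNatural X') (h0 : PowerSeries.coeff 0 X = 0) (h0' : PowerSeries.coeff 0 X' = 0)
    (hs : S.sigma X = S.sigma X') (hW : IsNatural (divNu (X - X'))) (f : R)
    {F Q : DualNumber (MvPowerSeries ι R)} (hF : F.fst = S.sigma X)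
    (hF' : F.snd = S.sigma (divNu (X - X'))) (hQ : Q.fst = MvPowerSeries.C f) (hQ' : Q.snd = 0)
    (k : ℕ) :
    let V := (fun W => ⁅divNu X, W⁆)^[k] (PowerSeries.C (mulOp f))
    let V' := (fun W => ⁅divNu X', W⁆)^[k] (PowerSeries.C (mulOp f))
    PowerSeries.coeff 0 (V - V') = 0 ∧ IsNatural (divNu (V - V')) ∧
      ((S.poissonEps F)^[k] Q).fst = S.sigma V ∧
      ((S.poissonEps F)^[k] Q).snd = S.sigma (divNu (V - V')) := by
  induction k with
  | zero =>
    simp only [Function.iterate_zero, id_eq, sub_self, divNu_zero, S.sigma_zero, S.sigma_C, hQ, hQ',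
      map_zero, and_self, and_true, true_and]
    exact isNatural_iff.2 fun r => by rw [map_zero]; exact zero_mem _
  | succ k ih =>
    have hV := hX.iterate_lie h0 f k
    have hV' := hX'.iterate_lie h0' f k
    have hVs := S.sigma_iterate_lie hX h0 f k
    have hVs' := S.sigma_iterate_lie hX' h0' f k
    simp only [Function.iterate_succ_apply']
    set V := (fun W => ⁅divNu X, W⁆)^[k] (PowerSeries.C (mulOp f)) with hVd
    set V' := (fun W => ⁅divNu X', W⁆)^[k] (PowerSeries.C (mulOp f)) with hVd'
    obtain ⟨hc, hn, he, he'⟩ := ih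
    have hXX : PowerSeries.coeff 0 (X - X') = 0 := by rw [map_sub, h0, h0', sub_self]
    -- The difference of the two brackets is redistributed so that every `ν⁻¹` acts on a difference.
    -- Dividing once more by `ν` then yields `ε`-linear Poisson brackets.
    have key : ⁅divNu X, V⁆ - ⁅divNu X', V'⁆ = ⁅X, divNu (V - V')⁆ + ⁅divNu (X - X'), V'⁆ := by
      rw [← divNu_lie_left h0, ← divNu_lie_left h0', ← divNu_lie_right X hc, ← divNu_lie_left hXX,
        ← divNu_sub, ← divNu_add, commutator_sub_commutator]
    rw [key, divNu_add, S.sigma_add]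
    refine ⟨?_, ?_, ?_, ?_⟩
    · rw [map_add, hX.coeff_zero_lie hn, hW.coeff_zero_lie hV', add_zero]
    · refine isNatural_iff.2 fun r => ?_
      rw [map_add]
      exact add_mem (isNatural_iff.1 (hX.divNu_lie hn) r) (isNatural_iff.1 (hW.divNu_lie hV') r)
    · rw [← divNu_lie_left h0, S.sigma_divNu_lie hX hV, ← he, ← hF]
      rfl
    · rw [S.sigma_divNu_lie hX hn, S.sigma_divNu_lie hW hV', hVs', ← hs, ← hVs, ← he, ← he', ← hF,
        ← hF']
      rfl

/-- Termwise comparison by `iterate_poissonEps` requires reconciling the truncations: dividing the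
difference by `ν` moves the relevant power to `ν^(|α|+1)`, so one extra exponential term appears. It
cancels because `X₂ = X'₂`. -/
lemma expHamEps_eq {X X' : PowerSeries (Module.End ℂ R)} (hX : IsNatural X)
    (hX' : IsNatural X') (h0 : PowerSeries.coeff 0 X = 0) (h0' : PowerSeries.coeff 0 X' = 0)
    (h1 : PowerSeries.coeff 1 X = 0) (h1' : PowerSeries.coeff 1 X' = 0)
    (h2 : PowerSeries.coeff 2 X = PowerSeries.coeff 2 X')
    (hs : S.sigma X = S.sigma X') (hW : IsNatural (divNu (X - X'))) (f : R)
    {F Q : DualNumber (MvPowerSeries ι R)} (hF : F.fst = S.sigma X)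
    (hF' : F.snd = S.sigma (divNu (X - X'))) (hQ : Q.fst = MvPowerSeries.C f) (hQ' : Q.snd = 0) :
    (S.expHamEps F Q).fst = S.sigma (expAd (divNu X) (PowerSeries.C (mulOp f))) ∧
      (S.expHamEps F Q).snd = S.sigma (divNu (expAd (divNu X) (PowerSeries.C (mulOp f)) -
          expAd (divNu X') (PowerSeries.C (mulOp f)))) := by
  have h := S.iterate_poissonEps hX hX' h0 h0' hs hW f hF hF' hQ hQ'
  constructor
  · rw [S.sigma_expAd hX h0]
    ext1 α
    rw [coeff_expHam, coeff_expHamEps_fst]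
    refine Finset.sum_congr rfl fun k _ => ?_
    rw [(h k).2.2.1, S.sigma_iterate_lie hX h0 f k]
  · ext1 α
    rw [coeff_expHamEps_snd, coeff_sigma, coeff_divNu, map_sub, coeff_expAd, coeff_expAd,
      ← Finset.sum_sub_distrib,
      Finset.sum_range_succ _ (α.degree + 1)]
    -- As `X/ν` starts with `ν X₂`, the coefficient of its `k`-fold commutator at `ν^k` is `ad(X₂)^k
    -- f`, which depends on `X₂` only.
    have htop : PowerSeries.coeff (α.degree + 1)
          ((fun W => ⁅divNu X, W⁆)^[α.degree + 1] (PowerSeries.C (mulOp f))) =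
        PowerSeries.coeff (α.degree + 1)
          ((fun W => ⁅divNu X', W⁆)^[α.degree + 1] (PowerSeries.C (mulOp f))) := by
      have hz (Z : PowerSeries (Module.End ℂ R)) (k : ℕ) :
          PowerSeries.coeff 0 ((fun W => ⁅Z, W⁆)^[k] (PowerSeries.C (mulOp f))) =
            (fun W => ⁅PowerSeries.coeff 0 Z, W⁆)^[k] (mulOp f) := by
        induction k with
        | zero => simp
        | succ k ih =>
          rw [Function.iterate_succ_apply', Function.iterate_succ_apply', ← ih]
          simp [Ring.lie_def]
      rw [coeff_iterate_lie (Y := divNu X) (by rw [coeff_divNu, zero_add, h1]) (α.degree + 1),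
        if_pos le_rfl,
        coeff_iterate_lie (Y := divNu X') (by rw [coeff_divNu, zero_add, h1']) (α.degree + 1),
        if_pos le_rfl,
        Nat.sub_self, hz, hz, coeff_divNu, coeff_divNu, coeff_divNu, coeff_divNu, h2]
    rw [htop, sub_self, add_zero, ← iterCommHom_apply, map_sum, LinearMap.sum_apply,
      Finset.smul_sum]
    refine Finset.sum_congr rfl fun k _ => ?_
    rw [(h k).2.2.2, ← smul_sub, map_smul, LinearMap.smul_apply, smul_comm, ← map_sub,
      ← coeff_divNu]
    rfl

end Symbols

end CoordSys

/-! ### Uniqueness from the quadratic part -/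

namespace CoordSys

variable {R : Type*} [CommRing R] [Algebra ℂ R] {κ : Type*} [Fintype κ] (S : CoordSys R (κ ⊕ κ))

/-- If `K` and `K'` agree below degree `d ≥ 3`, then `e^{H_K} x_i` and `e^{H_K'} x_i` differ in
degree `d - 1` exactly by the component of `∂_i (K - K')`. The equations kill its derivatives `∂_j`
for `j` of the same type as `i`, and a third derivative with three arbitrary indices always contains
such a pair. -/
lemma eq_of_poisson_expHam_eq_zero {K K' : MvPowerSeries (κ ⊕ κ) R}
    (hK : ∀ α : κ ⊕ κ →₀ ℕ, α.degree < 2 → MvPowerSeries.coeff α K = 0)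
    (hK' : ∀ α : κ ⊕ κ →₀ ℕ, α.degree < 2 → MvPowerSeries.coeff α K' = 0)
    (h2 : ∀ α : κ ⊕ κ →₀ ℕ, α.degree = 2 → MvPowerSeries.coeff α K = MvPowerSeries.coeff α K')
    (h : ∀ i j : κ ⊕ κ, i.isLeft = j.isLeft →
      S.poisson (S.expHam K (MvPowerSeries.C (S.x i))) (MvPowerSeries.C (S.x j)) = 0)
    (h' : ∀ i j : κ ⊕ κ, i.isLeft = j.isLeft →
      S.poisson (S.expHam K' (MvPowerSeries.C (S.x i))) (MvPowerSeries.C (S.x j)) = 0) :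
    K = K' := by
  refine ext_degree fun d => ?_
  induction d using Nat.strong_induction_on with
  | _ d ih =>
  obtain hd | rfl | ⟨e, rfl⟩ : d < 2 ∨ d = 2 ∨ ∃ e, d = e + 3 := by
    obtain h | h | h := lt_trichotomy d 2
    · exact Or.inl h
    · exact Or.inr (Or.inl h)
    · exact Or.inr (Or.inr ⟨d - 3, by omega⟩)
  · intro α hα
    rw [hK α (by omega), hK' α (by omega)]
  · exact h2
  set D := K - K' with hD
  have hDo : ((e + 3 : ℕ) : ℕ∞) ≤ D.order := MvPowerSeries.nat_le_order fun α hα => by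
    rw [hD, map_sub, ih _ hα α rfl, sub_self]
  have hKo : ((2 : ℕ) : ℕ∞) ≤ K.order := MvPowerSeries.nat_le_order hK
  have hKo' : ((2 : ℕ) : ℕ∞) ≤ K'.order := MvPowerSeries.nat_le_order hK'
  have hsucc (f : R) (k : ℕ) : (S.poisson K)^[k + 1] (MvPowerSeries.C f) -
      (S.poisson K')^[k + 1] (MvPowerSeries.C f) =
      S.poisson D ((S.poisson K)^[k] (MvPowerSeries.C f)) +
        S.poisson K' ((S.poisson K)^[k] (MvPowerSeries.C f) -
          (S.poisson K')^[k] (MvPowerSeries.C f)) := by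
    rw [Function.iterate_succ_apply', Function.iterate_succ_apply', hD, poisson_sub_left,
      poisson_sub_right]
    ring
  have hQ (f : R) (k : ℕ) : ((1 : ℕ) : ℕ∞) ≤ ((S.poisson K)^[k + 1] (MvPowerSeries.C f)).order := by
    rw [Function.iterate_succ_apply']
    exact le_order_poisson S (p := 2) (q := 0) (by omega) hKo (by simp)
  have hadd {m : ℕ} {P Q : MvPowerSeries (κ ⊕ κ) R} (hP : (m : ℕ∞) ≤ P.order)
      (hQ : (m : ℕ∞) ≤ Q.order) : (m : ℕ∞) ≤ (P + Q).order :=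
    (le_min hP hQ).trans MvPowerSeries.min_order_le_add
  have hdiff1 (f : R) : (S.poisson K)^[1] (MvPowerSeries.C f) -
      (S.poisson K')^[1] (MvPowerSeries.C f) = S.poisson D (MvPowerSeries.C f) := by
    rw [Function.iterate_one, Function.iterate_one, hD, poisson_sub_left]
  -- Iterates beyond the first differ only from degree `e + 3` on: bracketing with an element of
  -- order at least two raises the degree. So only the linear term of the exponential contributes in
  -- degree `e + 2`.
  have hdiff (f : R) (k : ℕ) : ((e + 3 : ℕ) : ℕ∞) ≤
      ((S.poisson K)^[k + 2] (MvPowerSeries.C f) -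
        (S.poisson K')^[k + 2] (MvPowerSeries.C f)).order := by
    induction k with
    | zero =>
      rw [hsucc, hdiff1]
      exact hadd (le_order_poisson S (p := e + 3) (q := 1) (by omega) hDo (hQ f 0))
        (le_order_poisson S (p := 2) (q := e + 2) (by omega) hKo'
          (le_order_poisson S (p := e + 3) (q := 0) (by omega) hDo (by simp)))
    | succ k ih =>
      rw [hsucc]
      exact hadd (le_order_poisson S (p := e + 3) (q := 1) (by omega) hDo (hQ f (k + 1)))
        (le_order_poisson S (p := 2) (q := e + 3) (by omega) hKo' ih)
  have hexp (f : R) (α : κ ⊕ κ →₀ ℕ) (hα : α.degree = e + 2) :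
      MvPowerSeries.coeff α (S.expHam K (MvPowerSeries.C f)) -
        MvPowerSeries.coeff α (S.expHam K' (MvPowerSeries.C f)) =
      MvPowerSeries.coeff α (S.poisson D (MvPowerSeries.C f)) := by
    rw [coeff_expHam, coeff_expHam, ← Finset.sum_sub_distrib, Finset.sum_eq_single 1]
    · rw [← hdiff1]; simp
    · rintro (_ | _ | k) _ hk
      · simp
      · exact absurd rfl hk
      · rw [← smul_sub, ← map_sub, MvPowerSeries.coeff_of_lt_order, smul_zero]
        exact lt_of_lt_of_le (by exact_mod_cast (by omega : α.degree < e + 3)) (hdiff f k)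
    · intro h1
      exact absurd (Finset.mem_range.2 (by omega)) h1
  have hij (i j : κ ⊕ κ) (hij : i.isLeft = j.isLeft) (β : κ ⊕ κ →₀ ℕ) (hβ : β.degree = e + 1) :
      MvPowerSeries.coeff β (MvPowerSeries.pderiv R j (MvPowerSeries.pderiv R i D)) = 0 := by
    have e1 := congrArg (MvPowerSeries.coeff β) (h i j hij)
    have e2 := congrArg (MvPowerSeries.coeff β) (h' i j hij)
    rw [poisson_C_x, MvPowerSeries.coeff_pderiv, map_zero] at e1 e2
    rw [MvPowerSeries.coeff_pderiv, ← S.poisson_C_x, ← hexp _ _ (by simp [hβ]), sub_mul, e1, e2,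
      sub_zero]
  have hk (i j k : κ ⊕ κ) (hij' : i.isLeft = j.isLeft) (γ : κ ⊕ κ →₀ ℕ) (hγ : γ.degree = e) :
      MvPowerSeries.coeff γ (MvPowerSeries.pderiv R k
        (MvPowerSeries.pderiv R j (MvPowerSeries.pderiv R i D))) = 0 := by
    rw [MvPowerSeries.coeff_pderiv, hij i j hij' _ (by simp [hγ]), zero_mul]
  intro α hα
  rw [← sub_eq_zero, ← map_sub, ← hD, ← map_zero (MvPowerSeries.coeff α)]
  refine coeff_eq_of_pderiv (d := e + 2) (fun i => coeff_eq_of_pderiv (fun j =>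
    coeff_eq_of_pderiv fun k γ hγ => ?_)) α hα
  simp only [map_zero]
  -- Pigeonhole: three coordinates, two types. This is where degree at least three is needed; a
  -- quadratic mixed term is invisible to the equations.
  obtain h1 | h1 | h1 : i.isLeft = j.isLeft ∨ i.isLeft = k.isLeft ∨ j.isLeft = k.isLeft := by
    cases i <;> cases j <;> cases k <;> simp
  · exact hk i j k h1 γ hγ
  · rw [pderiv_comm k j]; exact hk i k j h1 γ hγ
  · rw [pderiv_comm j i, pderiv_comm k i]; exact hk j k i h1 γ hγ

end CoordSys

/-! ### Algebraic products with separation of variables -/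

/-- Bilinear operators defining an associative unital product with separation of variables, on an
algebra with distinguished holomorphic and antiholomorphic elements. -/
structure SepStar (R : Type*) [CommRing R] [Algebra ℂ R] where
  C : ℕ → R →ₗ[ℂ] R →ₗ[ℂ] R
  hol : Submonoid R
  antihol : Submonoid R
  bidiff_left : ∀ r, ∃ N, ∀ f, C r f ∈ orderLT N
  bidiff_right : ∀ r, ∃ N, ∀ f, (C r).flip f ∈ orderLT N
  C_zero : ∀ f g, C 0 f g = f * g
  C_one_left : ∀ r f, C (r + 1) 1 f = 0
  C_one_right : ∀ r f, C (r + 1) f 1 = 0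
  assoc : ∀ r f g h,
    ∑ p ∈ Finset.HasAntidiagonal.antidiagonal r, C p.1 (C p.2 f g) h =
      ∑ p ∈ Finset.HasAntidiagonal.antidiagonal r, C p.1 f (C p.2 g h)
  sep_left : ∀ r, ∀ a ∈ hol, ∀ f g, C r (a * f) g = a * C r f g
  sep_right : ∀ r, ∀ b ∈ antihol, ∀ f g, C r f (b * g) = b * C r f g

namespace SepStar

variable {R : Type*} [CommRing R] [Algebra ℂ R] (T : SepStar R)

/-- Left multiplication. -/
def L (f : R) : PowerSeries (Module.End ℂ R) := PowerSeries.mk fun r => T.C r f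

/-- Right multiplication. -/
def Rt (f : R) : PowerSeries (Module.End ℂ R) := PowerSeries.mk fun r => (T.C r).flip f

lemma coeff_L (f : R) (r : ℕ) : PowerSeries.coeff r (T.L f) = T.C r f := by simp [L]

lemma coeff_Rt (f : R) (r : ℕ) : PowerSeries.coeff r (T.Rt f) = (T.C r).flip f := by simp [Rt]

lemma C_hol_left (r : ℕ) {a : R} (ha : a ∈ T.hol) (g : R) :
    T.C r a g = if r = 0 then a * g else 0 := by
  rw [← mul_one a, T.sep_left r a ha, mul_one]
  cases r with
  | zero => simp [T.C_zero]
  | succ r => simp [T.C_one_left]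

lemma C_antihol_right (r : ℕ) {b : R} (hb : b ∈ T.antihol) (f : R) :
    T.C r f b = if r = 0 then b * f else 0 := by
  rw [← mul_one b, T.sep_right r b hb, mul_one]
  cases r with
  | zero => simp [T.C_zero]
  | succ r => simp [T.C_one_right]

lemma L_hol {a : R} (ha : a ∈ T.hol) : T.L a = PowerSeries.C (mulOp a) := by
  ext r g
  rw [coeff_L, T.C_hol_left r ha, PowerSeries.coeff_C]
  split_ifs <;> simp

lemma Rt_antihol {b : R} (hb : b ∈ T.antihol) : T.Rt b = PowerSeries.C (mulOp b) := by
  ext r g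
  rw [coeff_Rt, LinearMap.flip_apply, T.C_antihol_right r hb, PowerSeries.coeff_C]
  split_ifs <;> simp

/-- Commutation of left and right multiplications is associativity. -/
lemma L_lie_Rt (f g : R) : ⁅T.L f, T.Rt g⁆ = 0 := by
  ext r h
  rw [Ring.lie_def, map_sub, PowerSeries.coeff_mul, PowerSeries.coeff_mul, LinearMap.sub_apply,
    LinearMap.sum_apply, LinearMap.sum_apply, map_zero, LinearMap.zero_apply, sub_eq_zero]
  simp only [coeff_L, coeff_Rt, Module.End.mul_apply, LinearMap.flip_apply]
  exact (T.assoc r f h g).symm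

/-- The defining property of the formal Berezin transform. -/
structure IsBerezin (B : PowerSeries (Module.End ℂ R)) : Prop where
  mem_diffOp : ∀ r, PowerSeries.coeff r B ∈ diffOp R
  apply : ∀ r, ∀ a ∈ T.hol, ∀ b ∈ T.antihol, PowerSeries.coeff r B (a * b) = T.C r b a

variable {κ : Type*} [Fintype κ] (S : CoordSys R (κ ⊕ κ))

/-- The coordinates are holomorphic and antiholomorphic, respectively. -/
structure Adapted : Prop where
  hol : ∀ k, S.x (Sum.inl k) ∈ T.hol
  antihol : ∀ k, S.x (Sum.inr k) ∈ T.antihol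

variable {T S}

/-- Every monomial in the coordinates is a product of a holomorphic and an antiholomorphic function,
and a differential operator is determined by its values on monomials. -/
lemma Adapted.eq_zero (hS : T.Adapted S) {A : Module.End ℂ R} (hA : A ∈ diffOp R)
    (h : ∀ a ∈ T.hol, ∀ b ∈ T.antihol, A (a * b) = 0) : A = 0 := by
  obtain ⟨N, hN⟩ := hA
  refine S.eq_zero_of_monomials hN fun y hy => ?_
  have hle : Submonoid.closure (Set.range S.x) ≤ T.hol ⊔ T.antihol := by
    rw [Submonoid.closure_le]
    rintro _ ⟨k | k, rfl⟩
    · exact (le_sup_left : T.hol ≤ _) (hS.hol k)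
    · exact (le_sup_right : T.antihol ≤ _) (hS.antihol k)
  obtain ⟨a, ha, b, hb, rfl⟩ := Submonoid.mem_sup.1 (hle hy)
  exact h a ha b hb

lemma mulOp_mem_diffOp (f : R) : mulOp f ∈ diffOp R := ⟨1, mulOp_mem_orderLT f⟩

/-- On `a b'` the identity is `b ⋆ (b' ⋆ a) = (b b') ⋆ a`, which is associativity together with `b ⋆
b' = b b'`. -/
lemma Adapted.L_mul (hS : T.Adapted S) {B : PowerSeries (Module.End ℂ R)} (hB : T.IsBerezin B)
    {b : R} (hb : b ∈ T.antihol) : T.L b * B = B * PowerSeries.C (mulOp b) := by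
  ext1 r
  rw [← sub_eq_zero]
  refine hS.eq_zero ?_ fun a ha b' hb' => ?_
  · rw [PowerSeries.coeff_mul, PowerSeries.coeff_mul_C]
    refine sub_mem (sum_mem fun p _ => mul_mem ?_ (hB.mem_diffOp _))
      (mul_mem (hB.mem_diffOp _) (mulOp_mem_diffOp b))
    obtain ⟨N, hN⟩ := T.bidiff_left p.1
    rw [coeff_L]
    exact ⟨N, hN b⟩
  · rw [PowerSeries.coeff_mul, PowerSeries.coeff_mul_C, LinearMap.sub_apply, LinearMap.sum_apply]
    simp only [coeff_L, Module.End.mul_apply, LinearMap.mulLeft_apply, hB.apply _ a ha b' hb']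
    rw [← T.assoc, mul_left_comm, hB.apply _ a ha _ (mul_mem hb hb'), sub_eq_zero,
      Finset.sum_eq_single (r, 0)]
    · rw [T.C_zero]
    · rintro ⟨i, j⟩ hp hne
      have := Finset.HasAntidiagonal.mem_antidiagonal.1 hp
      have hj : j ≠ 0 := by rintro rfl; exact hne (by simpa using this)
      simp [T.C_antihol_right j hb', hj]
    · intro h0
      exact absurd (Finset.HasAntidiagonal.mem_antidiagonal.2 (add_zero r)) h0

lemma Adapted.Rt_mul (hS : T.Adapted S) {B : PowerSeries (Module.End ℂ R)} (hB : T.IsBerezin B)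
    {a : R} (ha : a ∈ T.hol) : T.Rt a * B = B * PowerSeries.C (mulOp a) := by
  ext1 r
  rw [← sub_eq_zero]
  refine hS.eq_zero ?_ fun a' ha' b hb => ?_
  · rw [PowerSeries.coeff_mul, PowerSeries.coeff_mul_C]
    refine sub_mem (sum_mem fun p _ => mul_mem ?_ (hB.mem_diffOp _))
      (mul_mem (hB.mem_diffOp _) (mulOp_mem_diffOp a))
    obtain ⟨N, hN⟩ := T.bidiff_right p.1
    rw [coeff_Rt]
    exact ⟨N, hN a⟩
  · rw [PowerSeries.coeff_mul, PowerSeries.coeff_mul_C, LinearMap.sub_apply, LinearMap.sum_apply]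
    simp only [coeff_Rt, Module.End.mul_apply, LinearMap.mulLeft_apply, LinearMap.flip_apply,
      hB.apply _ a' ha' b hb]
    rw [T.assoc, ← mul_assoc, hB.apply _ _ (mul_mem ha ha') b hb, sub_eq_zero,
      Finset.sum_eq_single (r, 0)]
    · rw [T.C_zero, mul_comm]
    · rintro ⟨i, j⟩ hp hne
      have := Finset.HasAntidiagonal.mem_antidiagonal.1 hp
      have hj : j ≠ 0 := by rintro rfl; exact hne (by simpa using this)
      simp [T.C_hol_left j ha', hj]
    · intro h0
      exact absurd (Finset.HasAntidiagonal.mem_antidiagonal.2 (add_zero r)) h0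

end SepStar

/-! ### Naturality of the exponent -/

section Naturality

variable {R : Type*} [CommRing R] [Algebra ℂ R]

/-- Isolates the only place where the next coefficient `X_{s+1}` enters. Since `X/ν` and all its
commutators lack a `ν⁰` term, terms with at least two commutators involve at `ν^s` only coefficients
up to `X_s`, already known to satisfy the order bound. -/
lemma coeff_expAd_sub_lie_mem {X : PowerSeries (Module.End ℂ R)}
    (h1 : PowerSeries.coeff 1 X = 0) {s : ℕ} (hs : 1 ≤ s)
    (hX : ∀ i ≤ s, PowerSeries.coeff i X ∈ orderLT (i + 1)) (f : R) :
    PowerSeries.coeff s (expAd (divNu X) (PowerSeries.C (mulOp f))) -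
      ⁅PowerSeries.coeff (s + 1) X, mulOp f⁆ ∈ orderLT (s + 1) := by
  set Y := divNu X with hY
  have hY0 : PowerSeries.coeff 0 Y = 0 := by rw [hY, coeff_divNu, zero_add, h1]
  have hYs (i : ℕ) (hi : i < s) : PowerSeries.coeff i Y ∈ orderLT (i + 2) := by
    rw [hY, coeff_divNu]
    exact hX (i + 1) hi
  have hstep (W : PowerSeries (Module.End ℂ R)) (hW0 : PowerSeries.coeff 0 W = 0)
      (hW : ∀ j < s, PowerSeries.coeff j W ∈ orderLT (j + 1)) (j : ℕ) (hj : j ≤ s) :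
      PowerSeries.coeff j ⁅Y, W⁆ ∈ orderLT (j + 1) := by
    rw [coeff_lie]
    refine sum_mem fun p hp => ?_
    have hp' := Finset.HasAntidiagonal.mem_antidiagonal.1 hp
    obtain h | h := Nat.eq_zero_or_pos p.1
    · rw [h, hY0, commutator_zero_left]; exact zero_mem _
    obtain h' | h' := Nat.eq_zero_or_pos p.2
    · rw [h', hW0, commutator_zero_right]; exact zero_mem _
    exact lie_mem_orderLT (by omega) (hYs p.1 (by omega)) (hW p.2 (by omega))
  have hV (k : ℕ) : PowerSeries.coeff 0 ((fun W => ⁅Y, W⁆)^[k + 1] (PowerSeries.C (mulOp f))) = 0 ∧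
      ∀ j < s, PowerSeries.coeff j ((fun W => ⁅Y, W⁆)^[k + 1] (PowerSeries.C (mulOp f))) ∈
        orderLT (j + 1) := by
    refine ⟨by rw [coeff_iterate_lie hY0, if_neg (by omega)], ?_⟩
    induction k with
    | zero =>
      intro j hj
      rw [zero_add, Function.iterate_one, coeff_lie_C]
      exact lie_mem_orderLT (by omega) (hYs j hj) (mulOp_mem_orderLT f)
    | succ k ih =>
      intro j hj
      rw [Function.iterate_succ_apply']
      exact hstep _ (by rw [coeff_iterate_lie hY0, if_neg (by omega)]) ih j hj.le
  have e1 : ⁅PowerSeries.coeff (s + 1) X, mulOp f⁆ = (((1 : ℕ).factorial : ℂ)⁻¹) •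
      PowerSeries.coeff s ((fun W => ⁅Y, W⁆)^[1] (PowerSeries.C (mulOp f))) := by
    rw [Function.iterate_one, coeff_lie_C, hY, coeff_divNu]
    simp
  rw [coeff_expAd, ← Finset.add_sum_erase _ _ (Finset.mem_range.2 (by omega : 1 < s + 1)), ← e1,
    add_sub_cancel_left]
  refine sum_mem fun k hk => Submodule.smul_mem _ _ ?_
  obtain _ | _ | k := k
  · rw [Function.iterate_zero, id_eq, PowerSeries.coeff_C, if_neg (by omega)]
    exact zero_mem _
  · simp at hk
  · rw [Function.iterate_succ_apply']
    exact hstep _ (hV k).1 (hV k).2 s le_rfl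

/-- The hypothesis bounds the order of `[[X_r, x_i], x_j]` for coordinates of the same type. Since
any triple of coordinates contains such a pair, all triple commutators are bounded, and this
suffices because `X_r` has finite order. -/
lemma CoordSys.isNatural_of_lie_expAd {κ : Type*} [Fintype κ] (S : CoordSys R (κ ⊕ κ))
    {X : PowerSeries (Module.End ℂ R)} (hd : ∀ r, PowerSeries.coeff r X ∈ diffOp R)
    (h0 : PowerSeries.coeff 0 X = 0) (h1 : PowerSeries.coeff 1 X = 0)
    (h : ∀ i j : κ ⊕ κ, i.isLeft = j.isLeft →
      ⁅expAd (divNu X) (PowerSeries.C (mulOp (S.x i))), PowerSeries.C (mulOp (S.x j))⁆ = 0) :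
    IsNatural X := by
  refine isNatural_iff.2 fun r => ?_
  induction r using Nat.strong_induction_on with
  | _ r ih =>
  obtain _ | _ | s := r
  · rw [h0]; exact zero_mem _
  · rw [h1]; exact zero_mem _
  have hij (i j : κ ⊕ κ) (hij : i.isLeft = j.isLeft) :
      ⁅⁅PowerSeries.coeff (s + 2) X, mulOp (S.x i)⁆, mulOp (S.x j)⁆ ∈ orderLT (s + 1) := by
    have e := congrArg (PowerSeries.coeff (s + 1)) (h i j hij)
    rw [coeff_lie_C, map_zero] at e
    have hm := BerezinLog.mem_orderLT_succ.1 (coeff_expAd_sub_lie_mem h1 (s := s + 1) (by omega)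
      (fun i hi => ih i (by omega)) (S.x i)) (S.x j)
    have e2 (a b c : Module.End ℂ R) : ⁅a - b, c⁆ = ⁅a, c⁆ - ⁅b, c⁆ := by
      simp only [Ring.lie_def, sub_mul, mul_sub]; abel
    rw [e2, e, zero_sub, neg_mem_iff] at hm
    exact hm
  obtain ⟨N, hN⟩ := hd (s + 2)
  have hlie {N : ℕ} {A : Module.End ℂ R} (hA : A ∈ orderLT N) (f : R) : ⁅A, mulOp f⁆ ∈ orderLT N :=
    BerezinLog.mem_orderLT_succ.1 (orderLT_mono (Nat.le_succ N) hA) f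
  refine S.mem_orderLT_succ hN fun i => S.mem_orderLT_succ (hlie hN _) fun j =>
    S.mem_orderLT_succ (hlie (hlie hN _) _) fun k => ?_
  obtain h1 | h1 | h1 : i.isLeft = j.isLeft ∨ i.isLeft = k.isLeft ∨ j.isLeft = k.isLeft := by
    cases i <;> cases j <;> cases k <;> simp
  · exact BerezinLog.mem_orderLT_succ.1 (hij i j h1) _
  · rw [lie_mulOp_comm]; exact BerezinLog.mem_orderLT_succ.1 (hij i k h1) _
  · rw [lie_mulOp_comm _ (S.x i), lie_mulOp_comm _ (S.x i)]
    exact BerezinLog.mem_orderLT_succ.1 (hij j k h1) _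

end Naturality

/-! ### Logarithm of the Berezin transform -/

namespace SepStar

variable {R : Type*} [CommRing R] [Algebra ℂ R]

/-- `X = ν² X₂ + …` is a formal differential operator and `exp (ν⁻¹ X)` is the formal Berezin
transform. -/
structure IsLog (T : SepStar R) (X : PowerSeries (Module.End ℂ R)) : Prop where
  mem_diffOp : ∀ r, PowerSeries.coeff r X ∈ diffOp R
  coeff_zero : PowerSeries.coeff 0 X = 0
  coeff_one : PowerSeries.coeff 1 X = 0
  isBerezin : T.IsBerezin (formalExp (divNu X))

variable {κ : Type*} [Fintype κ] {S : CoordSys R (κ ⊕ κ)} {T T' : SepStar R}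
  {X X' : PowerSeries (Module.End ℂ R)}

lemma IsLog.L_eq (hX : T.IsLog X) (hS : T.Adapted S) {b : R} (hb : b ∈ T.antihol) :
    T.L b = expAd (divNu X) (PowerSeries.C (mulOp b)) :=
  eq_of_mul_eq_mul_right (coeff_zero_formalExp _) <| by
    rw [hS.L_mul hX.isBerezin hb,
      expAd_mul_formalExp (by rw [coeff_divNu, zero_add, hX.coeff_one])]

lemma IsLog.Rt_eq (hX : T.IsLog X) (hS : T.Adapted S) {a : R} (ha : a ∈ T.hol) :
    T.Rt a = expAd (divNu X) (PowerSeries.C (mulOp a)) :=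
  eq_of_mul_eq_mul_right (coeff_zero_formalExp _) <| by
    rw [hS.Rt_mul hX.isBerezin ha,
      expAd_mul_formalExp (by rw [coeff_divNu, zero_add, hX.coeff_one])]

/-- The exponential is `R_a`, while multiplication by `a'` is `L_{a'}`; the two commute. -/
lemma IsLog.lie_hol (hX : T.IsLog X) (hS : T.Adapted S) {a a' : R} (ha : a ∈ T.hol)
    (ha' : a' ∈ T.hol) :
    ⁅expAd (divNu X) (PowerSeries.C (mulOp a)), PowerSeries.C (mulOp a')⁆ = 0 := by
  rw [← hX.Rt_eq hS ha, ← T.L_hol ha', Ring.lie_def, ← neg_sub, ← Ring.lie_def, T.L_lie_Rt,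
    neg_zero]

lemma IsLog.lie_antihol (hX : T.IsLog X) (hS : T.Adapted S) {b b' : R} (hb : b ∈ T.antihol)
    (hb' : b' ∈ T.antihol) :
    ⁅expAd (divNu X) (PowerSeries.C (mulOp b)), PowerSeries.C (mulOp b')⁆ = 0 := by
  rw [← hX.L_eq hS hb, ← T.Rt_antihol hb', T.L_lie_Rt]

lemma IsLog.isNatural (hX : T.IsLog X) (hS : T.Adapted S) : IsNatural X := by
  refine S.isNatural_of_lie_expAd hX.mem_diffOp hX.coeff_zero hX.coeff_one ?_
  rintro (i | i) (j | j) h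
  · exact hX.lie_hol hS (hS.hol i) (hS.hol j)
  · simp at h
  · simp at h
  · exact hX.lie_antihol hS (hS.antihol i) (hS.antihol j)

lemma IsLog.poisson_expHam_hol (hX : T.IsLog X) (hS : T.Adapted S) {a a' : R} (ha : a ∈ T.hol)
    (ha' : a' ∈ T.hol) :
    S.poisson (S.expHam (S.sigma X) (MvPowerSeries.C a)) (MvPowerSeries.C a') = 0 := by
  have hn := hX.isNatural hS
  rw [← S.sigma_expAd hn hX.coeff_zero, ← S.sigma_C,
    ← S.sigma_divNu_lie (hn.expAd hX.coeff_zero a) (isNatural_C a'), hX.lie_hol hS ha ha',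
    divNu_zero,
    S.sigma_zero]

lemma IsLog.poisson_expHam_antihol (hX : T.IsLog X) (hS : T.Adapted S) {b b' : R}
    (hb : b ∈ T.antihol) (hb' : b' ∈ T.antihol) :
    S.poisson (S.expHam (S.sigma X) (MvPowerSeries.C b)) (MvPowerSeries.C b') = 0 := by
  have hn := hX.isNatural hS
  rw [← S.sigma_expAd hn hX.coeff_zero, ← S.sigma_C,
    ← S.sigma_divNu_lie (hn.expAd hX.coeff_zero b) (isNatural_C b'), hX.lie_antihol hS hb hb',
    divNu_zero, S.sigma_zero]

lemma IsLog.coeff_sigma_eq_zero (hX : T.IsLog X) (α : κ ⊕ κ →₀ ℕ) (hα : α.degree < 2) :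
    MvPowerSeries.coeff α (S.sigma X) = 0 := by
  rw [S.coeff_sigma, ← iterCommHom_apply]
  obtain h | h : α.degree = 0 ∨ α.degree = 1 := by omega
  · rw [h, hX.coeff_zero]; simp
  · rw [h, hX.coeff_one]; simp

/-- The term `C₁(a, b)` is zero by separation of variables; it is included so that the right-hand
side is the antisymmetric part of `C₁`, i.e. the Poisson bracket. -/
lemma IsLog.coeff_two_apply (hX : T.IsLog X) {a b : R} (ha : a ∈ T.hol) (hb : b ∈ T.antihol) :
    PowerSeries.coeff 2 X (a * b) = T.C 1 b a - T.C 1 a b := by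
  have := hX.isBerezin.apply 1 a ha b hb
  rw [coeff_one_formalExp, coeff_divNu] at this
  rw [this, T.C_hol_left 1 ha, if_neg one_ne_zero, sub_zero]

lemma IsLog.coeff_sigma_two (hX : T.IsLog X) (hS : T.Adapted S) (α : κ ⊕ κ →₀ ℕ)
    (hα : α.degree = 2) : MvPowerSeries.coeff α (S.sigma X) =
      MvPowerSeries.coeff α (∑ k : κ, ∑ l : κ,
        MvPowerSeries.C (T.C 1 (S.x (Sum.inr l)) (S.x (Sum.inl k)) -
            T.C 1 (S.x (Sum.inl k)) (S.x (Sum.inr l))) *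
          MvPowerSeries.X (Sum.inl k) * MvPowerSeries.X (Sum.inr l)) := by
  classical
  have hh {a : R} (ha : a ∈ T.hol) : PowerSeries.coeff 2 X a = 0 := by
    have := hX.coeff_two_apply ha (one_mem T.antihol)
    rwa [mul_one, T.C_one_left, T.C_one_right, sub_zero] at this
  have hb {b : R} (hb : b ∈ T.antihol) : PowerSeries.coeff 2 X b = 0 := by
    have := hX.coeff_two_apply (one_mem T.hol) hb
    rwa [one_mul, T.C_one_left, T.C_one_right, sub_zero] at this
  have hx (i : κ ⊕ κ) : PowerSeries.coeff 2 X (S.x i) = 0 := by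
    obtain i | i := i
    · exact hh (hS.hol i)
    · exact hb (hS.antihol i)
  refine coeff_eq_of_pderiv (d := 1) (fun i => coeff_eq_of_pderiv (d := 0) fun j γ hγ => ?_) α hα
  obtain rfl := (Finsupp.degree_eq_zero_iff γ).1 hγ
  -- The second fibre derivatives at the zero section are double commutators of `X₂` applied to `1`.
  -- They reduce to `X₂ (x_i x_j)` because `X₂` kills `1` and the coordinates.
  have e : MvPowerSeries.coeff 0 (MvPowerSeries.pderiv R j (MvPowerSeries.pderiv R i (S.sigma X))) =
      PowerSeries.coeff 2 X (S.x i * S.x j) := by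
    rw [S.pderiv_sigma, S.pderiv_sigma, S.constantCoeff_sigma, coeff_divNu, coeff_lie_C,
      coeff_divNu,
      coeff_lie_C]
    simp [Ring.lie_def, hx, hh (one_mem _)]
  rw [e]
  have hX' (i j : κ ⊕ κ) : MvPowerSeries.pderiv R i (MvPowerSeries.X j) =
      MvPowerSeries.C (if i = j then 1 else 0) := by
    split_ifs with h
    · rw [h, MvPowerSeries.pderiv_X_self, map_one]
    · rw [MvPowerSeries.pderiv_X_of_ne (Ne.symm h), map_zero]
  simp only [map_sum, Derivation.leibniz, hX', MvPowerSeries.pderiv_C, add_zero, map_add,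
    map_mul, smul_eq_mul, MvPowerSeries.coeff_zero_eq_constantCoeff_apply,
    MvPowerSeries.constantCoeff_C, mul_zero, zero_add]
  obtain i | i := i <;> obtain j | j := j
  · rw [hh (mul_mem (hS.hol i) (hS.hol j))]
    simp
  · rw [hX.coeff_two_apply (hS.hol i) (hS.antihol j)]
    simp
  · rw [mul_comm, hX.coeff_two_apply (hS.hol j) (hS.antihol i)]
    simp
  · rw [hb (mul_mem (hS.antihol i) (hS.antihol j))]
    simp

end SepStar

/-! ### Comparison of two products -/

namespace SepStar

variable {R : Type*} [CommRing R] [Algebra ℂ R]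

/-- Two products with the same (anti)holomorphic functions and the same semiclassical limit. -/
structure IsPair (T T' : SepStar R) : Prop where
  hol_eq : T'.hol = T.hol
  antihol_eq : T'.antihol = T.antihol
  commutator_eq : ∀ f g, T.C 1 f g - T.C 1 g f = T'.C 1 f g - T'.C 1 g f

variable {κ : Type*} [Fintype κ] {S : CoordSys R (κ ⊕ κ)} {T T' : SepStar R}
  {X X' : PowerSeries (Module.End ℂ R)}

/-- Commutators of `Φ f` with functions still depend on `f` through differential operators.
Induction on `s` therefore reduces the order bound to the vanishing of such an operator, which may
be checked on products `a b`. -/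
lemma Adapted.mem_orderLT (hS : T.Adapted S) {s : ℕ} (Φ : R →ₗ[ℂ] Module.End ℂ R)
    (hΦ : ∀ g, Φ.flip g ∈ diffOp R)
    (h : ∀ a ∈ T.hol, ∀ b ∈ T.antihol, Φ (a * b) ∈ orderLT s) (f : R) : Φ f ∈ orderLT s := by
  induction s generalizing Φ with
  | zero =>
    ext g
    have : Φ.flip g = 0 := hS.eq_zero (hΦ g) fun a ha b hb => by
      rw [LinearMap.flip_apply, mem_orderLT_zero.1 (h a ha b hb), LinearMap.zero_apply]
    simpa using LinearMap.congr_fun this f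
  | succ s ih =>
    refine BerezinLog.mem_orderLT_succ.2 fun u => ?_
    have := ih ((LinearMap.mulRight ℂ (mulOp u) - LinearMap.mulLeft ℂ (mulOp u)) ∘ₗ Φ)
      (fun g => by
        have : ((LinearMap.mulRight ℂ (mulOp u) - LinearMap.mulLeft ℂ (mulOp u)) ∘ₗ Φ).flip g =
            Φ.flip (u * g) - mulOp u * Φ.flip g := by
          ext; simp
        rw [this]
        exact sub_mem (hΦ _) (mul_mem (mulOp_mem_diffOp u) (hΦ g)))
      (fun a ha b hb => BerezinLog.mem_orderLT_succ.1 (h a ha b hb) u)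
    exact this

lemma C_flip_mem_diffOp (T : SepStar R) (r : ℕ) (f : R) : (T.C r).flip f ∈ diffOp R :=
  (T.bidiff_right r).imp fun _ h => h f

lemma C_mem_diffOp (T : SepStar R) (r : ℕ) (f : R) : T.C r f ∈ diffOp R :=
  (T.bidiff_left r).imp fun _ h => h f

lemma C_mul (T : SepStar R) (r : ℕ) {a : R} (ha : a ∈ T.hol) (f : R) :
    T.C r (a * f) = mulOp a * T.C r f := by
  ext g; simp [T.sep_left r a ha]

lemma C_flip_mul (T : SepStar R) (r : ℕ) {b : R} (hb : b ∈ T.antihol) (f : R) :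
    (T.C r).flip (f * b) = mulOp b * (T.C r).flip f := by
  ext g; simp [mul_comm f, T.sep_right r b hb]

lemma IsLog.isNatural_L (hX : T.IsLog X) (hS : T.Adapted S) (f : R) : IsNatural (T.L f) :=
  isNatural_iff.2 fun r => by
    rw [coeff_L]
    refine hS.mem_orderLT (T.C r) (T.C_flip_mem_diffOp r) (fun a ha b hb => ?_) f
    rw [T.C_mul r ha, ← T.coeff_L, hX.L_eq hS hb]
    exact mul_mem_orderLT (by omega) (mulOp_mem_orderLT a)
      (isNatural_iff.1 ((hX.isNatural hS).expAd hX.coeff_zero b) r)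

lemma IsLog.isNatural_Rt (hX : T.IsLog X) (hS : T.Adapted S) (f : R) : IsNatural (T.Rt f) :=
  isNatural_iff.2 fun r => by
    rw [coeff_Rt]
    refine hS.mem_orderLT (T.C r).flip (T.C_mem_diffOp r) (fun a ha b hb => ?_) f
    rw [T.C_flip_mul r hb, ← T.coeff_Rt, hX.Rt_eq hS ha]
    exact mul_mem_orderLT (by omega) (mulOp_mem_orderLT b)
      (isNatural_iff.1 ((hX.isNatural hS).expAd hX.coeff_zero a) r)

lemma IsPair.coeff_two_eq (hT : T.IsPair T') (hS : T.Adapted S) (hX : T.IsLog X)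
    (hX' : T'.IsLog X') : PowerSeries.coeff 2 X = PowerSeries.coeff 2 X' := by
  rw [← sub_eq_zero]
  refine hS.eq_zero (sub_mem (hX.mem_diffOp 2) (hX'.mem_diffOp 2)) fun a ha b hb => ?_
  rw [LinearMap.sub_apply, hX.coeff_two_apply ha hb,
    hX'.coeff_two_apply (hT.hol_eq ▸ ha) (hT.antihol_eq ▸ hb), hT.commutator_eq, sub_self]

lemma IsPair.sigma_eq (hT : T.IsPair T') (hS : T.Adapted S) (hS' : T'.Adapted S) (hX : T.IsLog X)
    (hX' : T'.IsLog X') : S.sigma X = S.sigma X' := by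
  refine S.eq_of_poisson_expHam_eq_zero hX.coeff_sigma_eq_zero hX'.coeff_sigma_eq_zero
    (fun α hα => ?_) ?_ ?_
  · rw [S.coeff_sigma, S.coeff_sigma, hα, hT.coeff_two_eq hS hX hX']
  · rintro (i | i) (j | j) h
    · exact hX.poisson_expHam_hol hS (hS.hol i) (hS.hol j)
    · simp at h
    · simp at h
    · exact hX.poisson_expHam_antihol hS (hS.antihol i) (hS.antihol j)
  · rintro (i | i) (j | j) h
    · exact hX'.poisson_expHam_hol hS' (hS'.hol i) (hS'.hol j)
    · simp at h
    · simp at h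
    · exact hX'.poisson_expHam_antihol hS' (hS'.antihol i) (hS'.antihol j)

/-- Equal symbols mean that the coefficient of the difference at `ν^(r+1)` has order at most `r`,
exactly what division by `ν` requires. -/
lemma isNatural_divNu_sub {A A' : PowerSeries (Module.End ℂ R)} (hA : IsNatural A)
    (hA' : IsNatural A') (h : S.sigma A = S.sigma A') : IsNatural (divNu (A - A')) :=
  isNatural_iff.2 fun r => by
    rw [coeff_divNu]
    exact S.coeff_mem_orderLT_of_sigma_eq_zero
      (hA.sub hA') (by rw [S.sigma_sub, h, sub_self]) (r + 1)

lemma IsPair.isNatural_divNu (hT : T.IsPair T') (hS : T.Adapted S) (hS' : T'.Adapted S)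
    (hX : T.IsLog X) (hX' : T'.IsLog X') : IsNatural (divNu (X - X')) :=
  isNatural_divNu_sub (hX.isNatural hS) (hX'.isNatural hS') (hT.sigma_eq hS hS' hX hX')

lemma IsPair.coeff_sub_mem (hT : T.IsPair T') (hS : T.Adapted S) (hS' : T'.Adapted S)
    (hX : T.IsLog X) (hX' : T'.IsLog X') (f : R) (r : ℕ) :
    PowerSeries.coeff r (expAd (divNu X) (PowerSeries.C (mulOp f)) -
      expAd (divNu X') (PowerSeries.C (mulOp f))) ∈ orderLT r := by
  refine S.coeff_mem_orderLT_of_sigma_eq_zero (((hX.isNatural hS).expAd hX.coeff_zero f).sub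
    ((hX'.isNatural hS').expAd hX'.coeff_zero f)) ?_ r
  rw [S.sigma_sub, S.sigma_expAd (hX.isNatural hS) hX.coeff_zero,
    S.sigma_expAd (hX'.isNatural hS') hX'.coeff_zero, hT.sigma_eq hS hS' hX hX', sub_self]

lemma IsPair.coeff_L_sub_mem (hT : T.IsPair T') (hS : T.Adapted S) (hS' : T'.Adapted S)
    (hX : T.IsLog X) (hX' : T'.IsLog X') (f : R) (r : ℕ) :
    PowerSeries.coeff r (T.L f - T'.L f) ∈ orderLT r := by
  rw [map_sub, coeff_L, coeff_L, ← LinearMap.sub_apply]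
  refine hS.mem_orderLT _ (fun g => ?_) (fun a ha b hb => ?_) f
  · exact sub_mem (T.C_flip_mem_diffOp r g) (T'.C_flip_mem_diffOp r g)
  · have ha' : a ∈ T'.hol := hT.hol_eq ▸ ha
    have hb' : b ∈ T'.antihol := hT.antihol_eq ▸ hb
    rw [LinearMap.sub_apply, T.C_mul r ha, T'.C_mul r ha', ← mul_sub, ← T.coeff_L, ← T'.coeff_L,
      ← map_sub, hX.L_eq hS hb, hX'.L_eq hS' hb']
    exact mul_mem_orderLT (by omega) (mulOp_mem_orderLT a) (hT.coeff_sub_mem hS hS' hX hX' b r)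

lemma IsPair.coeff_Rt_sub_mem (hT : T.IsPair T') (hS : T.Adapted S) (hS' : T'.Adapted S)
    (hX : T.IsLog X) (hX' : T'.IsLog X') (f : R) (r : ℕ) :
    PowerSeries.coeff r (T.Rt f - T'.Rt f) ∈ orderLT r := by
  rw [map_sub, coeff_Rt, coeff_Rt, ← LinearMap.sub_apply]
  refine hS.mem_orderLT _ (fun g => ?_) (fun a ha b hb => ?_) f
  · exact sub_mem (T.C_mem_diffOp r g) (T'.C_mem_diffOp r g)
  · have ha' : a ∈ T'.hol := hT.hol_eq ▸ ha
    have hb' : b ∈ T'.antihol := hT.antihol_eq ▸ hb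
    rw [LinearMap.sub_apply, T.C_flip_mul r hb, T'.C_flip_mul r hb', ← mul_sub, ← T.coeff_Rt,
      ← T'.coeff_Rt, ← map_sub, hX.Rt_eq hS ha, hX'.Rt_eq hS' ha']
    exact mul_mem_orderLT (by omega) (mulOp_mem_orderLT b) (hT.coeff_sub_mem hS hS' hX hX' a r)

variable (S) in
lemma sigma_eq_of_coeff_sub_mem {A A' : PowerSeries (Module.End ℂ R)}
    (h : ∀ r, PowerSeries.coeff r (A - A') ∈ orderLT r) :
    S.sigma A = S.sigma A' ∧ PowerSeries.coeff 0 (A - A') = 0 ∧ IsNatural (divNu (A - A')) := by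
  refine ⟨?_, h 0, isNatural_iff.2 fun r => ?_⟩
  · rw [← sub_eq_zero, ← S.sigma_sub, S.sigma_eq_zero h]
  · rw [coeff_divNu]
    exact h (r + 1)

/-- If two operators commute with `f`, so does their difference. Taking symbols before and after
division by `ν` gives the two components. -/
lemma poissonEps_eq_zero {V V' : PowerSeries (Module.End ℂ R)} (hV : IsNatural V)
    (h : ∀ r, PowerSeries.coeff r (V - V') ∈ orderLT r) (f : R)
    (hf : ⁅V, PowerSeries.C (mulOp f)⁆ = 0) (hf' : ⁅V', PowerSeries.C (mulOp f)⁆ = 0)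
    {P Q : DualNumber (MvPowerSeries (κ ⊕ κ) R)} (hP : P.fst = S.sigma V)
    (hP' : P.snd = S.sigma (divNu (V - V'))) (hQ : Q.fst = MvPowerSeries.C f) (hQ' : Q.snd = 0) :
    S.poissonEps P Q = 0 := by
  obtain ⟨-, h0, hn⟩ := sigma_eq_of_coeff_sub_mem S h
  have h1 : (S.poissonEps P Q).fst = 0 := by
    change S.poisson P.fst Q.fst = 0
    rw [hP, hQ, ← S.sigma_C, ← S.sigma_divNu_lie hV (isNatural_C f), hf, divNu_zero, S.sigma_zero]
  have h2 : (S.poissonEps P Q).snd = 0 := by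
    change S.poisson P.fst Q.snd + S.poisson P.snd Q.fst = 0
    have hz : S.poisson P.fst 0 = 0 := by simpa using S.poisson_sub_right P.fst 0 0
    have e : ⁅V - V', PowerSeries.C (mulOp f)⁆ = 0 := by
      rw [Ring.lie_def] at hf hf' ⊢
      rw [sub_mul, mul_sub, sub_sub_sub_comm, hf, hf', sub_zero]
    rw [hQ', hz, zero_add, hP', hQ, ← S.sigma_C, ← S.sigma_divNu_lie hn (isNatural_C f),
      ← divNu_lie_left h0, e, divNu_zero, divNu_zero, S.sigma_zero]
  exact TrivSqZeroExt.ext h1 h2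

end SepStar

/-! ### Hadamard's lemma -/

section Hadamard

/-- Differentiation under the integral sign, iterated. The target space is generalized in the
induction because the derivative takes values in linear maps. -/
lemma contDiff_parametric_integral {E : Type} [NormedAddCommGroup E] [NormedSpace ℝ E]
    [FiniteDimensional ℝ E] (m : ℕ) {F : Type} [NormedAddCommGroup F] [NormedSpace ℝ F]
    [CompleteSpace F] {H : E × ℝ → F} (hH : ContDiff ℝ ∞ H) :
    ContDiff ℝ m fun x => ∫ t in (0 : ℝ)..1, H (x, t) := by
  induction m generalizing F with
  | zero =>
    exact contDiff_zero.2 (intervalIntegral.continuous_parametric_intervalIntegral_of_continuous'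
      (f := fun x t => H (x, t)) hH.continuous 0 1)
  | succ m ih =>
    set H' : E × ℝ → (E →L[ℝ] F) := fun p => (fderiv ℝ H p).comp (ContinuousLinearMap.inl ℝ E ℝ)
      with hH'
    have hc : ContDiff ℝ ∞ H' := (hH.fderiv_right (by simp)).clm_comp contDiff_const
    have hd (x : E) (t : ℝ) : HasFDerivAt (fun y => H (y, t)) (H' (x, t)) x := by
      have h1 : HasFDerivAt H (fderiv ℝ H (x, t)) (x, t) :=
        (hH.differentiable (by simp) (x, t)).hasFDerivAt
      exact h1.comp x (hasFDerivAt_prodMk_left x t)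
    have hI (x : E) : HasFDerivAt (fun y => ∫ t in (0 : ℝ)..1, H (y, t))
        (∫ t in (0 : ℝ)..1, H' (x, t)) x := by
      have hK : IsCompact (Metric.closedBall x 1 ×ˢ Set.Icc (0 : ℝ) 1) :=
        (isCompact_closedBall x 1).prod isCompact_Icc
      obtain ⟨b, hb⟩ := hK.exists_bound_of_continuousOn hc.continuous.continuousOn
      refine intervalIntegral.hasFDerivAt_integral_of_dominated_of_fderiv_le
        (F := fun y t => H (y, t)) (F' := fun y t => H' (y, t)) (bound := fun _ => b)
        (Metric.ball_mem_nhds x one_pos) ?_ ?_ ?_ ?_ ?_ ?_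
      · exact Filter.Eventually.of_forall fun y =>
          (hH.continuous.comp (by fun_prop : Continuous fun t : ℝ => (y, t))).aestronglyMeasurable
      · exact (hH.continuous.comp
          (by fun_prop : Continuous fun t : ℝ => (x, t))).intervalIntegrable 0 1
      · exact (hc.continuous.comp
          (by fun_prop : Continuous fun t : ℝ => (x, t))).aestronglyMeasurable
      · refine Filter.Eventually.of_forall fun t ht y hy => hb (y, t) ⟨?_, ?_⟩
        · exact Metric.ball_subset_closedBall hy
        · rw [Set.uIoc_of_le zero_le_one] at ht
          exact ⟨ht.1.le, ht.2⟩
      · exact intervalIntegrable_const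
      · exact Filter.Eventually.of_forall fun t _ y _ => hd y t
    rw [Nat.cast_succ]
    exact contDiff_succ_iff_hasFDerivAt.2 ⟨_, ih hc, hI⟩

lemma exists_hadamard {E : Type} [NormedAddCommGroup E] [NormedSpace ℝ E] [FiniteDimensional ℝ E]
    {G : E → ℂ} (hG : ContDiff ℝ ∞ G) (p : E) :
    ∃ Φ : E → (E →L[ℝ] ℂ), ContDiff ℝ ∞ Φ ∧ ∀ y, G y - G p = Φ y (y - p) := by
  have hH : ContDiff ℝ ∞ fun q : E × ℝ => fderiv ℝ G (p + q.2 • (q.1 - p)) :=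
    (hG.fderiv_right (by simp)).comp (by fun_prop)
  refine ⟨fun y => ∫ t in (0 : ℝ)..1, fderiv ℝ G (p + t • (y - p)),
    contDiff_infty.2 fun m => contDiff_parametric_integral m hH, fun y => ?_⟩
  have hc : Continuous fun t : ℝ => fderiv ℝ G (p + t • (y - p)) :=
    hH.continuous.comp (by fun_prop : Continuous fun t : ℝ => (y, t))
  have hd (t : ℝ) : HasDerivAt (fun t : ℝ => G (p + t • (y - p)))
      (fderiv ℝ G (p + t • (y - p)) (y - p)) t := by
    have h1 : HasDerivAt (fun t : ℝ => p + t • (y - p)) (y - p) t := by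
      simpa using ((hasDerivAt_id t).smul_const (y - p)).const_add p
    exact ((hG.differentiable (by simp) _).hasFDerivAt).comp_hasDerivAt t h1
  have hf := intervalIntegral.integral_eq_sub_of_hasDerivAt (fun t _ => hd t)
    ((hc.clm_apply continuous_const).intervalIntegrable 0 1)
  rw [ContinuousLinearMap.intervalIntegral_apply (hc.intervalIntegrable 0 1), hf]
  simp

end Hadamard

/-! ### Holomorphic charts as coordinate systems -/

section Charts

variable {n : ℕ} {M : Type*} [TopologicalSpace M] [ChartedSpace (Fin n → ℂ) M]

/-- Evaluation at a point. -/
def evalAt {U : Opens M} (x : U) : Sm n U →ₐ[ℂ] ℂ := (Pi.evalAlgHom ℂ _ x).comp (Sm n U).val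

lemma evalAt_apply {U : Opens M} (x : U) (f : Sm n U) : evalAt x f = f.1 x := rfl

lemma HolChart.read_apply (c : HolChart n M) (f : Sm n c.dom) {y : Fin n → ℂ} (hy : y ∈ c.image) :
    c.read f y = f.1 ⟨c.chart.symm y, hy.2⟩ :=
  Subtype.val_injective.extend_apply f.1 0 ⟨c.chart.symm y, hy.2⟩

lemma HolChart.read_eventuallyEq (c : HolChart n M) (f : Sm n c.dom) {g : (Fin n → ℂ) → ℂ}
    (h : ∀ (y : Fin n → ℂ) (hy : y ∈ c.image), f.1 ⟨c.chart.symm y, hy.2⟩ = g y) (x : c.dom) :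
    c.read f =ᶠ[nhds (c.chart x)] g := by
  filter_upwards [c.isOpen_image.mem_nhds (c.map_mem_image x)] with y hy
  rw [c.read_apply f hy, h y hy]

lemma HolChart.read_chart (c : HolChart n M) (f : Sm n c.dom) (x : c.dom) :
    c.read f (c.chart x) = f.1 x := by
  rw [c.read_apply f (c.map_mem_image x)]
  exact congrArg f.1 (Subtype.ext (c.chart.left_inv (c.dom_le x.2)))

variable [IsManifold 𝓘(ℂ, Fin n → ℂ) ω M]

lemma HolChart.dirDeriv_apply (c : HolChart n M) (v : Fin n → ℂ) (f : Sm n c.dom) (x : c.dom) :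
    (c.dirDeriv v f).1 x = fderiv ℝ (c.read f) (c.chart x) v := rfl

lemma HolChart.differentiableAt_read (c : HolChart n M) (f : Sm n c.dom) (x : c.dom) :
    DifferentiableAt ℝ (c.read f) (c.chart x) :=
  ((c.contDiffOn_read f).differentiableOn (by simp)).differentiableAt
    (c.isOpen_image.mem_nhds (c.map_mem_image x))

/-- The directional derivative as a derivation. -/
def HolChart.dirDerivation (c : HolChart n M) (v : Fin n → ℂ) :
    Derivation ℂ (Sm n c.dom) (Sm n c.dom) :=
  Derivation.mk'
    { toFun := c.dirDeriv v
      map_add' := fun f g => by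
        ext x
        have h : c.read (f + g) =ᶠ[nhds (c.chart x)] c.read f + c.read g :=
          c.read_eventuallyEq _ (fun y hy => by
            rw [Pi.add_apply, c.read_apply f hy, c.read_apply g hy]; rfl) x
        change (c.dirDeriv v (f + g)).1 x = (c.dirDeriv v f).1 x + (c.dirDeriv v g).1 x
        simp only [c.dirDeriv_apply]
        rw [h.fderiv_eq, fderiv_add (c.differentiableAt_read f x) (c.differentiableAt_read g x)]
        rfl
      map_smul' := fun a f => by
        ext x
        have h : c.read (a • f) =ᶠ[nhds (c.chart x)] a • c.read f :=
          c.read_eventuallyEq _ (fun y hy => by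
            rw [Pi.smul_apply, c.read_apply f hy]; rfl) x
        change (c.dirDeriv v (a • f)).1 x = a * (c.dirDeriv v f).1 x
        simp only [c.dirDeriv_apply]
        rw [h.fderiv_eq, fderiv_const_smul (c.differentiableAt_read f x)]
        rfl } fun f g => by
    ext x
    have h : c.read (f * g) =ᶠ[nhds (c.chart x)] c.read f * c.read g :=
      c.read_eventuallyEq _ (fun y hy => by
        rw [Pi.mul_apply, c.read_apply f hy, c.read_apply g hy]; rfl) x
    change (c.dirDeriv v (f * g)).1 x = f.1 x * (c.dirDeriv v g).1 x + g.1 x * (c.dirDeriv v f).1 x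
    simp only [c.dirDeriv_apply]
    rw [h.fderiv_eq, fderiv_mul (c.differentiableAt_read f x) (c.differentiableAt_read g x)]
    simp [c.read_chart]

/-- The coordinate derivatives as derivations. -/
def HolChart.partialDerivation (c : HolChart n M) : Idx n → Derivation ℂ (Sm n c.dom) (Sm n c.dom)
  | Sum.inl k => (1 / 2 : ℂ) • (c.dirDerivation (Pi.single k 1) -
      Complex.I • c.dirDerivation (Pi.single k Complex.I))
  | Sum.inr k => (1 / 2 : ℂ) • (c.dirDerivation (Pi.single k 1) +
      Complex.I • c.dirDerivation (Pi.single k Complex.I))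

lemma HolChart.partialDerivation_apply (c : HolChart n M) (i : Idx n) (f : Sm n c.dom) :
    c.partialDerivation i f = c.partial i f := by
  cases i <;> rfl

lemma HolChart.dirDeriv_coord_inl (c : HolChart n M) (v : Fin n → ℂ) (k : Fin n) (x : c.dom) :
    (c.dirDeriv v (c.coord (Sum.inl k))).1 x = v k := by
  have h : c.read (c.coord (Sum.inl k)) =ᶠ[nhds (c.chart x)]
      (ContinuousLinearMap.proj k : (Fin n → ℂ) →L[ℝ] ℂ) :=
    c.read_eventuallyEq _ (fun y hy => congrFun (c.chart.right_inv hy.1) k) x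
  rw [c.dirDeriv_apply, h.fderiv_eq, ContinuousLinearMap.fderiv]
  rfl

lemma HolChart.dirDeriv_coord_inr (c : HolChart n M) (v : Fin n → ℂ) (k : Fin n) (x : c.dom) :
    (c.dirDeriv v (c.coord (Sum.inr k))).1 x = (starRingEnd ℂ) (v k) := by
  have h : c.read (c.coord (Sum.inr k)) =ᶠ[nhds (c.chart x)]
      ((Complex.conjCLE : ℂ →L[ℝ] ℂ).comp (ContinuousLinearMap.proj k) : (Fin n → ℂ) →L[ℝ] ℂ) :=
    c.read_eventuallyEq _ (fun y hy =>
      congrArg (starRingEnd ℂ) (congrFun (c.chart.right_inv hy.1) k)) x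
  rw [c.dirDeriv_apply, h.fderiv_eq, ContinuousLinearMap.fderiv]
  rfl

lemma HolChart.partial_coord (c : HolChart n M) (i j : Idx n) :
    c.partial i (c.coord j) = if i = j then 1 else 0 := by
  ext x
  have e1 (u v : Sm n c.dom) :
      ((1 / 2 : ℂ) • (u - Complex.I • v)).1 x = (1 / 2) * (u.1 x - Complex.I * v.1 x) := rfl
  have e2 (u v : Sm n c.dom) :
      ((1 / 2 : ℂ) • (u + Complex.I • v)).1 x = (1 / 2) * (u.1 x + Complex.I * v.1 x) := rfl
  have h1 : ((if i = j then 1 else 0 : Sm n c.dom)).1 x = if i = j then 1 else 0 := by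
    split_ifs <;> rfl
  rw [show ((if i = j then 1 else 0 : Sm n c.dom) : c.dom → ℂ) x = _ from h1]
  obtain i | i := i <;> obtain j | j := j
  · refine (e1 _ _).trans ?_
    rw [c.dirDeriv_coord_inl, c.dirDeriv_coord_inl]
    by_cases h : i = j
    · subst h; simp; norm_num
    · simp [h, Ne.symm h]
  · refine (e1 _ _).trans ?_
    rw [c.dirDeriv_coord_inr, c.dirDeriv_coord_inr]
    by_cases h : i = j
    · subst h; simp
    · simp [Ne.symm h]
  · refine (e2 _ _).trans ?_
    rw [c.dirDeriv_coord_inl, c.dirDeriv_coord_inl]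
    by_cases h : i = j
    · subst h; simp
    · simp [Ne.symm h]
  · refine (e2 _ _).trans ?_
    rw [c.dirDeriv_coord_inr, c.dirDeriv_coord_inr]
    by_cases h : i = j
    · subst h; simp; norm_num
    · simp [h, Ne.symm h]

/-- A smooth function on `ℂⁿ` as a function of the coordinates. -/
def HolChart.lift (c : HolChart n M) (h : (Fin n → ℂ) → ℂ) (hh : ContDiff ℝ ∞ h) : Sm n c.dom :=
  ⟨fun x => h (c.chart x), by
    have := isManifold_real n M
    intro x
    have h2 := contMDiffOn_of_mem_maximalAtlas (mem_maximalAtlas_real c.mem_atlas)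
    refine (contMDiffAt_subtype_iff (I := 𝓘(ℝ, Fin n → ℂ)) (I' := 𝓘(ℝ, ℂ)) (n := ∞)
      (f := fun x : M => h (c.chart x)) (x := x)).2 ?_
    exact ContMDiffAt.comp (x : M) hh.contMDiff.contMDiffAt
      (h2.contMDiffAt (c.chart.open_source.mem_nhds (c.dom_le x.2)))⟩

/-- Splits a real-linear functional into its complex-linear and antilinear parts, which turns
Hadamard's formula into one in `z^k` and `z̄^k`. -/
lemma realLinear_eq_sum (φ : (Fin n → ℂ) →L[ℝ] ℂ) (w : Fin n → ℂ) :
    φ w = ∑ k, (w k * ((1 / 2 : ℂ) * (φ (Pi.single k 1) - Complex.I * φ (Pi.single k Complex.I))) +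
      (starRingEnd ℂ) (w k) *
        ((1 / 2 : ℂ) * (φ (Pi.single k 1) + Complex.I * φ (Pi.single k Complex.I)))) := by
  have hw : w = ∑ k, ((w k).re • (Pi.single k 1 : Fin n → ℂ) +
      (w k).im • (Pi.single k Complex.I : Fin n → ℂ)) := by
    conv_lhs => rw [← Finset.univ_sum_single w]
    refine Finset.sum_congr rfl fun k _ => ?_
    rw [← Pi.single_smul, ← Pi.single_smul, ← Pi.single_add]
    congr 1
    simp [Complex.re_add_im]
  conv_lhs => rw [hw, map_sum]
  refine Finset.sum_congr rfl fun k _ => ?_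
  rw [map_add, map_smul, map_smul]
  have hc : (starRingEnd ℂ) (w k) = (w k).re - (w k).im * Complex.I := by
    apply Complex.ext <;> simp
  rw [hc]
  conv_rhs => rw [← Complex.re_add_im (w k)]
  simp only [Complex.real_smul, Complex.add_re, Complex.add_im, Complex.ofReal_re, Complex.mul_re,
    Complex.mul_im, Complex.ofReal_im, Complex.I_re, Complex.I_im]
  simp only [mul_zero, mul_one, sub_zero, add_zero, zero_add]
  linear_combination ((w k).im * φ (Pi.single k Complex.I)) * Complex.I_sq

/-- By Hadamard's lemma `G` is a constant plus a sum of products `(x_i - x_i(p)) g_i`. A derivation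
killing the coordinates leaves only terms that vanish at the base point. -/
lemma HolChart.derivation_lift_eq_zero (c : HolChart n M)
    (E : Derivation ℂ (Sm n c.dom) (Sm n c.dom)) (hE : ∀ i, E (c.coord i) = 0)
    {G : (Fin n → ℂ) → ℂ} (hG : ContDiff ℝ ∞ G) (x : c.dom) : evalAt x (E (c.lift G hG)) = 0 := by
  obtain ⟨Φ, hΦ, h⟩ := exists_hadamard hG (c.chart x)
  have h1 (v : Fin n → ℂ) : ContDiff ℝ ∞ fun y => Φ y v := hΦ.clm_apply contDiff_const
  set g : Fin n → Sm n c.dom := fun k => c.lift (fun y => (1 / 2 : ℂ) * (Φ y (Pi.single k 1) -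
    Complex.I * Φ y (Pi.single k Complex.I)))
    (contDiff_const.mul ((h1 _).sub (contDiff_const.mul (h1 _)))) with hg
  set g' : Fin n → Sm n c.dom := fun k => c.lift (fun y => (1 / 2 : ℂ) * (Φ y (Pi.single k 1) +
    Complex.I * Φ y (Pi.single k Complex.I)))
    (contDiff_const.mul ((h1 _).add (contDiff_const.mul (h1 _)))) with hg'
  have key : c.lift G hG = algebraMap ℂ _ (G (c.chart x)) +
      ∑ k, ((c.coord (Sum.inl k) - algebraMap ℂ _ (c.chart x k)) * g k +
        (c.coord (Sum.inr k) - algebraMap ℂ _ ((starRingEnd ℂ) (c.chart x k))) * g' k) := by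
    ext y
    rw [← evalAt_apply, ← evalAt_apply]
    simp only [map_add, map_sum, map_mul, map_sub, AlgHom.commutes]
    have e : G (c.chart y) = G (c.chart x) + Φ (c.chart y) (c.chart y - c.chart x) := by
      rw [← h]; ring
    refine Eq.trans e ?_
    rw [realLinear_eq_sum]
    refine congrArg₂ _ rfl (Finset.sum_congr rfl fun k _ => ?_)
    rw [Pi.sub_apply, map_sub]
    rfl
  have hx1 (k : Fin n) : evalAt x (c.coord (Sum.inl k)) = c.chart x k := rfl
  have hx2 (k : Fin n) : evalAt x (c.coord (Sum.inr k)) = (starRingEnd ℂ) (c.chart x k) := rfl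
  rw [key]
  simp [Derivation.leibniz, hE, hx1, hx2]

lemma HolChart.derivation_eq_zero (c : HolChart n M)
    (E : Derivation ℂ (Sm n c.dom) (Sm n c.dom)) (hE : ∀ i, E (c.coord i) = 0) : E = 0 := by
  ext f x
  change evalAt x (E f) = 0
  obtain ⟨ρ, hρ, hball⟩ := Metric.isOpen_iff.1 c.isOpen_image _ (c.map_mem_image x)
  -- The coordinate image need not be star-shaped, so Hadamard's lemma is applied on all of `ℂⁿ` to
  -- `χ` and to `χ f`, extended by zero. As `χ = 1` at the point, the Leibniz rule then gives `E f =
  -- 0` there.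
  let χ : ContDiffBump (c.chart x) := ⟨ρ / 4, ρ / 2, by positivity, by linarith⟩
  have hχ : ContDiff ℝ ∞ fun y => ((χ y : ℝ) : ℂ) :=
    Complex.ofRealCLM.contDiff.comp χ.contDiff
  have hG : ContDiff ℝ ∞ fun y => ((χ y : ℝ) : ℂ) * c.read f y := by
    refine contDiff_iff_contDiffAt.2 fun y => ?_
    by_cases hy : y ∈ c.image
    · exact hχ.contDiffAt.mul ((c.contDiffOn_read f).contDiffAt (c.isOpen_image.mem_nhds hy))
    · have hy' : y ∉ tsupport χ := by
        rw [χ.tsupport_eq]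
        intro h'
        refine hy (hball (Metric.closedBall_subset_ball ?_ h'))
        change ρ / 2 < ρ
        linarith
      have h0 : (fun y => ((χ y : ℝ) : ℂ) * c.read f y) =ᶠ[nhds y] fun _ => 0 := by
        filter_upwards [(isClosed_tsupport χ).isOpen_compl.mem_nhds hy'] with z hz
        rw [image_eq_zero_of_notMem_tsupport hz]
        simp
      exact contDiffAt_const.congr_of_eventuallyEq h0
  have hmul : c.lift _ hG = c.lift _ hχ * f := by
    ext y
    change _ = ((χ (c.chart y) : ℝ) : ℂ) * f.1 y
    rw [← c.read_chart f y]
    rfl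
  have e := c.derivation_lift_eq_zero E hE hG x
  have e1 : evalAt x (c.lift _ hχ) = 1 := by
    change ((χ (c.chart x) : ℝ) : ℂ) = 1
    rw [χ.one_of_mem_closedBall, Complex.ofReal_one]
    exact Metric.mem_closedBall_self (by change 0 ≤ ρ / 4; positivity)
  rw [hmul, Derivation.leibniz, map_add, smul_eq_mul, smul_eq_mul, map_mul, map_mul, e1,
    c.derivation_lift_eq_zero E hE hχ x, mul_zero, add_zero, one_mul] at e
  exact e

/-- The coordinates of a holomorphic chart. -/
def HolChart.coordSys (c : HolChart n M) : CoordSys (Sm n c.dom) (Idx n) where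
  x := c.coord
  D := c.partialDerivation
  D_x_self i := by rw [c.partialDerivation_apply, c.partial_coord, if_pos rfl]
  D_x_of_ne i j h := by rw [c.partialDerivation_apply, c.partial_coord, if_neg h]
  eq_zero := c.derivation_eq_zero

lemma HolChart.sigma_eq (c : HolChart n M) : c.sigma = c.coordSys.sigma := rfl

lemma HolChart.coordSys_baseDeriv (c : HolChart n M) : c.coordSys.baseDeriv = c.baseDeriv := by
  funext i P α
  exact c.partialDerivation_apply i _

lemma HolChart.poisson_eq (c : HolChart n M) : c.poisson = c.coordSys.poisson := by
  funext P Q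
  simp only [poisson, CoordSys.poisson, c.coordSys_baseDeriv]

lemma HolChart.expHam_eq (c : HolChart n M) : c.expHam = c.coordSys.expHam := by
  funext P Q α
  simp only [expHam, CoordSys.expHam, c.poisson_eq]

lemma HolChart.poissonEps_eq (c : HolChart n M) : c.poissonEps = c.coordSys.poissonEps := by
  funext P Q
  simp only [poissonEps, CoordSys.poissonEps, c.poisson_eq]
  rfl

lemma HolChart.expHamEps_eq (c : HolChart n M) : c.expHamEps = c.coordSys.expHamEps := by
  funext P Q
  simp only [expHamEps, CoordSys.expHamEps, c.poissonEps_eq]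
  rfl

end Charts

/-! ### Change of fibre coordinates -/

section LinearSubst

variable {R ι : Type*} [CommRing R] [Fintype ι]

lemma hasSubst_linear (m : ι → ι → R) :
    MvPowerSeries.HasSubst fun i : ι => ∑ j : ι, MvPowerSeries.C (m i j) *
      (MvPowerSeries.X j : MvPowerSeries ι R) :=
  MvPowerSeries.hasSubst_of_constantCoeff_zero fun i => by simp

lemma le_order_subst_linear (m : ι → ι → R) (P : MvPowerSeries ι R) :
    P.order ≤ (MvPowerSeries.subst (fun i : ι => ∑ j : ι, MvPowerSeries.C (m i j) *
      (MvPowerSeries.X j : MvPowerSeries ι R)) P).order := by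
  refine le_trans ?_ (MvPowerSeries.le_order_subst (hasSubst_linear m) P)
  refine le_mul_of_one_le_left zero_le (le_iInf fun i => ?_)
  exact MvPowerSeries.one_le_order_iff_constCoeff_eq_zero.2 (by simp)

lemma pderiv_linear (m : ι → ι → R) (i j : ι) :
    MvPowerSeries.pderiv R j (∑ j : ι, MvPowerSeries.C (m i j) *
      (MvPowerSeries.X j : MvPowerSeries ι R)) = MvPowerSeries.C (m i j) := by
  classical
  simp [Derivation.leibniz, MvPowerSeries.pderiv_X, Pi.single_apply]

/-- The chain rule holds for polynomials by induction. A given coefficient only sees a truncation of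
`P`, since linear substitution does not lower the order. -/
lemma pderiv_subst_linear (m : ι → ι → R) (P : MvPowerSeries ι R) (j : ι) :
    MvPowerSeries.pderiv R j (MvPowerSeries.subst (fun i : ι => ∑ j : ι, MvPowerSeries.C (m i j) *
      (MvPowerSeries.X j : MvPowerSeries ι R)) P) =
    ∑ i, MvPowerSeries.C (m i j) * MvPowerSeries.subst (fun i : ι => ∑ j : ι,
      MvPowerSeries.C (m i j) * (MvPowerSeries.X j : MvPowerSeries ι R))
        (MvPowerSeries.pderiv R i P) := by
  classical
  set a : ι → MvPowerSeries ι R := fun i => ∑ j : ι, MvPowerSeries.C (m i j) *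
      (MvPowerSeries.X j : MvPowerSeries ι R) with ha
  have hs : MvPowerSeries.HasSubst a := hasSubst_linear m
  have hpoly (p : MvPolynomial ι R) : MvPowerSeries.pderiv R j (MvPowerSeries.subst a
      (p : MvPowerSeries ι R)) = ∑ i, MvPowerSeries.C (m i j) *
        MvPowerSeries.subst a (MvPowerSeries.pderiv R i (p : MvPowerSeries ι R)) := by
    simp only [MvPowerSeries.pderiv_coe, MvPowerSeries.subst_coe]
    induction p using MvPolynomial.induction_on with
    | C r =>
      have : MvPolynomial.aeval a (MvPolynomial.C r) = (MvPowerSeries.C r : MvPowerSeries ι R) := by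
        simp [MvPowerSeries.algebraMap_apply]
      rw [this]
      simp
    | add p q hp hq => simp only [map_add, hp, hq, mul_add, Finset.sum_add_distrib]
    | mul_X p i hp =>
      have hi : MvPowerSeries.pderiv R j (a i) = MvPowerSeries.C (m i j) := pderiv_linear m i j
      simp only [map_mul, MvPolynomial.aeval_X, Derivation.leibniz, hp, hi, smul_eq_mul, map_add,
        MvPolynomial.pderiv_X, mul_add, Finset.sum_add_distrib]
      have e1 : ∑ x, MvPowerSeries.C (m x j) * (MvPolynomial.aeval a p *
          MvPolynomial.aeval a (Pi.single (M := fun _ => MvPolynomial ι R) x 1 i)) =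
          MvPolynomial.aeval a p * MvPowerSeries.C (m i j) := by
        rw [Finset.sum_eq_single i]
        · simp only [Pi.single_eq_same, map_one, mul_one]
          rw [mul_comm]
        · intro k _ hk
          simp [Pi.single_eq_of_ne hk.symm]
        · simp
      rw [e1, Finset.mul_sum]
      congr 1
      exact Finset.sum_congr rfl fun k _ => by ring
  ext β
  set e := β.degree
  -- The derivative shifts the degree by one, so terms up to degree `e + 1` are kept in order to
  -- compare coefficients of degree `e`.
  set p := MvPowerSeries.truncTotal (e + 2) P with hp
  have hQ : ((e + 2 : ℕ) : ℕ∞) ≤ (P - (p : MvPowerSeries ι R)).order :=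
    MvPowerSeries.nat_le_order fun d hd => by
      rw [map_sub, hp, MvPolynomial.coeff_coe, MvPowerSeries.coeff_truncTotal _ hd, sub_self]
  have hP : P = (p : MvPowerSeries ι R) + (P - p) := by ring
  set Q := P - (p : MvPowerSeries ι R) with hQd
  have h1 : MvPowerSeries.coeff β (MvPowerSeries.pderiv R j (MvPowerSeries.subst a Q)) = 0 := by
    rw [MvPowerSeries.coeff_pderiv, MvPowerSeries.coeff_of_lt_order, zero_mul]
    refine lt_of_lt_of_le ?_ (hQ.trans (le_order_subst_linear m Q))
    have : (β + Finsupp.single j 1).degree < e + 2 := by simp [e]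
    exact_mod_cast this
  have h2 (i : ι) : MvPowerSeries.coeff β (MvPowerSeries.C (m i j) *
      MvPowerSeries.subst a (MvPowerSeries.pderiv R i Q)) = 0 := by
    have h3 : ((e + 1 : ℕ) : ℕ∞) ≤ (MvPowerSeries.pderiv R i Q).order :=
      MvPowerSeries.nat_le_order fun d hd => by
        rw [MvPowerSeries.coeff_pderiv, MvPowerSeries.coeff_of_lt_order, zero_mul]
        refine lt_of_lt_of_le ?_ hQ
        have : (d + Finsupp.single i 1).degree < e + 2 := by simp; omega
        exact_mod_cast this
    rw [MvPowerSeries.coeff_C_mul, MvPowerSeries.coeff_of_lt_order, mul_zero]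
    refine lt_of_lt_of_le ?_ (h3.trans (le_order_subst_linear m _))
    exact_mod_cast Nat.lt_succ_self e
  rw [hP, MvPowerSeries.subst_add hs, map_add, map_add, h1, add_zero, hpoly]
  simp only [map_add, MvPowerSeries.subst_add hs, mul_add, Finset.sum_add_distrib]
  rw [map_sum, map_sum (MvPowerSeries.coeff β) (fun i => MvPowerSeries.C (m i j) *
    MvPowerSeries.subst a (MvPowerSeries.pderiv R i Q)), Finset.sum_eq_zero fun i _ => h2 i,
    add_zero]

end LinearSubst

namespace CoordSys

variable {R : Type*} [CommRing R] [Algebra ℂ R] {ι : Type*} [Fintype ι]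

lemma poisson_C (S : CoordSys R ι) (P : MvPowerSeries ι R) (f : R) :
    S.poisson P (MvPowerSeries.C f) =
      ∑ i, MvPowerSeries.C (S.D i f) * MvPowerSeries.pderiv R i P := by
  classical
  have h (j : ι) : S.baseDeriv j (MvPowerSeries.C f) = MvPowerSeries.C (S.D j f) := by
    ext α
    rw [coeff_baseDeriv, MvPowerSeries.coeff_C, MvPowerSeries.coeff_C]
    split_ifs <;> simp
  simp [poisson, h, mul_comm]

/-- Symbols do not depend on the coordinates. A fibre derivative in the new system is the symbol of
`ν⁻¹[A, x'_j]`; computed in the old system this is `{σ(A), x'_j}`, and the chain rule gives the same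
expression for the substituted symbol. -/
lemma subst_sigma (S S' : CoordSys R ι) {A : PowerSeries (Module.End ℂ R)} (hA : IsNatural A) :
    MvPowerSeries.subst (fun i : ι => ∑ j : ι, MvPowerSeries.C (S.D i (S'.x j)) *
      (MvPowerSeries.X j : MvPowerSeries ι R)) (S.sigma A) = S'.sigma A := by
  have hs := hasSubst_linear fun i j => S.D i (S'.x j)
  refine ext_degree fun d => ?_
  induction d generalizing A with
  | zero =>
    intro α hα
    obtain rfl := (Finsupp.degree_eq_zero_iff α).1 hα
    have h1 : S.sigma A = MvPowerSeries.C (PowerSeries.coeff 0 A 1) +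
        (S.sigma A - MvPowerSeries.C (PowerSeries.coeff 0 A 1)) := by ring
    rw [h1, MvPowerSeries.subst_add hs, MvPowerSeries.subst_C, map_add,
      MvPowerSeries.coeff_zero_eq_constantCoeff_apply _, MvPowerSeries.constantCoeff_C,
      MvPowerSeries.coeff_zero_eq_constantCoeff_apply (MvPowerSeries.subst _ _),
      MvPowerSeries.constantCoeff_subst_eq_zero hs (fun i => by simp), add_zero,
      S'.constantCoeff_sigma]
    rw [map_sub, MvPowerSeries.constantCoeff_C, ← MvPowerSeries.coeff_zero_eq_constantCoeff_apply,
      S.constantCoeff_sigma, sub_self]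
  | succ d ih =>
    refine coeff_eq_of_pderiv fun j β hβ => ?_
    have hx := isNatural_C (S'.x j)
    rw [S'.pderiv_sigma, ← ih (hA.divNu_lie hx) β hβ, S.sigma_divNu_lie hA hx, S.sigma_C,
      poisson_C, pderiv_subst_linear, ← MvPowerSeries.coe_substAlgHom hs,
      map_sum (MvPowerSeries.substAlgHom hs)]
    congr 1
    refine Finset.sum_congr rfl fun i _ => ?_
    rw [map_mul, MvPowerSeries.coe_substAlgHom, MvPowerSeries.subst_C]

end CoordSys

/-! ### Locality and globalization -/

section Restriction

lemma iterComm_map {R R' : Type*} [CommRing R] [Algebra ℂ R] [CommRing R'] [Algebra ℂ R']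
    (ρ : R →ₐ[ℂ] R') {ι : Type*} (x : ι → R) {A : Module.End ℂ R} {A' : Module.End ℂ R'}
    (h : ∀ f, ρ (A f) = A' (ρ f)) (α : ι →₀ ℕ) (f : R) :
    ρ (iterComm x α A f) = iterComm (fun i => ρ (x i)) α A' (ρ f) := by
  simp only [iterComm]
  induction Finsupp.toMultiset α using Multiset.induction_on generalizing f with
  | empty => simpa using h f
  | cons i s ih =>
    simp only [Multiset.foldr_cons, LinearMap.sub_apply, Module.End.mul_apply,
      LinearMap.mulLeft_apply, map_sub, map_mul, ih]

lemma map_sigma {R R' : Type*} [CommRing R] [Algebra ℂ R] [CommRing R'] [Algebra ℂ R']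
    (ρ : R →ₐ[ℂ] R') {ι : Type*} [Fintype ι] (S : CoordSys R ι) (S' : CoordSys R' ι)
    (hx : ∀ i, ρ (S.x i) = S'.x i) {A : PowerSeries (Module.End ℂ R)}
    {A' : PowerSeries (Module.End ℂ R')}
    (h : ∀ r f, ρ (PowerSeries.coeff r A f) = PowerSeries.coeff r A' (ρ f)) :
    MvPowerSeries.map ρ.toRingHom (S.sigma A) = S'.sigma A' := by
  ext α
  rw [MvPowerSeries.coeff_map, S.coeff_sigma, S'.coeff_sigma, ← funext hx]
  refine (map_smul ρ _ _).trans ?_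
  rw [iterComm_map ρ S.x (h _), map_one]

variable {n : ℕ} {M : Type*} [TopologicalSpace M] [ChartedSpace (Fin n → ℂ) M]

/-- Vanishing can be tested locally, and commutators with functions on `U` restrict to commutators
on smaller sets. -/
lemma mem_orderLT_of_local {U : Opens M} {s : ℕ} {A : Module.End ℂ (Sm n U)}
    (h : ∀ x : U, ∃ (V : Opens M) (hV : V ≤ U) (A' : Module.End ℂ (Sm n V)), x.1 ∈ V ∧
      (∀ f, res n hV (A f) = A' (res n hV f)) ∧ A' ∈ orderLT s) : A ∈ orderLT s := by
  induction s generalizing A with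
  | zero =>
    rw [mem_orderLT_zero]
    ext f x
    obtain ⟨V, hV, A', hx, hA, h0⟩ := h x
    have := hA f
    rw [mem_orderLT_zero.1 h0, LinearMap.zero_apply] at this
    exact congrFun (congrArg Subtype.val this) ⟨x.1, hx⟩
  | succ s ih =>
    refine mem_orderLT_succ.2 fun f => ih fun x => ?_
    obtain ⟨V, hV, A', hx, hA, h0⟩ := h x
    refine ⟨V, hV, ⁅A', mulOp (res n hV f)⁆, hx, fun g => ?_, mem_orderLT_succ.1 h0 _⟩
    simp only [Ring.lie_def, LinearMap.sub_apply, Module.End.mul_apply, LinearMap.mulLeft_apply,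
      map_sub, map_mul, hA]

/-- The coefficients of a formal operator commute with restrictions. -/
def IsLocal (A : FormalOp n M) : Prop :=
  ∀ (r : ℕ) {V U : Opens M} (h : V ≤ U) (f : Sm n U),
    res n h (PowerSeries.coeff r (A U) f) = PowerSeries.coeff r (A V) (res n h f)

variable [IsManifold 𝓘(ℂ, Fin n → ℂ) ω M]

lemma IsLocal.isNatural {A : FormalOp n M} (hA : IsLocal A)
    (h : ∀ c : HolChart n M, IsNatural (A c.dom)) (U : Opens M) : IsNatural (A U) :=
  isNatural_iff.2 fun r => mem_orderLT_of_local fun x => by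
    let c : HolChart n M :=
      { chart := chartAt (Fin n → ℂ) x.1
        mem_atlas := IsManifold.chart_mem_maximalAtlas x.1
        dom := U ⊓ ⟨(chartAt (Fin n → ℂ) x.1).source, (chartAt (Fin n → ℂ) x.1).open_source⟩
        dom_le := fun y hy => hy.2 }
    exact ⟨c.dom, inf_le_left, PowerSeries.coeff r (A c.dom), ⟨x.2, mem_chart_source _ x.1⟩,
      hA r _, isNatural_iff.1 (h c) r⟩

lemma HolChart.restrict_coord (c : HolChart n M) (W : Opens M) (h : W ≤ c.dom) (i : Idx n) :
    res n h (c.coord i) = (c.restrict W h).coord i := by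
  cases i <;> rfl

/-- The coordinates of a chart on a smaller open set. -/
def HolChart.restrictSys (c : HolChart n M) (W : Opens M) (h : W ≤ c.dom) :
    CoordSys (Sm n W) (Idx n) :=
  (c.restrict W h).coordSys

lemma IsLocal.isGlobal_sigma {A : FormalOp n M} (hA : IsLocal A) (hn : ∀ U, IsNatural (A U)) :
    IsGlobal fun c : HolChart n M => c.sigma (A c.dom) := by
  intro c d W hc hd
  have e (c : HolChart n M) (hc : W ≤ c.dom) : c.resFun hc (c.sigma (A c.dom)) =
      (c.restrictSys W hc).sigma (A W) :=
    map_sigma (res n hc) c.coordSys (c.restrictSys W hc) (c.restrict_coord W hc)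
      fun r f => hA r hc f
  rw [e c hc, e d hd, ← (c.restrictSys W hc).subst_sigma (d.restrictSys W hd) (hn W)]
  congr 1
  funext i
  refine Finset.sum_congr rfl fun j _ => ?_
  have h : (c.restrict W hc).partial i (res n hd (d.coord j)) =
      (c.restrictSys W hc).D i ((d.restrictSys W hd).x j) :=
    (congrArg _ (d.restrict_coord W hd j)).trans
      ((c.restrict W hc).partialDerivation_apply i _).symm
  exact congrArg (fun g : Sm n W =>
    MvPowerSeries.C g * (MvPowerSeries.X j : MvPowerSeries (Idx n) (Sm n W))) h

end Restriction

/-! ### Holomorphic and antiholomorphic functions -/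

section Holomorphic

variable {n : ℕ} {M : Type*} [TopologicalSpace M] [ChartedSpace (Fin n → ℂ) M]

variable (n) in
/-- The holomorphic functions as a submonoid. -/
def holSubmonoid (U : Opens M) : Submonoid (Sm n U) where
  carrier := {f | IsHol f}
  mul_mem' {f g} (hf : MDifferentiable 𝓘(ℂ, Fin n → ℂ) 𝓘(ℂ, ℂ) f.1)
    (hg : MDifferentiable 𝓘(ℂ, Fin n → ℂ) 𝓘(ℂ, ℂ) g.1) := hf.mul hg
  one_mem' := mdifferentiable_const

variable (n) in
/-- The antiholomorphic functions as a submonoid. -/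
def antiholSubmonoid (U : Opens M) : Submonoid (Sm n U) where
  carrier := {f | IsAntihol f}
  mul_mem' {f g}
    (hf : MDifferentiable 𝓘(ℂ, Fin n → ℂ) 𝓘(ℂ, ℂ) fun x => (starRingEnd ℂ) (f.1 x))
    (hg : MDifferentiable 𝓘(ℂ, Fin n → ℂ) 𝓘(ℂ, ℂ) fun x => (starRingEnd ℂ) (g.1 x)) := by
    have h : MDifferentiable 𝓘(ℂ, Fin n → ℂ) 𝓘(ℂ, ℂ)
        fun x => (starRingEnd ℂ) (f.1 x * g.1 x) := by
      simp only [map_mul]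
      exact hf.mul hg
    exact h
  one_mem' := by
    have : MDifferentiable 𝓘(ℂ, Fin n → ℂ) 𝓘(ℂ, ℂ) fun _ : U => (starRingEnd ℂ) 1 :=
      mdifferentiable_const
    exact this

lemma HolChart.mdifferentiable_coord (c : HolChart n M) (k : Fin n) :
    MDifferentiable 𝓘(ℂ, Fin n → ℂ) 𝓘(ℂ, ℂ) fun x : c.dom => c.chart x k := by
  intro x
  have h2 := contMDiffOn_of_mem_maximalAtlas c.mem_atlas
  have h3 : ContMDiffAt 𝓘(ℂ, Fin n → ℂ) 𝓘(ℂ, ℂ) ω (fun x : c.dom => c.chart x k) x :=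
    (contMDiffAt_subtype_iff (I := 𝓘(ℂ, Fin n → ℂ)) (I' := 𝓘(ℂ, ℂ)) (n := ω)
      (f := fun x : M => c.chart x k) (x := x)).2
      (ContMDiffAt.comp (x : M)
        (ContinuousLinearMap.proj k : (Fin n → ℂ) →L[ℂ] ℂ).contMDiff.contMDiffAt
        (h2.contMDiffAt (c.chart.open_source.mem_nhds (c.dom_le x.2))))
  exact h3.mdifferentiableAt (by simp)

variable [IsManifold 𝓘(ℂ, Fin n → ℂ) ω M]

lemma HolChart.isHol_coord (c : HolChart n M) (k : Fin n) : IsHol (c.coord (Sum.inl k)) :=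
  c.mdifferentiable_coord k

lemma HolChart.isAntihol_coord (c : HolChart n M) (k : Fin n) :
    IsAntihol (c.coord (Sum.inr k)) := by
  have h : MDifferentiable 𝓘(ℂ, Fin n → ℂ) 𝓘(ℂ, ℂ)
      fun x : c.dom => (starRingEnd ℂ) ((starRingEnd ℂ) (c.chart x k)) := by
    simpa only [Complex.conj_conj] using c.mdifferentiable_coord k
  exact h

end Holomorphic

/-! ### Coefficients of the star product -/

section StarMul

variable {R : Type*} [CommRing R] [Algebra ℂ R] (C : ℕ → R →ₗ[ℂ] R →ₗ[ℂ] R)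

lemma coeff_starMul_C_right (F : PowerSeries R) (h : R) (s : ℕ) :
    PowerSeries.coeff s (starMul C F (PowerSeries.C h)) =
      ∑ p ∈ Finset.HasAntidiagonal.antidiagonal s, C p.1 (PowerSeries.coeff p.2 F) h := by
  rw [starMul, PowerSeries.coeff_mk]
  refine Finset.sum_congr rfl fun p _ => ?_
  rw [Finset.sum_eq_single (p.2, 0)]
  · simp
  · rintro ⟨i, j⟩ hq hne
    have := Finset.HasAntidiagonal.mem_antidiagonal.1 hq
    have hj : j ≠ 0 := by rintro rfl; exact hne (by simpa using this)
    simp [PowerSeries.coeff_C, hj]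
  · intro h0
    exact absurd (Finset.HasAntidiagonal.mem_antidiagonal.2 (add_zero p.2)) h0

lemma coeff_starMul_C_left (f : R) (G : PowerSeries R) (s : ℕ) :
    PowerSeries.coeff s (starMul C (PowerSeries.C f) G) =
      ∑ p ∈ Finset.HasAntidiagonal.antidiagonal s, C p.1 f (PowerSeries.coeff p.2 G) := by
  rw [starMul, PowerSeries.coeff_mk]
  refine Finset.sum_congr rfl fun p _ => ?_
  rw [Finset.sum_eq_single (0, p.2)]
  · simp
  · rintro ⟨i, j⟩ hq hne
    have := Finset.HasAntidiagonal.mem_antidiagonal.1 hq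
    have hj : i ≠ 0 := by rintro rfl; exact hne (by simpa using this)
    simp [PowerSeries.coeff_C, hj]
  · intro h0
    exact absurd (Finset.HasAntidiagonal.mem_antidiagonal.2 (zero_add p.2)) h0

lemma coeff_starMul_C_C (f g : R) (s : ℕ) :
    PowerSeries.coeff s (starMul C (PowerSeries.C f) (PowerSeries.C g)) = C s f g := by
  rw [coeff_starMul_C_right, Finset.sum_eq_single (s, 0)]
  · simp
  · rintro ⟨i, j⟩ hq hne
    have := Finset.HasAntidiagonal.mem_antidiagonal.1 hq
    have hj : j ≠ 0 := by rintro rfl; exact hne (by simpa using this)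
    simp [PowerSeries.coeff_C, hj]
  · intro h0
    exact absurd (Finset.HasAntidiagonal.mem_antidiagonal.2 (add_zero s)) h0

end StarMul

/-! ### The symbol of one exponent -/

section Main

variable {n : ℕ} {M : Type*} [TopologicalSpace M] [ChartedSpace (Fin n → ℂ) M]
  {π : PoissonStructure n M}

/-- The star product over an open set. -/
def StarProduct.sepStar (st : StarProduct π) (hst : st.SeparationOfVariables) (U : Opens M) :
    SepStar (Sm n U) where
  C r := st.C r U
  hol := holSubmonoid n U
  antihol := antiholSubmonoid n U
  bidiff_left r := by
    obtain ⟨N, hN⟩ := st.bidifferential r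
    exact ⟨N + 1, fun f => hasOrder_iff.1 (hN U f).1⟩
  bidiff_right r := by
    obtain ⟨N, hN⟩ := st.bidifferential r
    exact ⟨N + 1, fun f => hasOrder_iff.1 (hN U f).2⟩
  C_zero := st.C_zero U
  C_one_left r f := by
    have h := congrArg (PowerSeries.coeff (r + 1)) (st.one_mul U (PowerSeries.C f))
    rw [← map_one PowerSeries.C, coeff_starMul_C_C, PowerSeries.coeff_C,
      if_neg (Nat.succ_ne_zero r)] at h
    exact h
  C_one_right r f := by
    have h := congrArg (PowerSeries.coeff (r + 1)) (st.mul_one U (PowerSeries.C f))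
    rw [← map_one PowerSeries.C, coeff_starMul_C_C, PowerSeries.coeff_C,
      if_neg (Nat.succ_ne_zero r)] at h
    exact h
  assoc r f g h := by
    have e := congrArg (PowerSeries.coeff r)
      (st.assoc U (PowerSeries.C f) (PowerSeries.C g) (PowerSeries.C h))
    rw [coeff_starMul_C_right, coeff_starMul_C_left] at e
    simpa only [coeff_starMul_C_C] using e
  sep_left r a ha f g := (hst r U f g).1 a ha
  sep_right r b hb f g := (hst r U f g).2 b hb

lemma isLog_of_isExponent {st : StarProduct π} (hst : st.SeparationOfVariables) {B X : FormalOp n M}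
    (hB : st.IsBerezinTransform B) (hX : IsExponent B X) (U : Opens M) :
    (st.sepStar hst U).IsLog (X U) where
  mem_diffOp r := by
    obtain ⟨N, hN⟩ := (hX.1 r).2
    exact mem_diffOp_of_hasOrder (hN U)
  coeff_zero := (hX.2 U).1
  coeff_one := (hX.2 U).2.1
  isBerezin := by
    rw [← (hX.2 U).2.2]
    refine ⟨fun r => ?_, fun r a ha b hb => hB.2 U a b ha hb r⟩
    obtain ⟨N, hN⟩ := (hB.1 r).2
    exact mem_diffOp_of_hasOrder (hN U)

lemma isPair (st st' : StarProduct π) (hst : st.SeparationOfVariables)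
    (hst' : st'.SeparationOfVariables) (U : Opens M) :
    (st.sepStar hst U).IsPair (st'.sepStar hst' U) where
  hol_eq := rfl
  antihol_eq := rfl
  commutator_eq f g := (st.C_one U f g).trans (st'.C_one U f g).symm

variable [IsManifold 𝓘(ℂ, Fin n → ℂ) ω M]

lemma adapted (st : StarProduct π) (hst : st.SeparationOfVariables) (c : HolChart n M) :
    (st.sepStar hst c.dom).Adapted c.coordSys where
  hol k := c.isHol_coord k
  antihol k := c.isAntihol_coord k

lemma isKahlerPoissonElement_of_isLog (st : StarProduct π) (hst : st.SeparationOfVariables)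
    {X : FormalOp n M} (hl : IsLocal X) (hX : ∀ U, (st.sepStar hst U).IsLog (X U)) :
    HasSymbol X (fun c => c.sigma (X c.dom)) ∧
      IsKahlerPoissonElement π fun c => c.sigma (X c.dom) := by
  have hn := hl.isNatural fun c => (hX c.dom).isNatural (adapted st hst c)
  have hg := hl.isGlobal_sigma hn
  refine ⟨⟨hn, hg, fun c => rfl⟩, ⟨hg, fun c => ⟨?_, ?_, ?_⟩⟩, fun c α hα => ?_⟩
  · exact (hX c.dom).coeff_sigma_eq_zero (S := c.coordSys)
  · intro a a' ha ha'
    rw [c.poisson_eq, c.expHam_eq]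
    exact (hX c.dom).poisson_expHam_hol (adapted st hst c) ha ha'
  · intro b b' hb hb'
    rw [c.poisson_eq, c.expHam_eq]
    exact (hX c.dom).poisson_expHam_antihol (adapted st hst c) hb hb'
  · refine ((hX c.dom).coeff_sigma_two (adapted st hst c) α hα).trans ?_
    simp only [← st.C_one]
    rfl

/-- The defining equations of `𝒦`, used only on coordinate functions, already determine the element
from its quadratic component chart by chart. -/
lemma IsKahlerPoissonElement.eq {K K' : CotFun n M} (hK : IsKahlerPoissonElement π K)
    (hK' : IsKahlerPoissonElement π K') : K = K' := by
  funext c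
  have key {K : CotFun n M} (hK : IsKahlerPoissonElement π K) (i j : Idx n)
      (h : i.isLeft = j.isLeft) : c.coordSys.poisson (c.coordSys.expHam (K c)
        (MvPowerSeries.C (c.coordSys.x i))) (MvPowerSeries.C (c.coordSys.x j)) = 0 := by
    have h1 := (hK.1.2 c).2
    rw [c.poisson_eq, c.expHam_eq] at h1
    obtain i | i := i <;> obtain j | j := j
    · exact h1.1 _ _ (c.isHol_coord i) (c.isHol_coord j)
    · simp at h
    · simp at h
    · exact h1.2 _ _ (c.isAntihol_coord i) (c.isAntihol_coord j)
  exact c.coordSys.eq_of_poisson_expHam_eq_zero (hK.1.2 c).1 (hK'.1.2 c).1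
    (fun α hα => (hK.2 c α hα).trans (hK'.2 c α hα).symm) (key hK) (key hK')

end Main

/-! ### The pair of star products on the manifold -/

section Pair

variable {n : ℕ} {M : Type*} [TopologicalSpace M] [ChartedSpace (Fin n → ℂ) M]
  [IsManifold 𝓘(ℂ, Fin n → ℂ) ω M] {π : PoissonStructure n M}
  {st st' : StarProduct π} {hst : st.SeparationOfVariables} {hst' : st'.SeparationOfVariables}

lemma sameGroupoid_of_isLog {X X' : FormalOp n M} (hX : ∀ U, (st.sepStar hst U).IsLog (X U))
    (hX' : ∀ U, (st'.sepStar hst' U).IsLog (X' U)) : SameGroupoid st st' := by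
  intro c f
  have hS := adapted st hst c
  have hS' := adapted st' hst' c
  have hP := isPair st st' hst hst' c.dom
  obtain ⟨h1, h2, h3⟩ := SepStar.sigma_eq_of_coeff_sub_mem c.coordSys fun r =>
    hP.coeff_L_sub_mem hS hS' (hX c.dom) (hX' c.dom) f r
  obtain ⟨h4, h5, h6⟩ := SepStar.sigma_eq_of_coeff_sub_mem c.coordSys fun r =>
    hP.coeff_Rt_sub_mem hS hS' (hX c.dom) (hX' c.dom) f r
  exact ⟨⟨(hX c.dom).isNatural_L hS f, (hX' c.dom).isNatural_L hS' f, h1, h2, h3⟩,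
    ⟨(hX c.dom).isNatural_Rt hS f, (hX' c.dom).isNatural_Rt hS' f, h4, h5, h6⟩⟩

lemma hasSymbol_divNu_sub {X X' : FormalOp n M} (hl : IsLocal X) (hl' : IsLocal X')
    (hX : ∀ U, (st.sepStar hst U).IsLog (X U)) (hX' : ∀ U, (st'.sepStar hst' U).IsLog (X' U)) :
    HasSymbol (fun U => divNu (X U - X' U)) fun c => c.sigma (divNu (X c.dom - X' c.dom)) := by
  have hW : IsLocal fun U => divNu (X U - X' U) := fun r V U h f => by
    have e (U : Opens M) (f : Sm n U) : PowerSeries.coeff r (divNu (X U - X' U)) f =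
        PowerSeries.coeff (r + 1) (X U) f - PowerSeries.coeff (r + 1) (X' U) f := by
      refine (DFunLike.congr_fun (coeff_divNu (X U - X' U) r) f).trans ?_
      rw [map_sub, LinearMap.sub_apply]
    rw [e, e, map_sub, hl (r + 1) h f, hl' (r + 1) h f]
  have hn := hW.isNatural fun c => (isPair st st' hst hst' c.dom).isNatural_divNu
    (adapted st hst c) (adapted st' hst' c) (hX c.dom) (hX' c.dom)
  exact ⟨hn, hW.isGlobal_sigma hn, fun c => rfl⟩

/-- The quotient `ν⁻¹(X - X')` begins only at `ν²`: its coefficient at `ν` is `X₂ - X'₂`, which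
vanishes because both operators are determined by the Poisson bracket. -/
lemma coeff_sigma_divNu_sub {X X' : FormalOp n M} (hX : ∀ U, (st.sepStar hst U).IsLog (X U))
    (hX' : ∀ U, (st'.sepStar hst' U).IsLog (X' U)) (c : HolChart n M) (α : Idx n →₀ ℕ)
    (hα : α.degree < 2) :
    MvPowerSeries.coeff α (c.sigma (divNu (X c.dom - X' c.dom))) = 0 := by
  have h : PowerSeries.coeff (α.degree + 1) (X c.dom - X' c.dom) = 0 := by
    rw [map_sub, sub_eq_zero]
    obtain h | h : α.degree = 0 ∨ α.degree = 1 := by omega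
    · rw [h, (hX c.dom).coeff_one, (hX' c.dom).coeff_one]
    · rw [h]
      exact (isPair st st' hst hst' c.dom).coeff_two_eq (adapted st hst c) (hX c.dom) (hX' c.dom)
  have e : PowerSeries.coeff α.degree (divNu (X c.dom - X' c.dom)) = 0 :=
    (coeff_divNu (X c.dom - X' c.dom) α.degree).trans h
  rw [c.sigma_eq, c.coordSys.coeff_sigma, e, ← iterCommHom_apply]
  simp

lemma expHamEps_eq {X X' : FormalOp n M} (hX : ∀ U, (st.sepStar hst U).IsLog (X U))
    (hX' : ∀ U, (st'.sepStar hst' U).IsLog (X' U)) (c : HolChart n M)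
    {F : DualNumber c.Fun} (hF : F.fst = c.sigma (X c.dom))
    (hF' : F.snd = c.sigma (divNu (X c.dom - X' c.dom))) (f : Sm n c.dom) :
    (c.expHamEps F (c.pullEps f)).fst =
        c.sigma (expAd (divNu (X c.dom)) (PowerSeries.C (mulOp f))) ∧
      (c.expHamEps F (c.pullEps f)).snd =
        c.sigma (divNu (expAd (divNu (X c.dom)) (PowerSeries.C (mulOp f)) -
          expAd (divNu (X' c.dom)) (PowerSeries.C (mulOp f)))) := by
  have hS := adapted st hst c
  have hS' := adapted st' hst' c
  have hP := isPair st st' hst hst' c.dom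
  have h := hX c.dom
  have h' := hX' c.dom
  rw [c.expHamEps_eq]
  exact c.coordSys.expHamEps_eq (h.isNatural hS) (h'.isNatural hS') h.coeff_zero h'.coeff_zero
    h.coeff_one h'.coeff_one (hP.coeff_two_eq hS h h') (hP.sigma_eq hS hS' h h')
    (hP.isNatural_divNu hS hS' h h') f hF hF' rfl rfl

lemma mem_calKEps {X X' : FormalOp n M} (hl : IsLocal X) (hl' : IsLocal X')
    (hX : ∀ U, (st.sepStar hst U).IsLog (X U)) (hX' : ∀ U, (st'.sepStar hst' U).IsLog (X' U))
    {F : DualNumber (CotFun n M)} (hF : F.fst = fun c => c.sigma (X c.dom))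
    (hF' : F.snd = fun c => c.sigma (divNu (X c.dom - X' c.dom))) : F ∈ calKEps n M := by
  refine ⟨hF ▸ (isKahlerPoissonElement_of_isLog st hst hl hX).1.2.1,
    hF' ▸ (hasSymbol_divNu_sub hl hl' hX hX').2.1, fun c => ⟨fun α hα => ⟨?_, ?_⟩, ?_⟩⟩
  · rw [hF]
    exact (hX c.dom).coeff_sigma_eq_zero (S := c.coordSys) α hα
  · rw [hF']
    exact coeff_sigma_divNu_sub hX hX' c α hα
  · have hS := adapted st hst c
    have hS' := adapted st' hst' c
    have hP := isPair st st' hst hst' c.dom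
    have h := hX c.dom
    have h' := hX' c.dom
    have hE := expHamEps_eq hX hX' c (F := c.eval F) (congrFun hF c) (congrFun hF' c)
    constructor
    · intro a a' ha ha'
      rw [c.poissonEps_eq]
      exact SepStar.poissonEps_eq_zero ((h.isNatural hS).expAd h.coeff_zero a)
        (hP.coeff_sub_mem hS hS' h h' a) a' (h.lie_hol hS ha ha') (h'.lie_hol hS' ha ha')
        (hE a).1 (hE a).2 rfl rfl
    · intro b b' hb hb'
      rw [c.poissonEps_eq]
      exact SepStar.poissonEps_eq_zero ((h.isNatural hS).expAd h.coeff_zero b)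
        (hP.coeff_sub_mem hS hS' h h' b) b' (h.lie_antihol hS hb hb') (h'.lie_antihol hS' hb hb')
        (hE b).1 (hE b).2 rfl rfl

lemma expHamEps_eq_source {X X' : FormalOp n M} (hX : ∀ U, (st.sepStar hst U).IsLog (X U))
    (hX' : ∀ U, (st'.sepStar hst' U).IsLog (X' U)) (c : HolChart n M)
    {F : DualNumber c.Fun} (hF : F.fst = c.sigma (X c.dom))
    (hF' : F.snd = c.sigma (divNu (X c.dom - X' c.dom))) {b : Sm n c.dom} (hb : IsAntihol b) :
    c.expHamEps F (c.pullEps b) = c.source st st' b := by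
  obtain ⟨h1, h2⟩ := expHamEps_eq hX hX' c hF hF' b
  rw [← (hX c.dom).L_eq (adapted st hst c) hb] at h1 h2
  rw [← (hX' c.dom).L_eq (adapted st' hst' c) hb] at h2
  exact TrivSqZeroExt.ext h1 h2

lemma expHamEps_eq_target {X X' : FormalOp n M} (hX : ∀ U, (st.sepStar hst U).IsLog (X U))
    (hX' : ∀ U, (st'.sepStar hst' U).IsLog (X' U)) (c : HolChart n M)
    {F : DualNumber c.Fun} (hF : F.fst = c.sigma (X c.dom))
    (hF' : F.snd = c.sigma (divNu (X c.dom - X' c.dom))) {a : Sm n c.dom} (ha : IsHol a) :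
    c.expHamEps F (c.pullEps a) = c.target st st' a := by
  obtain ⟨h1, h2⟩ := expHamEps_eq hX hX' c hF hF' a
  rw [← (hX c.dom).Rt_eq (adapted st hst c) ha] at h1 h2
  rw [← (hX' c.dom).Rt_eq (adapted st' hst' c) ha] at h2
  exact TrivSqZeroExt.ext h1 h2

end Pair

end BerezinLog

end

theorem mainTheorem6 {n : ℕ} {M : Type*} [TopologicalSpace M] [T2Space M]
    [SecondCountableTopology M] [ChartedSpace (Fin n → ℂ) M]
    [IsManifold 𝓘(ℂ, Fin n → ℂ) ω M]
    (π : PoissonStructure n M) (hπ : π.IsKahlerPoisson)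
    (st st' : StarProduct π)
    (hst : st.SeparationOfVariables) (hst' : st'.SeparationOfVariables)
    (B B' X X' : FormalOp n M)
    (hB : st.IsBerezinTransform B) (hB' : st'.IsBerezinTransform B')
    (hX : IsExponent B X) (hX' : IsExponent B' X') :
    SameGroupoid st st' ∧
    ∃ (K J : CotFun n M) (F : DualNumber (CotFun n M)),
      IsKahlerPoissonElement π K ∧
      (∀ K₁ : CotFun n M, IsKahlerPoissonElement π K₁ → K₁ = K) ∧
      HasSymbol X K ∧ HasSymbol X' K ∧
      HasSymbol (fun U => divNu (X U - X' U)) J ∧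
      F = TrivSqZeroExt.inl K + TrivSqZeroExt.inr J ∧ F ∈ calKEps n M ∧
      ∀ c : HolChart n M,
        (∀ b : Sm n c.dom, IsAntihol b →
          c.expHamEps (c.eval F) (c.pullEps b) = c.source st st' b) ∧
        (∀ a : Sm n c.dom, IsHol a →
          c.expHamEps (c.eval F) (c.pullEps a) = c.target st st' a) := by
  have hl : IsLocal X := fun r _ _ h f => (hX.1 r).1 h f
  have hl' : IsLocal X' := fun r _ _ h f => (hX'.1 r).1 h f
  have hL := isLog_of_isExponent hst hB hX
  have hL' := isLog_of_isExponent hst' hB' hX'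
  obtain ⟨hK, hK1⟩ := isKahlerPoissonElement_of_isLog st hst hl hL
  obtain ⟨hK', hK1'⟩ := isKahlerPoissonElement_of_isLog st' hst' hl' hL'
  -- `K` is taken to be `σ(X)`. Both `σ(X)` and `σ(X')` lie in `𝒦` with the same quadratic
  -- component, so uniqueness identifies them and `K` also serves as the symbol of `X'`.
  refine ⟨sameGroupoid_of_isLog hL hL', fun c => c.sigma (X c.dom),
    fun c => c.sigma (divNu (X c.dom - X' c.dom)), _, hK1, fun K₁ h => h.eq hK1, hK,
    hK1'.eq hK1 ▸ hK', hasSymbol_divNu_sub hl hl' hL hL', rfl,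
    mem_calKEps hl hl' hL hL' (by simp) (by simp), fun c => ⟨fun b hb => ?_, fun a ha => ?_⟩⟩
  · exact expHamEps_eq_source hL hL' c (by simp [HolChart.eval]) (by simp [HolChart.eval]) hb
  · exact expHamEps_eq_target hL hL' c (by simp [HolChart.eval]) (by simp [HolChart.eval]) ha
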